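/- All knots are smooth and unoriented: a knot is the image of a smooth embedding of $S^1$ in $S^3$. Let $D^3\subset\mathbb R^3$ be the closed unit ball, and let $T\subset D^3$ be the trivial $2$-stranded tangle consisting of the two vertical segments of $D^3$ in the plane $y=0$ with $x=-\tfrac12$ and $x=\tfrac12$. These segments cut off from the disk $D^3\cap\{y=0\}$ the left half-moon $H_-=\{x\le-\tfrac12\}$ and the right half-moon $H_+=\{x\ge\tfrac12\}$; let $\alpha_\pm=H_\pm\cap\partial D^3$. A *ribbon band* is a $2$-stranded tangle $R=R_-\cup R_+\subset D^3$ for which there are smoothly embedded disks $D_-,D_+\subset D^3$ (smooth embeddings of $H_-$ and $H_+$ that are the inclusion near $\alpha_\pm$ and map everything else into the interior of $D^3$) such that $\partial D_\pm=\alpha_\pm\cup R_\pm$ and such that $D_-\cap D_+$ consists of exactly two disjoint ribbon singularities. Here a *ribbon singularity* is a transverse double arc that, in one of the two disks, is properly embedded with both end points on the strand of $R$, and lies in the interior of the other disk. A knot $K'$ is obtained from a knot $K$ by a *ribbon band attachment* if there are a smoothly embedded closed $3$-ball $\varphi\colon D^3\hookrightarrow S^3$ with $K\cap\varphi(D^3)=\varphi(T)$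 and a ribbon band $R$ such that $K'=(K\setminus\varphi(D^3))\cup\varphi(R)$. **Corollary.** If a knot $K'$ is obtained from a knot $K$ by a ribbon band attachment, then $K$ and $K'$ are smoothly concordant, that is, there is a smooth neatly embedded annulus $C\subset S^3\times[0,1]$ with $C\cap(S^3\times\{0\})=K\times\{0\}$ and $C\cap(S^3\times\{1\})=K'\times\{1\}$. Moreover, $C$ can be chosen to be a ribbon concordance: the projection $C\to[0,1]$ is a Morse function without local maxima in the interior of $C$. In particular, $K$ and $K'$ have the same smooth $4$-genus, where the smooth $4$-genus of a knot is the minimal genus of a compact connected orientable smooth surface that is neatly embedded in the closed $4$-ball and has the knot as its boundary. -/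

import Mathlib

open scoped ContDiff

noncomputable section

namespace KnotConcordance

/-- The 3-sphere is the unit sphere of `ℝ⁴`, the 4-ball its closed unit ball. -/
abbrev E4 := EuclideanSpace ℝ (Fin 4)

abbrev E3 := EuclideanSpace ℝ (Fin 3)

abbrev E2 := EuclideanSpace ℝ (Fin 2)

/-! ### Knots -/

/-- A regular, simple, closed, smooth parametrised curve in the 3-sphere (of period one). -/
structure IsKnotParam (γ : ℝ → E4) : Prop where
  smooth : ContDiff ℝ ∞ γ
  periodic : Function.Periodic γ 1
  regular : ∀ s, deriv γ s ≠ 0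
  simple : ∀ s t, γ s = γ t → ∃ n : ℤ, t = s + n
  mem_sphere : ∀ s, ‖γ s‖ = 1

/-- A (smooth, unoriented) knot in the 3-sphere: the image of a smoothly embedded circle. -/
def IsKnot (K : Set E4) : Prop :=
  ∃ γ : ℝ → E4, IsKnotParam γ ∧ Set.range γ = K

/-! ### Concordance -/

/-- `(x, h)` is a smooth neat embedding of the annulus `S¹ × [0,1]` into `S³ × [0,1]`, where
`S¹ = ℝ/ℤ`, whose lower boundary is `K × {0}` and whose upper boundary is `K' × {1}`.
The values of `x` and `h` outside `ℝ × [0,1]` are irrelevant: a smooth map on `ℝ × [0,1]` is one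
that extends smoothly to the plane. -/
structure IsConcordance (K K' : Set E4) (x : ℝ × ℝ → E4) (h : ℝ × ℝ → ℝ) : Prop where
  smooth_fst : ContDiff ℝ ∞ x
  smooth_snd : ContDiff ℝ ∞ h
  periodic_fst : ∀ s t, x (s + 1, t) = x (s, t)
  periodic_snd : ∀ s t, h (s + 1, t) = h (s, t)
  mem_sphere : ∀ s, ∀ t ∈ Set.Icc (0 : ℝ) 1, ‖x (s, t)‖ = 1
  mem_Icc : ∀ s, ∀ t ∈ Set.Icc (0 : ℝ) 1, h (s, t) ∈ Set.Icc (0 : ℝ) 1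
  injective : ∀ s s', ∀ t ∈ Set.Icc (0 : ℝ) 1, ∀ t' ∈ Set.Icc (0 : ℝ) 1,
    x (s, t) = x (s', t') → h (s, t) = h (s', t') → t = t' ∧ ∃ n : ℤ, s' = s + n
  immersion : ∀ s, ∀ t ∈ Set.Icc (0 : ℝ) 1,
    Function.Injective (fderiv ℝ (fun p => (x p, h p)) (s, t))
  proper_zero : ∀ s, ∀ t ∈ Set.Icc (0 : ℝ) 1, (h (s, t) = 0 ↔ t = 0)
  proper_one : ∀ s, ∀ t ∈ Set.Icc (0 : ℝ) 1, (h (s, t) = 1 ↔ t = 1)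
  neat_zero : ∀ s, fderiv ℝ h (s, 0) ≠ 0
  neat_one : ∀ s, fderiv ℝ h (s, 1) ≠ 0
  lower_boundary : Set.range (fun s => x (s, 0)) = K
  upper_boundary : Set.range (fun s => x (s, 1)) = K'

/-- `K` and `K'` are smoothly concordant. -/
def Concordant (K K' : Set E4) : Prop :=
  ∃ x h, IsConcordance K K' x h

/-- There is a ribbon concordance with `K` at level `0` and `K'` at level `1`: the height function
of the annulus is a Morse function without local maxima in the interior. -/
def RibbonConcordant (K K' : Set E4) : Prop :=
  ∃ x h, IsConcordance K K' x h ∧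
    ∀ s, ∀ t ∈ Set.Ioo (0 : ℝ) 1, fderiv ℝ h (s, t) = 0 →
      Function.Injective (fderiv ℝ (fderiv ℝ h) (s, t)) ∧ ¬ IsLocalMax h (s, t)

/-! ### The smooth 4-genus -/

/-- `F` is a compact, neatly embedded smooth surface in the closed 4-ball: near each of its points
it is cut out of the ball by a smooth submersion to the plane, and at points of the 3-sphere it is
transverse to the sphere. Its boundary is then `F ∩ S³`. -/
structure IsNeatSurface (F : Set E4) : Prop where
  compact : IsCompact F
  subset_ball : F ⊆ Metric.closedBall 0 1
  local_equation : ∀ p ∈ F, ∃ (U : Set E4) (G : E4 → E2), IsOpen U ∧ p ∈ U ∧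
    ContDiffOn ℝ ∞ G U ∧ (∀ y ∈ U, y ∈ F ↔ ‖y‖ ≤ 1 ∧ G y = 0) ∧
    Function.Surjective (fderiv ℝ G p) ∧
    (‖p‖ = 1 → ∀ w : E2, ∃ v : E4, inner ℝ p v = 0 ∧ fderiv ℝ G p v = w)

/-- The tangent plane of a surface (with boundary) at a point; at a boundary point the
tangent cone is a half-plane and spans the tangent plane. -/
def tangentPlane (F : Set E4) (p : E4) : Submodule ℝ E4 :=
  Submodule.span ℝ (tangentConeAt ℝ F p)

/-- A surface is orientable if there is a continuous field of alternating 2-forms along it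
that is nowhere zero on its tangent planes. -/
def IsOrientableSurface (F : Set E4) : Prop :=
  ∃ η : E4 → E4 [⋀^Fin 2]→L[ℝ] ℝ, ContinuousOn η F ∧
    ∀ p ∈ F, ∃ u ∈ tangentPlane F p, ∃ v ∈ tangentPlane F p, η p ![u, v] ≠ 0

/-- The first rational Betti number, from singular homology. -/
def firstBetti (F : Set E4) : ℕ :=
  Module.finrank ℚ
    (((AlgebraicTopology.singularHomologyFunctor (ModuleCat.{0} ℚ) 1).obj
      (ModuleCat.of ℚ ℚ)).obj (TopCat.of F))

/-- `K` bounds in the 4-ball a compact, connected, orientable, neatly embedded smooth surface of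
genus `g`. (A compact connected orientable surface whose boundary is one circle has genus `g`
exactly if its first Betti number is `2 * g`.) -/
def BoundsSurfaceOfGenus (K : Set E4) (g : ℕ) : Prop :=
  ∃ F : Set E4, IsNeatSurface F ∧ IsConnected F ∧ IsOrientableSurface F ∧
    F ∩ Metric.sphere 0 1 = K ∧ firstBetti F = 2 * g

/-- The smooth 4-genus; the infimum is taken in `ℕ∞`, so that an empty one would be `⊤`. -/
def fourGenus (K : Set E4) : ℕ∞ :=
  ⨅ g ∈ {g : ℕ | BoundsSurfaceOfGenus K g}, (g : ℕ∞)

/-! ### Ribbon bands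

The model 3-ball is the closed unit ball of `ℝ³`, the model trivial 2-stranded tangle consists of
its two vertical segments in the plane `y = 0` with `x = -1/2` and `x = 1/2`. Each of them cuts off
the planar half-moon `y = 0`, `± x ≥ 1/2` from the ball. -/

/-- The half-moon, as a subset of the plane. Its boundary is the union of a chord and an arc. -/
def halfMoon : Set E2 := {q | ‖q‖ ≤ 1 ∧ 1 / 2 ≤ q 0}

def halfMoonInterior : Set E2 := {q | ‖q‖ < 1 ∧ 1 / 2 < q 0}

def chord : Set E2 := {q | ‖q‖ ≤ 1 ∧ q 0 = 1 / 2}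

/-- The flat embedding of the half-moon in the model ball, on the right for `σ = 1` and on the left
for `σ = -1`. -/
def flat (σ : ℝ) (q : E2) : E3 := !₂[σ * q 0, 0, q 1]

/-- The trivial 2-stranded tangle in the model ball. -/
def trivialTangle : Set E3 := flat (-1) '' chord ∪ flat 1 '' chord

/-- `e` is a smooth embedding of the half-moon in the model ball that is flat near
the arc and maps everything but the arc to the interior of the ball. So its image is an embedded
disk bounded by the standard arc on the sphere and by the strand `e '' chord`, and this strand
agrees with a strand of the trivial tangle near the sphere. -/
structure IsTangleDisk (σ : ℝ) (e : E2 → E3) : Prop where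
  smooth : ContDiff ℝ ∞ e
  injective : Set.InjOn e halfMoon
  immersion : ∀ q ∈ halfMoon, Function.Injective (fderiv ℝ e q)
  flat_near_arc : ∃ r < 1, ∀ q ∈ halfMoon, r ≤ ‖q‖ → e q = flat σ q
  interior : ∀ q ∈ halfMoon, ‖q‖ < 1 → ‖e q‖ < 1

/-- `A` is a ribbon singularity, in which the disk `e` passes through the disk `e'`: a transverse
double arc that is properly embedded in the disk `e` (with its end points on the strand)
and lies in the interior of the disk `e'`. -/
def IsRibbonSingularity (e e' : E2 → E3) (A : Set E3) : Prop :=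
  (∃ c : ℝ → E2, ContDiff ℝ ∞ c ∧ Set.InjOn c (Set.Icc 0 1) ∧
    (∀ t ∈ Set.Icc (0 : ℝ) 1, deriv c t ≠ 0) ∧
    c 0 ∈ chord ∧ c 1 ∈ chord ∧ (∀ t ∈ Set.Ioo (0 : ℝ) 1, c t ∈ halfMoonInterior) ∧
    (fun t => e (c t)) '' Set.Icc 0 1 = A) ∧
  A ⊆ e' '' halfMoonInterior ∧
  ∀ q ∈ halfMoon, ∀ q' ∈ halfMoon, e q ∈ A → e q = e' q' →
    (fderiv ℝ e q).range ⊔ (fderiv ℝ e' q').range = ⊤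

/-- A ribbon band in the model ball: a 2-stranded tangle `R` whose strands cobound, with the two
standard arcs on the sphere, two embedded disks that meet each other exactly in two
ribbon singularities. -/
def IsRibbonBand (R : Set E3) : Prop :=
  ∃ e₁ e₂ : E2 → E3, IsTangleDisk (-1) e₁ ∧ IsTangleDisk 1 e₂ ∧
    (∃ A B : Set E3, Disjoint A B ∧ (e₁ '' halfMoon) ∩ (e₂ '' halfMoon) = A ∪ B ∧
      (IsRibbonSingularity e₁ e₂ A ∨ IsRibbonSingularity e₂ e₁ A) ∧
      (IsRibbonSingularity e₁ e₂ B ∨ IsRibbonSingularity e₂ e₁ B)) ∧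
    R = e₁ '' chord ∪ e₂ '' chord

/-- `φ` restricts to a smooth embedding of the closed model ball in the 3-sphere. -/
structure IsBallEmbedding (φ : E3 → E4) : Prop where
  smooth : ContDiff ℝ ∞ φ
  injective : Set.InjOn φ (Metric.closedBall 0 1)
  immersion : ∀ y ∈ Metric.closedBall (0 : E3) 1, Function.Injective (fderiv ℝ φ y)
  mem_sphere : ∀ y ∈ Metric.closedBall (0 : E3) 1, ‖φ y‖ = 1

/-- `K'` is obtained from `K` by a ribbon band attachment: some 3-ball in `S³` meets `K` in a
trivial 2-stranded tangle, and replacing this tangle by a ribbon band yields `K'`. -/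
def IsRibbonBandAttachment (K K' : Set E4) : Prop :=
  ∃ (φ : E3 → E4) (R : Set E3), IsBallEmbedding φ ∧ IsRibbonBand R ∧
    K ∩ φ '' Metric.closedBall 0 1 = φ '' trivialTangle ∧
    K' = (K \ φ '' Metric.closedBall 0 1) ∪ φ '' R

end KnotConcordance

end

open scoped ContDiff

noncomputable section

namespace KnotConcordance

open Set Filter Topology

/-! ### Immersions and their left inverses -/

section Immersion

variable {E F : Type*} [NormedAddCommGroup E] [NormedSpace ℝ E] [FiniteDimensional ℝ E]
  [NormedAddCommGroup F] [NormedSpace ℝ F] [FiniteDimensional ℝ F]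

/-! The two disks of a ribbon band prescribe a motion of the trivial tangle: each strand crosses its
flat half-moon towards the boundary arc and returns from there through its disk `e i`, which is flat
near the arc. The trace of a strand in the product of the ball and the time interval is an embedded
disk on which time has no critical points. The two traces can meet only at double points of the
disks, so the order of the returns matters. Let strand `b` return after strand `!b`. A double arc
inside the disk of `!b` is harmless, since `!b` has swept over it before `b` sets out. If both
double arcs lie inside the same disk, a suitable order therefore makes the traces disjoint.
Otherwise one double arc `B` lies inside the disk of `b` and ends on the strand of `!b`, which still
passes through the ends of `B` when `b` arrives. The remedy is to lower the height function on the
trace of `b` along `B`, below every height at which the trace of `!b` meets `B`.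

Such a pit costs no maxima. A local diffeomorphism shrinks the arc into a small disk
(`exists_shrinking`), where a round pit is dug whose depth is a regular value in the sense of Sard
(`morseNoMaxAt_roundPit`, `exists_pit`). Its critical points are nondegenerate, and the height
increases to both sides of the symmetry axis, so none is a local maximum. The disks in the ball
(`IsRibbonBand.exists_isBallCobordism`) extend by the product of the rest of the knot and the
interval to an annulus that is a product near both ends (`exists_collared_concordance`).

For the 4-genus, a neat surface `F` bounded by `K` has a collar parametrised by the distance to the
origin (`exists_radialCollar`). This collar is bent into a cone over `K`, and the concordance is
inserted into the outer spherical shell (`IsConcordance.exists_neatCollar`). The new surface is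
homeomorphic to `F`, neat and orientable, and it bounds `K'`
(`IsNeatSurface.boundsSurfaceOfGenus_of_exchange`). Turning the concordance upside down gives the
other inequality. -/

omit [FiniteDimensional ℝ F] in
theorem eventually_injective_fderiv {f : E → F} {x : E} (hf : ContDiffAt ℝ ∞ f x)
    (hx : Function.Injective (fderiv ℝ f x)) :
    ∀ᶠ y in 𝓝 x, Function.Injective (fderiv ℝ f y) :=
  (hf.fderiv_right (m := 1) (by norm_cast)).continuousAt.eventually
    (ContinuousLinearMap.isOpen_injective.mem_nhds hx)

/-- For a linear left inverse `L` of the derivative at `x`, the map `L ∘ f` has derivative the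
identity at `x`. The inverse function theorem inverts it locally, and the inverse after `L` is the
required map. -/
theorem exists_leftInverse_nhds {f : E → F} {x : E} (hf : ∀ᶠ y in 𝓝 x, ContDiffAt ℝ ∞ f y)
    (hx : Function.Injective (fderiv ℝ f x)) :
    ∃ g : F → E, (∀ᶠ z in 𝓝 (f x), ContDiffAt ℝ ∞ g z) ∧ ∀ᶠ y in 𝓝 x, g (f y) = y := by
  obtain ⟨L₀, hL₀⟩ := LinearMap.exists_leftInverse_of_injective
    (fderiv ℝ f x : E →ₗ[ℝ] F) (LinearMap.ker_eq_bot.2 hx)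
  set L : F →L[ℝ] E := LinearMap.toContinuousLinearMap L₀ with hL
  have hder : ∀ y, ContDiffAt ℝ ∞ f y → HasFDerivAt (fun y => L (f y)) (L.comp (fderiv ℝ f y)) y :=
    fun y hy => L.hasFDerivAt.comp y (hy.differentiableAt (by simp)).hasFDerivAt
  have hsm : ∀ y, ContDiffAt ℝ ∞ f y → ContDiffAt ℝ ∞ (fun y => L (f y)) y :=
    fun y hy => L.contDiff.contDiffAt.comp y hy
  have hfx := hf.self_of_nhds
  have hd : HasFDerivAt (fun y => L (f y)) ((ContinuousLinearEquiv.refl ℝ E : E →L[ℝ] E)) x := by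
    convert hder x hfx using 1
    ext v
    exact (LinearMap.congr_fun hL₀ v).symm
  have hc := hsm x hfx
  let e := hc.toOpenPartialHomeomorph _ hd (by simp)
  have hxe : x ∈ e.source := hc.mem_toOpenPartialHomeomorph_source hd (by simp)
  have hinj : ∀ᶠ y in 𝓝 x, Function.Injective (fderiv ℝ (fun y => L (f y)) y) :=
    eventually_injective_fderiv hc (by rw [hd.fderiv]; exact fun a b h => h)
  -- Smoothness is wanted on a neighbourhood, not only at the image point; the derivative of `L ∘ f`
  -- stays invertible nearby, so the inverse is smooth at each nearby point.
  have hgood : ∀ᶠ w in 𝓝 (e x), ContDiffAt ℝ ∞ e.symm w := by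
    have hcont : ContinuousAt e.symm (e x) := e.symm.continuousAt (e.map_source hxe)
    have h1 : ∀ᶠ w in 𝓝 (e x), ContDiffAt ℝ ∞ f (e.symm w) ∧
        Function.Injective (fderiv ℝ (fun y => L (f y)) (e.symm w)) := by
      have h0 := hf.and hinj
      rw [← e.left_inv hxe] at h0
      exact hcont.tendsto.eventually h0
    filter_upwards [h1, e.open_target.mem_nhds (e.map_source hxe)] with w hw hwt
    let A : E ≃L[ℝ] E := ContinuousLinearEquiv.ofBijective (fderiv ℝ (fun y => L (f y)) (e.symm w))
      (LinearMap.ker_eq_bot.2 hw.2)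
      (LinearMap.range_eq_top.2 (LinearMap.injective_iff_surjective.1 hw.2))
    refine e.contDiffAt_symm (f₀' := A) hwt ?_ (hsm _ hw.1)
    have hA : (A : E →L[ℝ] E) = fderiv ℝ (fun y => L (f y)) (e.symm w) := by
      ext v
      rfl
    rw [hA]
    exact ((hsm _ hw.1).differentiableAt (by simp)).hasFDerivAt
  refine ⟨fun z => e.symm (L z), ?_, ?_⟩
  · have h3 : ∀ᶠ z in 𝓝 (f x), ContDiffAt ℝ ∞ e.symm (L z) :=
      L.continuous.continuousAt.eventually hgood
    filter_upwards [h3] with z hz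
    exact hz.comp z L.contDiff.contDiffAt
  · filter_upwards [e.open_source.mem_nhds hxe] with y hy
    exact e.left_inv hy

theorem injOn_nhds_of_immersion {f : E → F} {x : E} (hf : ∀ᶠ y in 𝓝 x, ContDiffAt ℝ ∞ f y)
    (hx : Function.Injective (fderiv ℝ f x)) : ∃ u ∈ 𝓝 x, InjOn f u := by
  obtain ⟨g, -, hg⟩ := exists_leftInverse_nhds hf hx
  exact ⟨_, hg, fun y hy z hz hyz => by rw [← hy, hyz, hz]⟩

/-- Local left inverses are averaged by a partition of unity. This is legitimate since prescribing
the value on `f '' K` and nothing elsewhere is a convex condition. -/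
theorem exists_smooth_leftInverse {f : E → F} (hf : ContDiff ℝ ∞ f) {K : Set E}
    (hK : IsCompact K) (hinj : InjOn f K)
    (himm : ∀ x ∈ K, Function.Injective (fderiv ℝ f x)) :
    ∃ g : F → E, ContDiff ℝ ∞ g ∧ ∀ x ∈ K, g (f x) = x := by
  -- By injectivity on `K` this is a single point for `y ∈ f '' K`, and the whole space for all
  -- other `y`.
  let t : F → Set E := fun y => {z | ∀ x ∈ K, f x = y → z = x}
  have ht : ∀ y, Convex ℝ (t y) := by
    intro y a ha b hb p q hp hq hpq x hx hxy
    rw [ha x hx hxy, hb x hx hxy, ← add_smul, hpq, one_smul]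
  have hloc : ∀ y : F, ∃ U ∈ 𝓝 y, ∃ g : F → E,
      ContMDiffOn (modelWithCornersSelf ℝ F) (modelWithCornersSelf ℝ E) ∞ g U ∧
        ∀ z ∈ U, g z ∈ t z := by
    intro y
    by_cases hy : y ∈ f '' K
    · obtain ⟨x, hx, rfl⟩ := hy
      obtain ⟨g, hg, hgf⟩ := exists_leftInverse_nhds
        (Eventually.of_forall fun _ => hf.contDiffAt) (himm x hx)
      obtain ⟨V, hV, hVo, hxV⟩ := eventually_nhds_iff.1 hgf
      have hcl : IsClosed (f '' (K \ V)) := ((hK.diff hVo).image hf.continuous).isClosed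
      have hnot : f x ∉ f '' (K \ V) := by
        rintro ⟨x', hx', he⟩
        exact hx'.2 (hinj hx'.1 hx he ▸ hxV)
      obtain ⟨W, hW, hgW⟩ := hg.exists_mem
      -- The image of the rest of `K` is compact and misses `f x`; off this image only points of `V`
      -- have to be recovered.
      refine ⟨W ∩ (f '' (K \ V))ᶜ, inter_mem hW (hcl.isOpen_compl.mem_nhds hnot), g, ?_, ?_⟩
      · rw [contMDiffOn_iff_contDiffOn]
        exact fun z hz => (hgW z hz.1).contDiffWithinAt
      · rintro z hz x' hx' rfl
        exact hV x' (by_contra fun h => hz.2 ⟨x', ⟨hx', h⟩, rfl⟩)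
    · refine ⟨(f '' K)ᶜ, (hK.image hf.continuous).isClosed.isOpen_compl.mem_nhds hy,
        fun _ => 0, contMDiffOn_const, ?_⟩
      exact fun z hz x hx hxz => (hz ⟨x, hx, hxz⟩).elim
  obtain ⟨g, hg⟩ := exists_contMDiffMap_forall_mem_convex_of_local
    (modelWithCornersSelf ℝ F) (n := (⊤ : ℕ∞)) ht hloc
  exact ⟨g, contMDiff_iff_contDiff.1 g.contMDiff, fun x hx => hg (f x) x hx rfl⟩

end Immersion

/-! ### Critical points that are nondegenerate and not local maxima -/

section Critical

variable {E F : Type*} [NormedAddCommGroup E] [NormedSpace ℝ E]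
  [NormedAddCommGroup F] [NormedSpace ℝ F]

/-- If `z` is a critical point of `h`, then it is nondegenerate and not a local maximum. -/
def MorseNoMaxAt (h : E → ℝ) (z : E) : Prop :=
  fderiv ℝ h z = 0 → Function.Injective (fderiv ℝ (fderiv ℝ h) z) ∧ ¬ IsLocalMax h z

theorem MorseNoMaxAt.congr {h h' : E → ℝ} {z : E} (H : MorseNoMaxAt h z) (e : h' =ᶠ[𝓝 z] h) :
    MorseNoMaxAt h' z := by
  intro hz
  rw [e.fderiv_eq] at hz
  rw [e.fderiv.fderiv_eq]
  exact ⟨(H hz).1, fun hm => (H hz).2 (hm.congr e)⟩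

/-- At a critical point the second derivative of `θ` is multiplied by the vanishing derivative of
`h`, so the Hessian of `h ∘ θ` is the Hessian of `h` pulled back by an isomorphism. Local maxima
transfer because `θ` maps neighbourhoods onto neighbourhoods. -/
theorem MorseNoMaxAt.comp [CompleteSpace E] [CompleteSpace F] {h : F → ℝ} {θ : E → F} {z : E} (H : MorseNoMaxAt h (θ z))
    (hh : ContDiffAt ℝ ∞ h (θ z)) (hθ : ContDiffAt ℝ ∞ θ z)
    (hb : Function.Bijective (fderiv ℝ θ z)) : MorseNoMaxAt (h ∘ θ) z := by
  have hsurj : (fderiv ℝ θ z).range = ⊤ := LinearMap.range_eq_top.2 hb.2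
  have hh1 : ContDiffAt ℝ 1 h (θ z) := hh.of_le (by norm_cast)
  have hθ1 : ContDiffAt ℝ 1 θ z := hθ.of_le (by norm_cast)
  have hev : fderiv ℝ (h ∘ θ) =ᶠ[𝓝 z] fun y => (fderiv ℝ h (θ y)).comp (fderiv ℝ θ y) := by
    filter_upwards [hθ.continuousAt.eventually (hh1.eventually (by simp)),
      hθ1.eventually (by simp)] with y h1 h2
    exact fderiv_comp y (h1.differentiableAt (by simp)) (h2.differentiableAt (by simp))
  intro hz
  rw [hev.eq_of_nhds] at hz
  have hz' : fderiv ℝ h (θ z) = 0 := by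
    ext w
    obtain ⟨v, rfl⟩ := hb.2 w
    exact congrArg (fun T => T v) hz
  obtain ⟨hinj, hmax⟩ := H hz'
  constructor
  · have hd1 : HasFDerivAt (fun y => fderiv ℝ h (θ y))
        ((fderiv ℝ (fderiv ℝ h) (θ z)).comp (fderiv ℝ θ z)) z :=
      (((hh.fderiv_right (m := 1) (by norm_cast)).differentiableAt (by simp)).hasFDerivAt).comp z
        (hθ.differentiableAt (by simp)).hasFDerivAt
    have hd2 : HasFDerivAt (fderiv ℝ θ) (fderiv ℝ (fderiv ℝ θ) z) z :=
      ((hθ.fderiv_right (m := 1) (by norm_cast)).differentiableAt (by simp)).hasFDerivAt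
    have hd := hd1.clm_comp hd2
    rw [hev.fderiv_eq, hd.fderiv, hz']
    intro a b hab
    apply hb.1
    apply hinj
    ext w
    obtain ⟨v, rfl⟩ := hb.2 w
    have := congrArg (fun T => T v) hab
    simpa using this
  · intro hm
    apply hmax
    have hmap := (hθ.hasStrictFDerivAt (by simp)).map_nhds_eq_of_surj hsurj
    unfold IsLocalMax IsMaxFilter
    rw [← hmap, eventually_map]
    exact hm

end Critical

/-! ### The smooth transition function -/

theorem hasDerivAt_expNegInvGlue {x : ℝ} (hx : 0 < x) :
    HasDerivAt expNegInvGlue (expNegInvGlue x * (x ^ 2)⁻¹) x := by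
  have h1 : HasDerivAt (fun y : ℝ => Real.exp (-y⁻¹)) (Real.exp (-x⁻¹) * (-(-(x ^ 2)⁻¹))) x :=
    ((hasDerivAt_inv hx.ne').neg).exp
  have h2 : expNegInvGlue =ᶠ[𝓝 x] fun y => Real.exp (-y⁻¹) := by
    filter_upwards [lt_mem_nhds hx] with y hy
    simp [expNegInvGlue, not_le.2 hy]
  have h3 := h1.congr_of_eventuallyEq h2
  rwa [neg_neg, ← h2.eq_of_nhds] at h3

/-- A strand that moves according to this function has nonzero speed throughout its time window, so
its position alone determines the time. -/
theorem deriv_smoothTransition_pos {x : ℝ} (h0 : 0 < x) (h1 : x < 1) :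
    0 < deriv Real.smoothTransition x := by
  have ha := hasDerivAt_expNegInvGlue h0
  have hb : HasDerivAt (fun y => expNegInvGlue (1 - y))
      (-(expNegInvGlue (1 - x) * ((1 - x) ^ 2)⁻¹)) x := by
    have := (hasDerivAt_expNegInvGlue (sub_pos.2 h1)).comp x ((hasDerivAt_id x).const_sub 1)
    simpa [Function.comp_def] using this
  have hp := Real.smoothTransition.pos_denom x
  have hd := ha.div (ha.add hb) hp.ne'
  have : deriv Real.smoothTransition x = _ := hd.deriv
  rw [this]
  have pa := expNegInvGlue.pos_of_pos h0
  have pb := expNegInvGlue.pos_of_pos (sub_pos.2 h1)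
  have ha' : 0 < (x ^ 2)⁻¹ := by positivity
  have hb' : 0 < ((1 - x) ^ 2)⁻¹ := inv_pos.2 (pow_pos (sub_pos.2 h1) 2)
  apply div_pos _ (pow_pos hp 2)
  have : expNegInvGlue x * (x ^ 2)⁻¹ * (expNegInvGlue x + expNegInvGlue (1 - x)) -
      expNegInvGlue x * (expNegInvGlue x * (x ^ 2)⁻¹ +
        -(expNegInvGlue (1 - x) * ((1 - x) ^ 2)⁻¹)) =
      expNegInvGlue x * expNegInvGlue (1 - x) * ((x ^ 2)⁻¹ + ((1 - x) ^ 2)⁻¹) := by ring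
  simp only [Pi.add_apply]
  rw [this]
  positivity

theorem strictMonoOn_smoothTransition : StrictMonoOn Real.smoothTransition (Icc 0 1) := by
  apply strictMonoOn_of_deriv_pos (convex_Icc 0 1) Real.smoothTransition.continuous.continuousOn
  intro x hx
  rw [interior_Icc] at hx
  exact deriv_smoothTransition_pos hx.1 hx.2

/-! ### Digging a round pit into the height function of the plane -/

/-- The derivative of a smooth function is smooth. -/
theorem contDiff_deriv {F : Type*} [NormedAddCommGroup F] [NormedSpace ℝ F] {f : ℝ → F}
    (hf : ContDiff ℝ ∞ f) : ContDiff ℝ ∞ (deriv f) :=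
  (contDiff_infty_iff_deriv.1 hf).2

/-- Sard's theorem on the line: the critical values of `k` form a null set, so some `q` between
`b⁻¹` and `a⁻¹` is not among them, and `M = q⁻¹`. -/
theorem exists_mem_Ioo_regular {k : ℝ → ℝ} (hk : ContDiff ℝ ∞ k) {a b : ℝ} (ha : 0 < a)
    (hab : a < b) : ∃ M ∈ Ioo a b, ∀ y, M * k y = 1 → deriv k y ≠ 0 := by
  set s : Set ℝ := {y | deriv k y = 0}
  have hnull : MeasureTheory.volume (k '' s) = 0 := by
    apply MeasureTheory.addHaar_image_eq_zero_of_det_fderivWithin_eq_zero MeasureTheory.volume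
      (f' := fun y => fderiv ℝ k y)
    · intro y _
      exact ((hk.differentiable (by simp)) y).hasFDerivAt.hasFDerivWithinAt
    · intro y hy
      have h0 : fderiv ℝ k y = 0 := by
        ext
        have : deriv k y = 0 := hy
        simpa using this
      simp [h0]
  have hpos : 0 < MeasureTheory.volume (Ioo b⁻¹ a⁻¹) := by
    rw [Real.volume_Ioo, ENNReal.ofReal_pos, sub_pos]
    exact (inv_lt_inv₀ (ha.trans hab) ha).2 hab
  obtain ⟨q, hq, hqk⟩ : ∃ q ∈ Ioo b⁻¹ a⁻¹, q ∉ k '' s := by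
    by_contra! hcon
    exact hpos.ne' (MeasureTheory.measure_mono_null hcon hnull)
  have hq0 : 0 < q := (inv_pos.2 (ha.trans hab)).trans hq.1
  refine ⟨q⁻¹, ⟨?_, ?_⟩, ?_⟩
  · rw [lt_inv_comm₀ ha hq0]
    exact hq.2
  · rw [inv_lt_comm₀ hq0 (ha.trans hab)]
    exact hq.1
  · intro y hy hd
    exact hqk ⟨y, hd, by field_simp at hy; exact hy⟩

/-- Rotational symmetry of the bump puts every critical point on the axis `p.1 = a`. There the
Hessian is diagonal: one entry is a multiple of `deriv B ≠ 0`, and the other is nonzero by the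
choice of `M`. Along the horizontal line through the point the bump decreases, so the height
increases and the point is no local maximum. -/
theorem morseNoMaxAt_roundPit {B : ℝ → ℝ} (hB : ContDiff ℝ ∞ B) (hanti : Antitone B) {M : ℝ}
    (hM : 0 < M) (a b : ℝ)
    (hreg : ∀ y, M * (2 * deriv B (y ^ 2) * y) = 1 →
      deriv (fun y => 2 * deriv B (y ^ 2) * y) y ≠ 0) (p : ℝ × ℝ) :
    MorseNoMaxAt (fun p : ℝ × ℝ => p.2 - M * B ((p.1 - a) ^ 2 + (p.2 - b) ^ 2)) p := by
  set k : ℝ → ℝ := fun y => 2 * deriv B (y ^ 2) * y with hk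
  have hB' : ContDiff ℝ ∞ (deriv B) := contDiff_deriv hB
  set N : ℝ × ℝ → ℝ := fun p => (p.1 - a) ^ 2 + (p.2 - b) ^ 2 with hN
  have hNs : ContDiff ℝ ∞ N := by fun_prop
  set P : ℝ × ℝ → ℝ := fun p => (-(2 * M * deriv B (N p))) * (p.1 - a) with hP
  set Q : ℝ × ℝ → ℝ := fun p => 1 - M * (2 * deriv B (N p) * (p.2 - b)) with hQ
  have hc : ContDiff ℝ ∞ fun p : ℝ × ℝ => deriv B (N p) := hB'.comp hNs
  have hPs : ContDiff ℝ ∞ P := by fun_prop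
  have hQs : ContDiff ℝ ∞ Q := by fun_prop
  have hder : ∀ p : ℝ × ℝ, HasFDerivAt (fun p : ℝ × ℝ => p.2 - M * B (N p))
      (P p • ContinuousLinearMap.fst ℝ ℝ ℝ + Q p • ContinuousLinearMap.snd ℝ ℝ ℝ) p := by
    intro p
    have h1 : HasFDerivAt N _ p :=
      (((hasFDerivAt_fst (𝕜 := ℝ) (p := p)).sub_const a).pow 2).add
        (((hasFDerivAt_snd (𝕜 := ℝ) (p := p)).sub_const b).pow 2)
    have h2 : HasDerivAt B (deriv B (N p)) (N p) :=
      ((hB.differentiable (by simp)) _).hasDerivAt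
    have h3 := (hasFDerivAt_snd (𝕜 := ℝ) (p := p)).sub ((h2.comp_hasFDerivAt p h1).const_mul M)
    refine h3.congr_fderiv ?_
    ext
    · simp [hP]
      ring
    · simp [hQ]
      left
      ring
  have hfd : fderiv ℝ (fun p : ℝ × ℝ => p.2 - M * B (N p)) =
      fun p => P p • ContinuousLinearMap.fst ℝ ℝ ℝ + Q p • ContinuousLinearMap.snd ℝ ℝ ℝ :=
    funext fun p => (hder p).fderiv
  intro hp
  rw [hfd] at hp
  have hP0 : P p = 0 := by simpa using congrArg (fun T => T (1, 0)) hp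
  have hQ0 : Q p = 0 := by simpa using congrArg (fun T => T (0, 1)) hp
  -- Where the bump is stationary, the vertical derivative is 1.
  have hB0 : deriv B (N p) ≠ 0 := by
    intro h0
    simp [hQ, h0] at hQ0
  have hneg : deriv B (N p) < 0 := lt_of_le_of_ne hanti.deriv_nonpos hB0
  have hpa : p.1 = a := by
    have : p.1 - a = 0 := by
      rcases mul_eq_zero.1 hP0 with h | h
      · have : 2 * M * deriv B (N p) ≠ 0 := by positivity
        exact absurd (neg_eq_zero.1 h) this
      · exact h
    linarith
  constructor
  · rw [hfd]
    have hdP : HasFDerivAt P (fderiv ℝ P p) p := ((hPs.differentiable (by simp)) p).hasFDerivAt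
    have hdQ : HasFDerivAt Q (fderiv ℝ Q p) p := ((hQs.differentiable (by simp)) p).hasFDerivAt
    have h2 := (hdP.smul_const (ContinuousLinearMap.fst ℝ ℝ ℝ)).add
      (hdQ.smul_const (ContinuousLinearMap.snd ℝ ℝ ℝ))
    have h2' : fderiv ℝ (fun p => P p • ContinuousLinearMap.fst ℝ ℝ ℝ +
        Q p • ContinuousLinearMap.snd ℝ ℝ ℝ) p = _ := h2.fderiv
    rw [h2', injective_iff_map_eq_zero]
    intro w hw
    have hw1 : fderiv ℝ P p w = 0 := by simpa using congrArg (fun T => T (1, 0)) hw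
    have hw2 : fderiv ℝ Q p w = 0 := by simpa using congrArg (fun T => T (0, 1)) hw
    -- The factor `p.1 - a` of `P` vanishes, so only the derivative of this factor contributes.
    have hPf : fderiv ℝ P p w = -(2 * M * deriv B (N p)) * w.1 := by
      have hcd : HasFDerivAt (fun p => -(2 * M * deriv B (N p)))
          (fderiv ℝ (fun p => -(2 * M * deriv B (N p))) p) p :=
        (((hc.const_smul (2 * M)).neg.differentiable (by simp)) p).hasFDerivAt
      have h3 : HasFDerivAt P _ p := hcd.mul ((hasFDerivAt_fst (𝕜 := ℝ) (p := p)).sub_const a)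
      rw [h3.fderiv]
      simp [hpa]
    have hw1' : w.1 = 0 := by
      rw [hPf] at hw1
      rcases mul_eq_zero.1 hw1 with h | h
      · have : 2 * M * deriv B (N p) ≠ 0 := by positivity
        exact absurd (neg_eq_zero.1 h) this
      · exact h
    have hks : ContDiff ℝ ∞ k := by fun_prop
    have hl : HasDerivAt (fun t : ℝ => (a, p.2 + t * w.2)) w 0 := by
      have h4 := (hasDerivAt_const (0 : ℝ) a).prodMk
        (((hasDerivAt_id (0 : ℝ)).mul_const w.2).const_add p.2)
      refine h4.congr_deriv ?_
      ext <;> simp [hw1']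
    have h5 : HasDerivAt (fun t : ℝ => Q (a, p.2 + t * w.2)) (fderiv ℝ Q p w) 0 := by
      have hpe : (a, p.2 + 0 * w.2) = p := by ext <;> simp [hpa]
      exact HasFDerivAt.comp_hasDerivAt (0 : ℝ) (by rw [hpe]; exact hdQ) hl
    have h6 : HasDerivAt (fun t : ℝ => Q (a, p.2 + t * w.2)) (-(M * (deriv k (p.2 - b) * w.2)))
        0 := by
      have h7 : HasDerivAt (fun t : ℝ => p.2 - b + t * w.2) w.2 0 := by
        simpa using ((hasDerivAt_id (0 : ℝ)).mul_const w.2).const_add (p.2 - b)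
      have h8 : HasDerivAt k (deriv k (p.2 - b)) (p.2 - b + 0 * w.2) := by
        rw [zero_mul, add_zero]
        exact ((hks.differentiable (by simp)) _).hasDerivAt
      have h9 := ((h8.comp (0 : ℝ) h7).const_mul M).const_sub 1
      refine h9.congr_of_eventuallyEq (Eventually.of_forall fun t => ?_)
      simp only [hQ, hk, hN, Function.comp_apply]
      rw [show p.2 + t * w.2 - b = p.2 - b + t * w.2 by ring]
      simp
    have h10 := h5.unique h6
    rw [hw2] at h10
    have hk1 : M * k (p.2 - b) = 1 := by
      have : Q p = 1 - M * k (p.2 - b) := by simp [hQ, hk, hN, hpa]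
      linarith
    have h11 : w.2 = 0 := by
      have h12 : M * (deriv k (p.2 - b) * w.2) = 0 := by linarith
      simpa [hM.ne', hreg _ hk1] using h12
    exact Prod.ext hw1' h11
  · intro hmax
    -- On the horizontal line the squared distance to the centre grows by exactly `s ^ 2`, so the
    -- slope of `B` at `N p`, which is negative, decides.
    have hcurve : Tendsto (fun s : ℝ => ((a + s, p.2) : ℝ × ℝ)) (𝓝[≠] 0) (𝓝 p) := by
      have : ContinuousAt (fun s : ℝ => ((a + s, p.2) : ℝ × ℝ)) 0 := by fun_prop
      have h := this.tendsto
      rw [show ((a + 0, p.2) : ℝ × ℝ) = p by ext <;> simp [hpa]] at h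
      exact h.mono_left nhdsWithin_le_nhds
    have h1 := hcurve.eventually hmax
    have hslope := ((hB.differentiable (by simp)) (N p)).hasDerivAt.tendsto_slope
    have h2 : Tendsto (fun s : ℝ => N p + s ^ 2) (𝓝[≠] 0) (𝓝[≠] (N p)) := by
      apply tendsto_nhdsWithin_of_tendsto_nhds_of_eventually_within
      · have : ContinuousAt (fun s : ℝ => N p + s ^ 2) 0 := by fun_prop
        have h := this.tendsto
        simp only [ne_eq, OfNat.ofNat_ne_zero, not_false_eq_true, zero_pow, add_zero] at h
        exact h.mono_left nhdsWithin_le_nhds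
      · filter_upwards [self_mem_nhdsWithin] with s hs
        have : s ^ 2 ≠ 0 := pow_ne_zero 2 hs
        simpa using hs
    have h3 := (h2.eventually (hslope.eventually (gt_mem_nhds hneg))).and
      (h1.and self_mem_nhdsWithin)
    obtain ⟨s, hs1, hs2, hs0⟩ := h3.exists
    have hs0' : 0 < s ^ 2 := by
      have : s ≠ 0 := hs0
      positivity
    rw [slope_def_field] at hs1
    have h4 : B (N p + s ^ 2) - B (N p) < 0 := by
      have h5 : N p + s ^ 2 - N p = s ^ 2 := by ring
      rw [h5, div_lt_iff₀ hs0'] at hs1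
      linarith
    have h6 : N (a + s, p.2) = N p + s ^ 2 := by
      simp [hN, hpa]
      ring
    simp only at hs2
    change p.2 - M * B (N (a + s, p.2)) ≤ p.2 - M * B (N p) at hs2
    rw [h6] at hs2
    nlinarith

/-! ### Contracting a segment in a box -/

/-- A self-map of the plane that contracts the segment `[0,1] × 0` by the factor `α` and is the
identity outside a small neighbourhood of this segment. -/
def contraction (α δ : ℝ) (q : ℝ × ℝ) : ℝ × ℝ :=
  -- The first cutoff is 1 for `q.2 ^ 2 ≤ δ ^ 2 / 8` and 0 for `|q.2| ≥ δ / 2`. The second is 1 over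
  -- `[0,1]` and vanishes outside the interval from `-δ / 2` to `1 + δ / 2`.
  (q.1 - (1 - α) * (Real.smoothTransition (2 - 8 * q.2 ^ 2 / δ ^ 2) *
    Real.smoothTransition (((1 / 2 + δ / 2) ^ 2 - (q.1 - 1 / 2) ^ 2) / ((1 / 2 + δ / 2) ^ 2 - 1 / 4)) *
    (q.1 - 1 / 2)), q.2)

theorem contDiff_contraction (α δ : ℝ) : ContDiff ℝ ∞ (contraction α δ) := by
  have h : ContDiff ℝ ∞ Real.smoothTransition := Real.smoothTransition.contDiff
  unfold contraction
  fun_prop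

theorem contraction_eq_self {α δ : ℝ} (hδ : 0 < δ) {q : ℝ × ℝ}
    (hq : q ∉ Ioo (-(δ / 2)) (1 + δ / 2) ×ˢ Ioo (-(δ / 2)) (δ / 2)) : contraction α δ q = q := by
  have hden : 0 < (1 / 2 + δ / 2) ^ 2 - 1 / 4 := by nlinarith
  have key : Real.smoothTransition (2 - 8 * q.2 ^ 2 / δ ^ 2) *
      Real.smoothTransition
        (((1 / 2 + δ / 2) ^ 2 - (q.1 - 1 / 2) ^ 2) / ((1 / 2 + δ / 2) ^ 2 - 1 / 4)) = 0 := by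
    by_contra hne
    obtain ⟨h1, h2⟩ := mul_ne_zero_iff.1 hne
    rw [Ne, Real.smoothTransition.zero_iff_nonpos, not_le] at h1 h2
    have h3 : 8 * q.2 ^ 2 / δ ^ 2 < 2 := by linarith
    rw [div_lt_iff₀ (by positivity)] at h3
    have h4 : 0 < (1 / 2 + δ / 2) ^ 2 - (q.1 - 1 / 2) ^ 2 := by
      by_contra h
      exact absurd h2 (not_lt.2 (div_nonpos_of_nonpos_of_nonneg (not_lt.1 h) hden.le))
    have h5 := abs_lt_of_sq_lt_sq (show q.2 ^ 2 < (δ / 2) ^ 2 by linarith) (by positivity)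
    have h6 := abs_lt_of_sq_lt_sq (sub_pos.1 h4) (by positivity)
    rw [abs_lt] at h5 h6
    exact hq ⟨⟨by linarith, by linarith⟩, h5⟩
  unfold contraction
  rw [key]
  simp

theorem contraction_segment {α δ : ℝ} (hδ : 0 < δ) {τ : ℝ} (hτ : τ ∈ Icc (0 : ℝ) 1) :
    contraction α δ (τ, 0) = (1 / 2 + α * (τ - 1 / 2), 0) := by
  have hden : 0 < (1 / 2 + δ / 2) ^ 2 - 1 / 4 := by nlinarith
  have h1 : Real.smoothTransition
      (((1 / 2 + δ / 2) ^ 2 - (τ - 1 / 2) ^ 2) / ((1 / 2 + δ / 2) ^ 2 - 1 / 4)) = 1 := by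
    apply Real.smoothTransition.one_of_one_le
    rw [le_div_iff₀ hden]
    nlinarith [hτ.1, hτ.2]
  have h2 : Real.smoothTransition (2 - 8 * 0 ^ 2 / δ ^ 2) = 1 :=
    Real.smoothTransition.one_of_one_le (by norm_num)
  simp only [contraction, h1, h2]
  ext <;> simp
  ring

theorem contraction_mem {α δ : ℝ} (hα : 0 < α) (hα1 : α < 1) {q : ℝ × ℝ}
    (hq : q ∈ Ioo (-δ) (1 + δ) ×ˢ Ioo (-δ) δ) :
    contraction α δ q ∈ Ioo (-δ) (1 + δ) ×ˢ Ioo (-δ) δ := by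
  refine ⟨?_, hq.2⟩
  set z := Real.smoothTransition (2 - 8 * q.2 ^ 2 / δ ^ 2) *
    Real.smoothTransition
      (((1 / 2 + δ / 2) ^ 2 - (q.1 - 1 / 2) ^ 2) / ((1 / 2 + δ / 2) ^ 2 - 1 / 4)) with hz
  have hz0 : 0 ≤ z := mul_nonneg (Real.smoothTransition.nonneg _) (Real.smoothTransition.nonneg _)
  have hz1 : z ≤ 1 := mul_le_one₀ (Real.smoothTransition.le_one _)
    (Real.smoothTransition.nonneg _) (Real.smoothTransition.le_one _)
  have he : (contraction α δ q).1 = 1 / 2 + (1 - (1 - α) * z) * (q.1 - 1 / 2) := by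
    simp only [contraction, ← hz]
    ring
  have hs0 : 0 ≤ 1 - (1 - α) * z := by nlinarith
  have hs1 : 1 - (1 - α) * z ≤ 1 := by nlinarith
  obtain ⟨⟨h1, h2⟩, -⟩ := hq
  rw [he]
  constructor <;> nlinarith [mul_nonneg hs0 (sub_nonneg.2 h1.le), mul_nonneg hs0 (sub_nonneg.2 h2.le)]

/-- The second coordinate is preserved. The horizontal derivative of the first one is at least `α`:
the longitudinal cutoff decreases away from the midpoint `1 / 2`, so the term with its derivative
can only help. -/
theorem fderiv_contraction_injective {α δ : ℝ} (hα : 0 < α) (hα1 : α < 1) (hδ : 0 < δ)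
    (q : ℝ × ℝ) : Function.Injective (fderiv ℝ (contraction α δ) q) := by
  have hden : 0 < (1 / 2 + δ / 2) ^ 2 - 1 / 4 := by nlinarith
  have hd := (((contDiff_contraction α δ).differentiable (by simp)) q).hasFDerivAt
  rw [injective_iff_map_eq_zero]
  intro w hw
  have hw2 : w.2 = 0 := by
    have h1 : HasFDerivAt (fun q => (contraction α δ q).2) (ContinuousLinearMap.snd ℝ ℝ ℝ) q :=
      hasFDerivAt_snd
    have h2 := (hasFDerivAt_snd (𝕜 := ℝ) (p := contraction α δ q)).comp q hd
    have h3 := congrArg (fun T => T w) (h1.unique h2)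
    simpa [hw] using h3
  set A := Real.smoothTransition (2 - 8 * q.2 ^ 2 / δ ^ 2) with hA
  set χ : ℝ → ℝ := fun τ => Real.smoothTransition
    (((1 / 2 + δ / 2) ^ 2 - (τ - 1 / 2) ^ 2) / ((1 / 2 + δ / 2) ^ 2 - 1 / 4)) with hχ
  have hSTd : Differentiable ℝ Real.smoothTransition :=
    (Real.smoothTransition.contDiff (n := 1)).differentiable (by simp)
  set s' := deriv Real.smoothTransition
    (((1 / 2 + δ / 2) ^ 2 - (q.1 - 1 / 2) ^ 2) / ((1 / 2 + δ / 2) ^ 2 - 1 / 4)) with hs'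
  have hs'0 : 0 ≤ s' := Real.smoothTransition.monotone.deriv_nonneg
  have hχd : HasDerivAt χ (s' * (-(2 * (q.1 - 1 / 2)) / ((1 / 2 + δ / 2) ^ 2 - 1 / 4))) q.1 := by
    have h1 : HasDerivAt (fun τ : ℝ => ((1 / 2 + δ / 2) ^ 2 - (τ - 1 / 2) ^ 2) /
        ((1 / 2 + δ / 2) ^ 2 - 1 / 4)) (-(2 * (q.1 - 1 / 2)) / ((1 / 2 + δ / 2) ^ 2 - 1 / 4)) q.1 := by
      have h2 := ((((hasDerivAt_id q.1).sub_const (1 / 2)).pow 2).const_sub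
        ((1 / 2 + δ / 2) ^ 2)).div_const ((1 / 2 + δ / 2) ^ 2 - 1 / 4)
      simpa using h2
    exact (hSTd _).hasDerivAt.comp q.1 h1
  have hl : HasDerivAt (fun t : ℝ => (t, q.2)) ((1 : ℝ), (0 : ℝ)) q.1 :=
    (hasDerivAt_id q.1).prodMk (hasDerivAt_const q.1 q.2)
  have h5 := (hasFDerivAt_fst (𝕜 := ℝ) (p := contraction α δ q)).comp_hasDerivAt q.1
    (hd.comp_hasDerivAt (f := fun t : ℝ => (t, q.2)) q.1 hl)
  have h6 : HasDerivAt (fun τ : ℝ => τ - (1 - α) * (A * χ τ * (τ - 1 / 2))) _ q.1 :=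
    (hasDerivAt_id q.1).sub (((hχd.const_mul A).mul
      ((hasDerivAt_id q.1).sub_const (1 / 2))).const_mul (1 - α))
  have h7 := h5.unique h6
  have hA0 : 0 ≤ A := Real.smoothTransition.nonneg _
  have hA1 : A ≤ 1 := Real.smoothTransition.le_one _
  have hχ0 : 0 ≤ χ q.1 := Real.smoothTransition.nonneg _
  have hχ1 : χ q.1 ≤ 1 := Real.smoothTransition.le_one _
  have hprod : A * χ q.1 ≤ 1 := mul_le_one₀ hA1 hχ0 hχ1
  have hw' : w = w.1 • ((1 : ℝ), (0 : ℝ)) := by ext <;> simp [hw2]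
  have h8 : w.1 * (fderiv ℝ (contraction α δ) q (1, 0)).1 = 0 := by
    have h9 := congrArg Prod.fst hw
    rw [hw', map_smul] at h9
    simpa using h9
  have h10 : 0 < (fderiv ℝ (contraction α δ) q (1, 0)).1 := by
    simp only [ContinuousLinearMap.coe_fst', id_eq, mul_one] at h7
    rw [h7]
    have h11 : A * (s' * (-(2 * (q.1 - 1 / 2)) / ((1 / 2 + δ / 2) ^ 2 - 1 / 4))) * (q.1 - 1 / 2) ≤
        0 := by
      have : A * (s' * (-(2 * (q.1 - 1 / 2)) / ((1 / 2 + δ / 2) ^ 2 - 1 / 4))) * (q.1 - 1 / 2) =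
          -(A * s' * (2 * (q.1 - 1 / 2) ^ 2 / ((1 / 2 + δ / 2) ^ 2 - 1 / 4))) := by ring
      rw [this, neg_nonpos]
      positivity
    nlinarith
  have hw1 : w.1 = 0 := by simpa [h10.ne'] using h8
  exact Prod.ext hw1 hw2

/-! ### Digging a pit along an arc -/

/-- The rotation of the plane by a right angle. -/
def quarterTurn : ℝ × ℝ →L[ℝ] ℝ × ℝ :=
  (-ContinuousLinearMap.snd ℝ ℝ ℝ).prod (ContinuousLinearMap.fst ℝ ℝ ℝ)

@[simp] theorem quarterTurn_apply (w : ℝ × ℝ) : quarterTurn w = (-w.2, w.1) := rfl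

/-- Tubular coordinates along a plane curve. -/
def planeTube (c : ℝ → ℝ × ℝ) (q : ℝ × ℝ) : ℝ × ℝ := c q.1 + q.2 • quarterTurn (deriv c q.1)

theorem contDiff_planeTube {c : ℝ → ℝ × ℝ} (hc : ContDiff ℝ ∞ c) : ContDiff ℝ ∞ (planeTube c) := by
  have h := contDiff_deriv hc
  unfold planeTube
  fun_prop

theorem planeTube_zero (c : ℝ → ℝ × ℝ) (τ : ℝ) : planeTube c (τ, 0) = c τ := by
  simp [planeTube]

/-- On the core the partial derivatives are the velocity and its quarter turn, two orthogonal
vectors of equal nonzero length. -/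
theorem fderiv_planeTube_injective {c : ℝ → ℝ × ℝ} (hc : ContDiff ℝ ∞ c) {τ : ℝ}
    (hτ : deriv c τ ≠ 0) : Function.Injective (fderiv ℝ (planeTube c) (τ, 0)) := by
  have h1 : HasFDerivAt (fun q : ℝ × ℝ => c q.1)
      ((ContinuousLinearMap.fst ℝ ℝ ℝ).smulRight (deriv c τ)) (τ, 0) := by
    have h2 : HasDerivAt c (deriv c τ) τ := ((hc.differentiable (by simp)) τ).hasDerivAt
    have h2' : HasFDerivAt (fun q : ℝ × ℝ => q.1) (ContinuousLinearMap.fst ℝ ℝ ℝ) (τ, (0 : ℝ)) :=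
      hasFDerivAt_fst
    refine (HasFDerivAt.comp (τ, (0 : ℝ)) h2.hasFDerivAt h2').congr_fderiv ?_
    ext <;> simp
  have h3 : HasFDerivAt (fun q : ℝ × ℝ => quarterTurn (deriv c q.1))
      (fderiv ℝ (fun q : ℝ × ℝ => quarterTurn (deriv c q.1)) (τ, 0)) (τ, 0) := by
    have h4 := contDiff_deriv hc
    have h5 : ContDiff ℝ ∞ fun q : ℝ × ℝ => quarterTurn (deriv c q.1) := by fun_prop
    exact (h5.differentiable (by simp) _).hasFDerivAt
  have h6 : HasFDerivAt (planeTube c) _ (τ, 0) :=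
    h1.add ((hasFDerivAt_snd (𝕜 := ℝ) (p := (τ, (0 : ℝ)))).smul h3)
  rw [h6.fderiv, injective_iff_map_eq_zero]
  intro w hw
  set a := deriv c τ with ha
  have e1 : w.1 * a.1 - w.2 * a.2 = 0 := by
    have := congrArg Prod.fst hw
    simp at this
    linarith
  have e2 : w.1 * a.2 + w.2 * a.1 = 0 := by
    have := congrArg Prod.snd hw
    simp at this
    linarith
  have hpos : 0 < a.1 ^ 2 + a.2 ^ 2 := by
    by_contra hle
    apply hτ
    have h7 : a.1 = 0 := by nlinarith [sq_nonneg a.1, sq_nonneg a.2]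
    have h8 : a.2 = 0 := by nlinarith [sq_nonneg a.1, sq_nonneg a.2]
    exact Prod.ext h7 h8
  have f1 : w.1 * (a.1 ^ 2 + a.2 ^ 2) = 0 := by linear_combination a.1 * e1 + a.2 * e2
  have f2 : w.2 * (a.1 ^ 2 + a.2 ^ 2) = 0 := by linear_combination a.1 * e2 - a.2 * e1
  exact Prod.ext (by simpa [hpos.ne'] using f1) (by simpa [hpos.ne'] using f2)

/-- An injective immersed compact arc in an open set of the plane has a tubular neighbourhood. -/
theorem exists_tube {c : ℝ → ℝ × ℝ} (hc : ContDiff ℝ ∞ c) (hinj : InjOn c (Icc 0 1))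
    (hreg : ∀ t ∈ Icc (0 : ℝ) 1, deriv c t ≠ 0) {O : Set (ℝ × ℝ)} (hO : IsOpen O)
    (hcO : ∀ t ∈ Icc (0 : ℝ) 1, c t ∈ O) :
    ∃ δ > 0, InjOn (planeTube c) (Icc (-δ) (1 + δ) ×ˢ Icc (-δ) δ) ∧
      ∀ q ∈ Icc (-δ) (1 + δ) ×ˢ Icc (-δ) δ, planeTube c q ∈ O ∧
        Function.Injective (fderiv ℝ (planeTube c) q) := by
  have hψ := contDiff_planeTube hc
  set K : Set (ℝ × ℝ) := Icc 0 1 ×ˢ {0} with hKdef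
  have hK : IsCompact K := isCompact_Icc.prod isCompact_singleton
  have hmem : ∀ q ∈ K, ∃ τ ∈ Icc (0 : ℝ) 1, q = (τ, 0) := by
    rintro ⟨τ, n⟩ ⟨hτ, hn⟩
    exact ⟨τ, hτ, Prod.ext rfl hn⟩
  have himm : ∀ q ∈ K, Function.Injective (fderiv ℝ (planeTube c) q) := by
    intro q hq
    obtain ⟨τ, hτ, rfl⟩ := hmem q hq
    exact fderiv_planeTube_injective hc (hreg τ hτ)
  have hKinj : InjOn (planeTube c) K := by
    intro q hq q' hq' h
    obtain ⟨τ, hτ, rfl⟩ := hmem q hq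
    obtain ⟨τ', hτ', rfl⟩ := hmem q' hq'
    rw [planeTube_zero, planeTube_zero] at h
    rw [hinj hτ hτ' h]
  -- A map that is injective on a compact set and locally injective at its points is injective on a
  -- neighbourhood of it.
  obtain ⟨V, hV, hVinj⟩ := hKinj.exists_mem_nhdsSet hK
    (fun q _ => hψ.continuous.continuousAt)
    (fun q hq => injOn_nhds_of_immersion (Eventually.of_forall fun _ => hψ.contDiffAt) (himm q hq))
  have hgood : ∀ᶠ q in 𝓝ˢ K, planeTube c q ∈ O ∧ Function.Injective (fderiv ℝ (planeTube c) q) := by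
    rw [Filter.Eventually, mem_nhdsSet_iff_forall]
    intro q hq
    refine Filter.Eventually.and ?_ (eventually_injective_fderiv hψ.contDiffAt (himm q hq))
    apply hψ.continuous.continuousAt.eventually
    obtain ⟨τ, hτ, rfl⟩ := hmem q hq
    rw [planeTube_zero]
    exact hO.mem_nhds (hcO τ hτ)
  obtain ⟨W, hWo, hKW, hWV⟩ := mem_nhdsSet_iff_exists.1 (Filter.inter_mem hV hgood)
  obtain ⟨δ, hδ, hδW⟩ := hK.exists_cthickening_subset_open hWo hKW
  have hbox : ∀ q ∈ Icc (-δ) (1 + δ) ×ˢ Icc (-δ) δ, q ∈ W := by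
    rintro ⟨τ, n⟩ ⟨hτ, hn⟩
    apply hδW
    -- Clamping the first coordinate to `[0,1]` gives a point of the core at sup-distance at most
    -- `δ`.
    refine Metric.mem_cthickening_of_dist_le _ (max 0 (min τ 1), 0) δ K ?_ ?_
    · exact ⟨⟨le_max_left _ _, max_le zero_le_one (min_le_right _ _)⟩, rfl⟩
    · rw [Prod.dist_eq, max_le_iff]
      simp only [Real.dist_eq, abs_le]
      simp only [mem_Icc] at hτ hn
      refine ⟨⟨?_, ?_⟩, by linarith, by linarith⟩
      · have : max 0 (min τ 1) ≤ τ + δ := by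
          apply max_le (by linarith)
          exact (min_le_left _ _).trans (by linarith)
        linarith
      · have : τ - δ ≤ max 0 (min τ 1) := by
          rcases le_total τ 1 with h | h
          · rw [min_eq_left h]
            exact le_max_of_le_right (by linarith)
          · rw [min_eq_right h]
            exact le_max_of_le_right (by linarith)
        linarith
  exact ⟨δ, hδ, hVinj.mono fun q hq => (hWV (hbox q hq)).1, fun q hq => (hWV (hbox q hq)).2⟩

theorem fderiv_bijective_of_injective {f : ℝ × ℝ → ℝ × ℝ} {z : ℝ × ℝ}
    (h : Function.Injective (fderiv ℝ f z)) : Function.Bijective (fderiv ℝ f z) :=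
  ⟨h, LinearMap.injective_iff_surjective (f := (fderiv ℝ f z : ℝ × ℝ →ₗ[ℝ] ℝ × ℝ)).1 h⟩

/-- A compact arc in an open set `O` of the plane can be moved into a given neighbourhood of its
midpoint by a local diffeomorphism of the plane that is the identity off a compact subset of `O`. -/
theorem exists_shrinking {c : ℝ → ℝ × ℝ} (hc : ContDiff ℝ ∞ c) (hinj : InjOn c (Icc 0 1))
    (hreg : ∀ t ∈ Icc (0 : ℝ) 1, deriv c t ≠ 0) {O : Set (ℝ × ℝ)} (hO : IsOpen O)
    (hcO : ∀ t ∈ Icc (0 : ℝ) 1, c t ∈ O) :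
    ∃ N : Set (ℝ × ℝ), IsCompact N ∧ N ⊆ O ∧ N ∈ 𝓝 (c (1 / 2)) ∧
      ∀ D ∈ 𝓝 (c (1 / 2)), ∃ Θ : ℝ × ℝ → ℝ × ℝ, ContDiff ℝ ∞ Θ ∧
        (∀ z, Function.Bijective (fderiv ℝ Θ z)) ∧ (∀ z ∉ N, Θ z = z) ∧ (∀ z ∈ N, Θ z ∈ N) ∧
        ∀ t ∈ Icc (0 : ℝ) 1, Θ (c t) ∈ D := by
  obtain ⟨δ, hδ, hψinj, hψ2⟩ := exists_tube hc hinj hreg hO hcO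
  have hψ := contDiff_planeTube hc
  set ψ := planeTube c with hψdef
  set box : Set (ℝ × ℝ) := Icc (-δ) (1 + δ) ×ˢ Icc (-δ) δ with hbox
  set obox : Set (ℝ × ℝ) := Ioo (-δ) (1 + δ) ×ˢ Ioo (-δ) δ with hobox
  set sbox : Set (ℝ × ℝ) := Icc (-(δ / 2)) (1 + δ / 2) ×ˢ Icc (-(δ / 2)) (δ / 2) with hsbox
  have hboxc : IsCompact box := isCompact_Icc.prod isCompact_Icc
  have hsboxc : IsCompact sbox := isCompact_Icc.prod isCompact_Icc
  have hoboxo : IsOpen obox := isOpen_Ioo.prod isOpen_Ioo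
  have hob : obox ⊆ box := prod_mono Ioo_subset_Icc_self Ioo_subset_Icc_self
  have hso : sbox ⊆ obox := prod_mono (Icc_subset_Ioo (by linarith) (by linarith))
    (Icc_subset_Ioo (by linarith) (by linarith))
  have hopen : ∀ q ∈ obox, ψ '' obox ∈ 𝓝 (ψ q) := by
    intro q hq
    have h1 := (hψ.contDiffAt.hasStrictFDerivAt (x := q) (by simp)).map_nhds_eq_of_surj
      (LinearMap.range_eq_top.2 (fderiv_bijective_of_injective (hψ2 q (hob hq)).2).2)
    rw [← h1]
    exact image_mem_map (hoboxo.mem_nhds hq)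
  have hoimg : IsOpen (ψ '' obox) := by
    rw [isOpen_iff_mem_nhds]
    rintro _ ⟨q, hq, rfl⟩
    exact hopen q hq
  obtain ⟨g, hg, hgψ⟩ := exists_smooth_leftInverse hψ hboxc hψinj fun q hq => (hψ2 q hq).2
  have hseg : ∀ t ∈ Icc (0 : ℝ) 1, ((t, 0) : ℝ × ℝ) ∈ obox := fun t ht =>
    ⟨⟨by linarith [ht.1], by linarith [ht.2]⟩, by linarith, hδ⟩
  refine ⟨ψ '' box, hboxc.image hψ.continuous, ?_, ?_, ?_⟩
  · rintro _ ⟨q, hq, rfl⟩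
    exact (hψ2 q hq).1
  · have h := hopen (1 / 2, 0) (hseg _ ⟨by norm_num, by norm_num⟩)
    rw [hψdef, planeTube_zero] at h
    exact mem_of_superset h (image_mono hob)
  intro D hD
  -- After contraction by `α` the segment is within `α / 2` of its midpoint, so a small `α` brings
  -- the arc into `D`.
  obtain ⟨α, hα, hα1, hαD⟩ : ∃ α : ℝ, 0 < α ∧ α < 1 ∧ ∀ u : ℝ, |u| < α → c (1 / 2 + u) ∈ D := by
    have h1 : ContinuousAt (fun u : ℝ => c (1 / 2 + u)) 0 := by
      have := hc.continuous
      fun_prop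
    have h2 : ∀ᶠ u in 𝓝 (0 : ℝ), c (1 / 2 + u) ∈ D := by
      apply h1.eventually_mem
      simpa using hD
    obtain ⟨ε, hε, hεD⟩ := Metric.eventually_nhds_iff.1 h2
    refine ⟨min ε (1 / 2), by positivity, (min_le_right _ _).trans_lt (by norm_num), fun u hu => ?_⟩
    apply hεD
    simpa using hu.trans_le (min_le_left _ _)
  classical
  set S := contraction α δ with hS
  have hSid : ∀ q ∉ sbox, S q = q := fun q hq =>
    contraction_eq_self hδ fun h => hq (prod_mono Ioo_subset_Icc_self Ioo_subset_Icc_self h)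
  have hSo : ∀ q ∈ obox, S q ∈ obox := fun q hq => contraction_mem hα hα1 hq
  have hSb : ∀ q ∈ box, S q ∈ box := by
    intro q hq
    by_cases h : q ∈ sbox
    · exact hob (hSo q (hso h))
    · rwa [hSid q h]
  -- The contraction in tube coordinates, extended by the identity. The two descriptions overlap
  -- between the images of `sbox` and `box`, where the contraction is the identity.
  set Θ : ℝ × ℝ → ℝ × ℝ := fun z => if z ∈ ψ '' box then ψ (S (g z)) else z with hΘ
  have hΘψ : ∀ q ∈ box, Θ (ψ q) = ψ (S q) := by
    intro q hq
    simp only [hΘ]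
    rw [if_pos ⟨q, hq, rfl⟩, hgψ q hq]
  have hΘout : ∀ z ∉ ψ '' sbox, Θ z = z := by
    intro z hz
    by_cases h : z ∈ ψ '' box
    · obtain ⟨q, hq, rfl⟩ := h
      rw [hΘψ q hq, hSid q fun hs => hz ⟨q, hs, rfl⟩]
    · simp only [hΘ]
      rw [if_neg h]
  have hnear1 : ∀ q ∈ obox, Θ =ᶠ[𝓝 (ψ q)] fun z => ψ (S (g z)) := by
    intro q hq
    filter_upwards [hopen q hq] with z hz
    obtain ⟨q', hq', rfl⟩ := hz
    rw [hΘψ q' (hob hq'), hgψ q' (hob hq')]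
  have hnear2 : ∀ z ∉ ψ '' sbox, Θ =ᶠ[𝓝 z] id := by
    intro z hz
    filter_upwards [(hsboxc.image hψ.continuous).isClosed.isOpen_compl.mem_nhds hz] with y hy
    exact hΘout y hy
  have hSs : ContDiff ℝ ∞ S := contDiff_contraction α δ
  have hΘs : ContDiff ℝ ∞ Θ := by
    rw [contDiff_iff_contDiffAt]
    intro z
    by_cases hz : z ∈ ψ '' sbox
    · obtain ⟨q, hq, rfl⟩ := hz
      exact ((hψ.comp (hSs.comp hg)).contDiffAt).congr_of_eventuallyEq (hnear1 q (hso hq))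
    · exact contDiffAt_id.congr_of_eventuallyEq (hnear2 z hz)
  refine ⟨Θ, hΘs, ?_, ?_, ?_, ?_⟩
  · intro z
    by_cases hz : z ∈ ψ '' sbox
    · obtain ⟨q, hq, rfl⟩ := hz
      have hqo := hso hq
      apply fderiv_bijective_of_injective
      have hdψ : HasFDerivAt ψ (fderiv ℝ ψ q) q := ((hψ.differentiable (by simp)) q).hasFDerivAt
      have hdΘ : HasFDerivAt Θ (fderiv ℝ Θ (ψ q)) (ψ q) :=
        ((hΘs.differentiable (by simp)) _).hasFDerivAt
      have hdS : HasFDerivAt S (fderiv ℝ S q) q := ((hSs.differentiable (by simp)) q).hasFDerivAt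
      have hdψ' : HasFDerivAt ψ (fderiv ℝ ψ (S q)) (S q) :=
        ((hψ.differentiable (by simp)) _).hasFDerivAt
      -- Differentiating `Θ ∘ ψ = ψ ∘ S` reduces the claim to the invertibility of the derivatives
      -- of `S` and `ψ`.
      have h1 := hdΘ.comp q hdψ
      have h2 := (hdψ'.comp q hdS).congr_of_eventuallyEq (f₁ := Θ ∘ ψ) (by
        filter_upwards [hoboxo.mem_nhds hqo] with y hy
        exact hΘψ y (hob hy))
      have h3 := h1.unique h2
      have hb := fderiv_bijective_of_injective (hψ2 q (hob hqo)).2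
      intro a b hab
      obtain ⟨a, rfl⟩ := hb.2 a
      obtain ⟨b, rfl⟩ := hb.2 b
      have h4 := congrArg (fun T => T a) h3
      have h5 := congrArg (fun T => T b) h3
      simp only [ContinuousLinearMap.comp_apply] at h4 h5
      rw [h4, h5] at hab
      rw [fderiv_contraction_injective hα hα1 hδ q ((hψ2 _ (hob (hSo q hqo))).2 hab)]
    · rw [(hnear2 z hz).fderiv_eq, fderiv_id]
      exact Function.bijective_id
  · intro z hz
    exact hΘout z fun h => hz (image_mono (hso.trans hob) h)
  · rintro _ ⟨q, hq, rfl⟩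
    rw [hΘψ q hq]
    exact ⟨_, hSb q hq, rfl⟩
  · intro t ht
    have h1 : c t = ψ (t, 0) := (planeTube_zero c t).symm
    rw [h1, hΘψ _ (hob (hseg t ht)), hS, contraction_segment hδ ht, hψdef, planeTube_zero]
    apply hαD
    rw [abs_mul, abs_of_pos hα]
    have : |t - 1 / 2| ≤ 1 / 2 := by
      rw [abs_le]
      constructor <;> linarith [ht.1, ht.2]
    nlinarith

/-- Along a compact arc in an open set `O` of the plane, a pit can be dug into the height function
without creating local maxima. -/
theorem exists_pit {c : ℝ → ℝ × ℝ} (hc : ContDiff ℝ ∞ c) (hinj : InjOn c (Icc 0 1))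
    (hreg : ∀ t ∈ Icc (0 : ℝ) 1, deriv c t ≠ 0) {O : Set (ℝ × ℝ)} (hO : IsOpen O)
    (hcO : ∀ t ∈ Icc (0 : ℝ) 1, c t ∈ O) {l m : ℝ} (hml : m < l) (hl : ∀ p ∈ O, l ≤ p.2) :
    ∃ (h : ℝ × ℝ → ℝ) (N : Set (ℝ × ℝ)), ContDiff ℝ ∞ h ∧ IsCompact N ∧ N ⊆ O ∧
      (∀ p ∉ N, h p = p.2) ∧ (∀ t ∈ Icc (0 : ℝ) 1, h (c t) < l) ∧
      (∀ p ∈ N, m < h p ∧ ∃ q ∈ N, h p ≤ q.2) ∧ ∀ p, MorseNoMaxAt h p := by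
  obtain ⟨N, hN, hNO, hNn, hΘ⟩ := exists_shrinking hc hinj hreg hO hcO
  set a := (c (1 / 2)).1 with ha
  set b := (c (1 / 2)).2 with hb
  have hbl : l ≤ b := hl _ (hcO _ ⟨by norm_num, by norm_num⟩)
  obtain ⟨ρ₀, hρ₀, hρN⟩ := Metric.mem_nhds_iff.1 hNn
  set ρ := min ρ₀ ((l - m) / 4) with hρdef
  have hρ : 0 < ρ := lt_min hρ₀ (by linarith)
  have hρl : ρ ≤ (l - m) / 4 := min_le_right _ _
  set B : ℝ → ℝ := fun u => Real.smoothTransition (2 * (1 - u / ρ ^ 2)) with hB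
  have hST : ContDiff ℝ ∞ Real.smoothTransition := Real.smoothTransition.contDiff
  have hBs : ContDiff ℝ ∞ B := by fun_prop
  have hBa : Antitone B := by
    intro u v huv
    apply Real.smoothTransition.monotone
    have : u / ρ ^ 2 ≤ v / ρ ^ 2 := by gcongr
    linarith
  have hB1 : ∀ u, u ≤ ρ ^ 2 / 2 → B u = 1 := by
    intro u hu
    apply Real.smoothTransition.one_of_one_le
    have : u / ρ ^ 2 ≤ 1 / 2 := by
      rw [div_le_iff₀ (by positivity)]
      linarith
    linarith
  have hB0 : ∀ u, ρ ^ 2 ≤ u → B u = 0 := by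
    intro u hu
    apply Real.smoothTransition.zero_of_nonpos
    have : 1 ≤ u / ρ ^ 2 := by
      rw [le_div_iff₀ (by positivity)]
      linarith
    linarith
  have hBle : ∀ u, B u ≤ 1 := fun u => Real.smoothTransition.le_one _
  have hBnn : ∀ u, 0 ≤ B u := fun u => Real.smoothTransition.nonneg _
  have hk : ContDiff ℝ ∞ fun y : ℝ => 2 * deriv B (y ^ 2) * y := by
    have := contDiff_deriv hBs
    fun_prop
  -- Within distance `ρ` of the centre the second coordinate lies between `b - ρ` and `b + ρ`. Hence
  -- a depth above `b - l + ρ` puts the flat bottom below `l`, and a depth below `b - m - ρ` keeps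
  -- the whole pit above `m`. There is room since `ρ ≤ (l - m) / 4`.
  obtain ⟨M, ⟨hM1, hM2⟩, hMreg⟩ := exists_mem_Ioo_regular hk (a := b - l + ρ) (b := b - m - ρ)
    (by linarith) (by linarith)
  have hM0 : 0 < M := by linarith
  set D : Set (ℝ × ℝ) := {p | (p.1 - a) ^ 2 + (p.2 - b) ^ 2 < ρ ^ 2 / 2} with hD
  have hDo : IsOpen D := isOpen_lt (by fun_prop) (by fun_prop)
  obtain ⟨Θ, hΘs, hΘb, hΘid, hΘN, hΘc⟩ := hΘ D (hDo.mem_nhds (by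
    change (a - a) ^ 2 + (b - b) ^ 2 < ρ ^ 2 / 2
    rw [sub_self, sub_self]
    have := pow_pos hρ 2
    linarith))
  set H : ℝ × ℝ → ℝ := fun p => p.2 - M * B ((p.1 - a) ^ 2 + (p.2 - b) ^ 2) with hH
  have hHs : ContDiff ℝ ∞ H := by fun_prop
  have hHlow : ∀ p, p ∈ N → m < H p := by
    intro p hp
    by_cases hd : ρ ^ 2 ≤ (p.1 - a) ^ 2 + (p.2 - b) ^ 2
    · simp only [hH, hB0 _ hd]
      linarith [hl p (hNO hp)]
    · have h1 : (p.2 - b) ^ 2 < ρ ^ 2 := by nlinarith [sq_nonneg (p.1 - a)]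
      have h2 := abs_lt.1 (abs_lt_of_sq_lt_sq h1 hρ.le)
      have h3 := hBle ((p.1 - a) ^ 2 + (p.2 - b) ^ 2)
      simp only [hH]
      nlinarith
  refine ⟨H ∘ Θ, N, hHs.comp hΘs, hN, hNO, ?_, ?_, ?_, ?_⟩
  · intro p hp
    simp only [Function.comp_apply, hΘid p hp, hH]
    rw [hB0, mul_zero, sub_zero]
    by_contra hlt
    apply hp
    apply hρN
    have h1 : (p.1 - a) ^ 2 < ρ ^ 2 := by nlinarith [sq_nonneg (p.2 - b)]
    have h2 : (p.2 - b) ^ 2 < ρ ^ 2 := by nlinarith [sq_nonneg (p.1 - a)]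
    rw [Metric.mem_ball, Prod.dist_eq, max_lt_iff, Real.dist_eq, Real.dist_eq]
    exact ⟨(abs_lt_of_sq_lt_sq h1 hρ.le).trans_le (min_le_left _ _),
      (abs_lt_of_sq_lt_sq h2 hρ.le).trans_le (min_le_left _ _)⟩
  · intro t ht
    have h1 : (Θ (c t)).1 - a = (Θ (c t)).1 - a := rfl
    have h2 : ((Θ (c t)).1 - a) ^ 2 + ((Θ (c t)).2 - b) ^ 2 < ρ ^ 2 / 2 := hΘc t ht
    simp only [Function.comp_apply, hH, hB1 _ h2.le]
    have h3 : ((Θ (c t)).2 - b) ^ 2 < ρ ^ 2 := by nlinarith [sq_nonneg ((Θ (c t)).1 - a)]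
    have h4 := abs_lt.1 (abs_lt_of_sq_lt_sq h3 hρ.le)
    linarith
  · intro p hp
    -- Digging only lowers the height, so the new height at `p` is at most the second coordinate of
    -- `Θ p`.
    refine ⟨hHlow _ (hΘN p hp), Θ p, hΘN p hp, ?_⟩
    simp only [Function.comp_apply, hH]
    have := mul_nonneg hM0.le (hBnn (((Θ p).1 - a) ^ 2 + ((Θ p).2 - b) ^ 2))
    linarith
  · intro p
    exact (morseNoMaxAt_roundPit hBs hBa hM0 a b hMreg (Θ p)).comp hHs.contDiffAt hΘs.contDiffAt
      (hΘb p)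

/-! ### The half-moon in coordinates -/

/-- Half the length of the chord of the half-moon. -/
def halfChord : ℝ := √3 / 2

theorem halfChord_sq : halfChord ^ 2 = 3 / 4 := by
  rw [halfChord, div_pow, Real.sq_sqrt (by norm_num)]
  norm_num

theorem halfChord_pos : 0 < halfChord := by
  unfold halfChord
  positivity

theorem abs_le_halfChord {v : ℝ} : |v| ≤ halfChord ↔ v ^ 2 ≤ 3 / 4 := by
  rw [← halfChord_sq, sq_le_sq, abs_of_pos halfChord_pos]

theorem abs_lt_halfChord {v : ℝ} : |v| < halfChord ↔ v ^ 2 < 3 / 4 := by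
  rw [← halfChord_sq, sq_lt_sq, abs_of_pos halfChord_pos]

/-- A point of the plane. -/
def planePoint (a v : ℝ) : E2 := !₂[a, v]

@[simp] theorem planePoint_zero (a v : ℝ) : planePoint a v 0 = a := rfl

@[simp] theorem planePoint_one (a v : ℝ) : planePoint a v 1 = v := rfl

theorem planePoint_self (q : E2) : planePoint (q 0) (q 1) = q := by
  ext i
  fin_cases i <;> rfl

theorem planePoint_inj {a v a' v' : ℝ} (h : planePoint a v = planePoint a' v') :
    a = a' ∧ v = v' :=
  ⟨by simpa using congrArg (fun q : E2 => q 0) h, by simpa using congrArg (fun q : E2 => q 1) h⟩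

theorem norm_sq_E2 (q : E2) : ‖q‖ ^ 2 = q 0 ^ 2 + q 1 ^ 2 := by
  rw [EuclideanSpace.real_norm_sq_eq, Fin.sum_univ_two]

theorem norm_lt_iff_E2 {q : E2} {r : ℝ} (hr : 0 ≤ r) : ‖q‖ < r ↔ q 0 ^ 2 + q 1 ^ 2 < r ^ 2 := by
  rw [← norm_sq_E2, sq_lt_sq₀ (norm_nonneg _) hr]

theorem norm_le_iff_E2 {q : E2} {r : ℝ} (hr : 0 ≤ r) : ‖q‖ ≤ r ↔ q 0 ^ 2 + q 1 ^ 2 ≤ r ^ 2 := by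
  rw [← norm_sq_E2, sq_le_sq₀ (norm_nonneg _) hr]

theorem le_norm_iff_E2 {q : E2} {r : ℝ} (hr : 0 ≤ r) : r ≤ ‖q‖ ↔ r ^ 2 ≤ q 0 ^ 2 + q 1 ^ 2 := by
  rw [← norm_sq_E2, sq_le_sq₀ hr (norm_nonneg _)]

theorem isCompact_halfMoon : IsCompact halfMoon := by
  apply (isCompact_closedBall (0 : E2) 1).of_isClosed_subset
  · exact (isClosed_le continuous_norm continuous_const).inter
      (isClosed_le continuous_const ((EuclideanSpace.proj (𝕜 := ℝ) (0 : Fin 2)).continuous))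
  · intro q hq
    simpa using hq.1

theorem mem_chord {q : E2} : q ∈ chord ↔ ∃ v, |v| ≤ halfChord ∧ planePoint (1 / 2) v = q := by
  constructor
  · rintro ⟨h1, h2⟩
    refine ⟨q 1, ?_, ?_⟩
    · rw [norm_le_iff_E2 zero_le_one, h2] at h1
      rw [abs_le_halfChord]
      linarith
    · rw [← h2, planePoint_self]
  · rintro ⟨v, hv, rfl⟩
    refine ⟨?_, rfl⟩
    rw [norm_le_iff_E2 zero_le_one]
    rw [abs_le_halfChord] at hv
    simp
    linarith

theorem abs_le_of_mem_halfMoon {q : E2} (hq : q ∈ halfMoon) : |q 1| ≤ halfChord := by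
  obtain ⟨h1, h2⟩ := hq
  rw [norm_le_iff_E2 zero_le_one] at h1
  rw [abs_le_halfChord]
  nlinarith

theorem contDiff_flat (σ : ℝ) : ContDiff ℝ ∞ (flat σ) := by
  rw [contDiff_euclidean]
  intro i
  unfold flat
  fin_cases i <;> simp <;> fun_prop

theorem norm_flat {σ : ℝ} (hσ : σ ^ 2 = 1) (q : E2) : ‖flat σ q‖ = ‖q‖ := by
  rw [← sq_eq_sq₀ (norm_nonneg _) (norm_nonneg _), norm_sq_E2, EuclideanSpace.real_norm_sq_eq,
    Fin.sum_univ_three]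
  simp only [flat, PiLp.toLp_apply, Matrix.cons_val]
  rw [mul_pow, hσ]
  ring

theorem flat_injective {σ : ℝ} (hσ : σ ^ 2 = 1) : Function.Injective (flat σ) := by
  intro q q' h
  have h0 : σ * q 0 = σ * q' 0 := by simpa [flat] using congrArg (fun p : E3 => p 0) h
  have h1 : q 1 = q' 1 := by simpa [flat] using congrArg (fun p : E3 => p 2) h
  have hσ0 : σ ≠ 0 := by
    rintro rfl
    norm_num at hσ
  have h2 := mul_left_cancel₀ hσ0 h0
  ext i
  fin_cases i
  · exact h2
  · exact h1

theorem fderiv_flat_injective {σ : ℝ} (hσ : σ ^ 2 = 1) (q : E2) :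
    Function.Injective (fderiv ℝ (flat σ) q) := by
  have hlin : IsLinearMap ℝ (flat σ) := by
    constructor
    · intro x y
      ext i
      fin_cases i <;> simp [flat] <;> ring
    · intro a x
      ext i
      fin_cases i <;> simp [flat] <;> ring
  have h : HasFDerivAt (flat σ) (LinearMap.toContinuousLinearMap hlin.mk') q :=
    (LinearMap.toContinuousLinearMap hlin.mk').hasFDerivAt
  rw [h.fderiv]
  exact flat_injective hσ

/-- The sides of the model ball. -/
def sgn (i : Bool) : ℝ := if i then 1 else -1

theorem sgn_sq (i : Bool) : sgn i ^ 2 = 1 := by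
  cases i <;> norm_num [sgn]

theorem sgn_not (i : Bool) : sgn (!i) = -sgn i := by
  cases i <;> norm_num [sgn]

/-- Points in the two flat half-moons are distinct. -/
theorem flat_ne_flat_not {i : Bool} {q q' : E2} (hq : q ∈ halfMoon) (hq' : q' ∈ halfMoon) :
    flat (sgn i) q ≠ flat (sgn !i) q' := by
  intro h
  have h0 : sgn i * q 0 = sgn (!i) * q' 0 := by simpa [flat] using congrArg (fun p : E3 => p 0) h
  rw [sgn_not] at h0
  have h1 := hq.2
  have h2 := hq'.2
  cases i <;> simp [sgn] at h0 <;> linarith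

/-! ### Pushing the strand across the half-moon -/

/-- A profile function whose graph, as seen from the chord, is a curve that agrees with the chord
near its end points and lies outside the disk of radius `r`. -/
theorem exists_profile {r : ℝ} (hr : 1 / 2 < r) (hr1 : r < 1) :
    ∃ U : ℝ → ℝ, ContDiff ℝ ∞ U ∧ (∀ v, 0 ≤ U v) ∧
      (∃ a < halfChord, ∀ v, a ≤ |v| → U v = 0) ∧
      (∀ v, |v| ≤ halfChord → r ≤ ‖planePoint (1 / 2 + U v) v‖ ∧
        ‖planePoint (1 / 2 + U v) v‖ ≤ 1) ∧
      (∀ v, |v| < halfChord → ‖planePoint (1 / 2 + U v) v‖ < 1) ∧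
      ∀ q : E2, 1 / 2 ≤ q 0 → ‖q‖ < r → q 0 < 1 / 2 + U (q 1) := by
  obtain ⟨s, hrs, hs1⟩ := exists_between hr1
  have hden : 0 < s ^ 2 - r ^ 2 := by nlinarith
  set χ : ℝ → ℝ := fun v => Real.smoothTransition ((s ^ 2 - 1 / 4 - v ^ 2) / (s ^ 2 - r ^ 2)) with hχ
  have hχs : ContDiff ℝ ∞ χ := by
    have : ContDiff ℝ ∞ Real.smoothTransition := Real.smoothTransition.contDiff
    fun_prop
  have hχ0 : ∀ v, 0 ≤ χ v := fun v => Real.smoothTransition.nonneg _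
  have hχ1 : ∀ v, χ v ≤ 1 := fun v => Real.smoothTransition.le_one _
  have hχone : ∀ v, v ^ 2 ≤ r ^ 2 - 1 / 4 → χ v = 1 := by
    intro v hv
    apply Real.smoothTransition.one_of_one_le
    rw [le_div_iff₀ hden]
    linarith
  have hχzero : ∀ v, s ^ 2 - 1 / 4 ≤ v ^ 2 → χ v = 0 := by
    intro v hv
    apply Real.smoothTransition.zero_of_nonpos
    exact div_nonpos_of_nonpos_of_nonneg (by linarith) hden.le
  -- The graph follows the circle of radius `s`, with `r < s < 1`, wherever the disk of radius `r`
  -- protrudes beyond the chord, and it is cut off to the chord before the circle would cross it.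
  set U : ℝ → ℝ := fun v => χ v * (√(s ^ 2 - v ^ 2) - 1 / 2) with hU
  have hsqrt : ∀ v, v ^ 2 < s ^ 2 - 1 / 4 → 1 / 2 < √(s ^ 2 - v ^ 2) := by
    intro v hv
    rw [Real.lt_sqrt (by norm_num)]
    linarith
  have hU0 : ∀ v, 0 ≤ U v := by
    intro v
    rcases lt_or_ge (v ^ 2) (s ^ 2 - 1 / 4) with h | h
    · exact mul_nonneg (hχ0 v) (by linarith [hsqrt v h])
    · simp only [hU, hχzero v h, zero_mul, le_refl]
  have hUle : ∀ v, v ^ 2 < s ^ 2 - 1 / 4 → (1 / 2 + U v) ^ 2 + v ^ 2 ≤ s ^ 2 := by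
    intro v h
    have h1 : 1 / 2 + U v ≤ √(s ^ 2 - v ^ 2) := by
      have := mul_le_mul_of_nonneg_right (hχ1 v) (sub_nonneg.2 (hsqrt v h).le)
      simp only [hU]
      linarith
    have h2 : (1 / 2 + U v) ^ 2 ≤ √(s ^ 2 - v ^ 2) ^ 2 := by
      have := hU0 v
      gcongr
    rw [Real.sq_sqrt (by nlinarith)] at h2
    linarith
  refine ⟨U, ?_, hU0, ⟨√(s ^ 2 - 1 / 4), ?_, ?_⟩, ?_, ?_, ?_⟩
  · rw [contDiff_iff_contDiffAt]
    intro v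
    rcases lt_or_ge (v ^ 2) (s ^ 2) with h | h
    · have h1 : ContDiffAt ℝ ∞ (fun v : ℝ => √(s ^ 2 - v ^ 2)) v :=
        ContDiffAt.sqrt (by fun_prop) (by linarith)
      exact hχs.contDiffAt.mul (h1.sub contDiffAt_const)
    -- The square root is not smooth where `v ^ 2 = s ^ 2`, but there the cutoff already vanishes.
    · have h1 : ∀ᶠ w in 𝓝 v, s ^ 2 - 1 / 4 < w ^ 2 :=
        (continuous_pow 2).continuousAt.eventually (lt_mem_nhds (by linarith))
      have h2 : U =ᶠ[𝓝 v] fun _ => 0 := by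
        filter_upwards [h1] with w hw
        simp only [hU, hχzero w hw.le, zero_mul]
      exact contDiffAt_const.congr_of_eventuallyEq h2
  · rw [← abs_of_nonneg (Real.sqrt_nonneg (s ^ 2 - 1 / 4)), abs_lt_halfChord,
      Real.sq_sqrt (by nlinarith)]
    nlinarith
  · intro v hv
    have : s ^ 2 - 1 / 4 ≤ v ^ 2 := by
      rw [← sq_abs v]
      exact Real.sqrt_le_left (abs_nonneg v) |>.1 hv
    simp only [hU, hχzero v this, zero_mul]
  · intro v hv
    rw [abs_le_halfChord] at hv
    rw [le_norm_iff_E2 (by linarith), norm_le_iff_E2 zero_le_one]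
    simp only [planePoint_zero, planePoint_one]
    constructor
    · rcases le_or_gt (v ^ 2) (r ^ 2 - 1 / 4) with h | h
      · have h1 : (1 / 2 + U v) = √(s ^ 2 - v ^ 2) := by
          simp only [hU, hχone v h]
          ring
        rw [h1, Real.sq_sqrt (by nlinarith)]
        nlinarith
      · nlinarith [hU0 v]
    · rcases lt_or_ge (v ^ 2) (s ^ 2 - 1 / 4) with h | h
      · nlinarith [hUle v h]
      · simp only [hU, hχzero v h, zero_mul]
        linarith
  · intro v hv
    rw [abs_lt_halfChord] at hv
    rw [norm_lt_iff_E2 zero_le_one]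
    simp only [planePoint_zero, planePoint_one]
    rcases lt_or_ge (v ^ 2) (s ^ 2 - 1 / 4) with h | h
    · nlinarith [hUle v h]
    · simp only [hU, hχzero v h, zero_mul]
      linarith
  · intro q hq hqr
    rw [norm_lt_iff_E2 (by linarith)] at hqr
    have h1 : q 1 ^ 2 ≤ r ^ 2 - 1 / 4 := by nlinarith
    simp only [hU, hχone _ h1, one_mul]
    have : q 0 < √(s ^ 2 - q 1 ^ 2) := by
      rw [Real.lt_sqrt (by linarith)]
      nlinarith
    linarith

/-- The point of the half-moon at height fraction `w` under the graph of the profile. -/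
def graphPoint (U : ℝ → ℝ) (w v : ℝ) : E2 := planePoint (1 / 2 + w * U v) v

theorem contDiff_graphPoint {U θ : ℝ → ℝ} (hU : ContDiff ℝ ∞ U) (hθ : ContDiff ℝ ∞ θ) :
    ContDiff ℝ ∞ fun p : ℝ × ℝ => graphPoint U (θ p.2) p.1 := by
  rw [contDiff_euclidean]
  intro i
  unfold graphPoint planePoint
  fin_cases i
  · simp only [Fin.zero_eta, PiLp.toLp_apply, Matrix.cons_val_zero]
    fun_prop
  · simp only [Fin.mk_one, PiLp.toLp_apply, Matrix.cons_val_one, Matrix.cons_val_fin_one]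
    fun_prop

theorem graphPoint_mem {U : ℝ → ℝ} (hU0 : ∀ v, 0 ≤ U v)
    (hU1 : ∀ v, |v| ≤ halfChord → ‖planePoint (1 / 2 + U v) v‖ ≤ 1) {w v : ℝ}
    (hw0 : 0 ≤ w) (hw1 : w ≤ 1) (hv : |v| ≤ halfChord) : graphPoint U w v ∈ halfMoon := by
  have h1 := hU1 v hv
  have h2 := hU0 v
  rw [norm_le_iff_E2 zero_le_one] at h1
  have h3 : 0 ≤ w * U v := mul_nonneg hw0 h2
  have h4 : w * U v ≤ U v := mul_le_of_le_one_left h2 hw1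
  refine ⟨?_, ?_⟩
  · rw [norm_le_iff_E2 zero_le_one]
    simp only [graphPoint, planePoint_zero, planePoint_one] at h1 ⊢
    nlinarith
  · simp only [graphPoint, planePoint_zero]
    linarith

/-- The movement of a strand away from the chord. -/
def rise (t : ℝ) : ℝ := Real.smoothTransition (4 * t - 1 / 2)

/-- The movement of a strand back to the chord, in the time window from `w` to `w + 1 / 10`. -/
def fall (w t : ℝ) : ℝ := 1 - Real.smoothTransition (10 * (t - w))

theorem contDiff_rise : ContDiff ℝ ∞ rise := by
  have : ContDiff ℝ ∞ Real.smoothTransition := Real.smoothTransition.contDiff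
  unfold rise
  fun_prop

theorem contDiff_fall (w : ℝ) : ContDiff ℝ ∞ (fall w) := by
  have : ContDiff ℝ ∞ Real.smoothTransition := Real.smoothTransition.contDiff
  unfold fall
  fun_prop

theorem rise_nonneg (t : ℝ) : 0 ≤ rise t := Real.smoothTransition.nonneg _

theorem rise_le_one (t : ℝ) : rise t ≤ 1 := Real.smoothTransition.le_one _

theorem rise_eq_zero {t : ℝ} (h : t ≤ 1 / 8) : rise t = 0 :=
  Real.smoothTransition.zero_of_nonpos (by linarith)

theorem rise_eq_one {t : ℝ} (h : 3 / 8 ≤ t) : rise t = 1 :=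
  Real.smoothTransition.one_of_one_le (by linarith)

theorem fall_nonneg (w t : ℝ) : 0 ≤ fall w t := sub_nonneg.2 (Real.smoothTransition.le_one _)

theorem fall_le_one (w t : ℝ) : fall w t ≤ 1 := sub_le_self _ (Real.smoothTransition.nonneg _)

theorem fall_eq_one {w t : ℝ} (h : t ≤ w) : fall w t = 1 := by
  rw [fall, Real.smoothTransition.zero_of_nonpos (by linarith), sub_zero]

theorem fall_eq_zero {w t : ℝ} (h : w + 1 / 10 ≤ t) : fall w t = 0 := by
  rw [fall, Real.smoothTransition.one_of_one_le (by linarith), sub_self]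

theorem lt_of_fall_lt_one {w t : ℝ} (h : fall w t < 1) : w < t := by
  by_contra hle
  exact h.ne (fall_eq_one (not_lt.1 hle))

theorem lt_of_fall_pos {w t : ℝ} (h : 0 < fall w t) : t < w + 1 / 10 := by
  by_contra hle
  exact h.ne' (fall_eq_zero (not_lt.1 hle))

theorem deriv_fall_ne_zero {w t : ℝ} (h1 : w < t) (h2 : t < w + 1 / 10) : deriv (fall w) t ≠ 0 := by
  have hd : HasDerivAt (fall w) (-(deriv Real.smoothTransition (10 * (t - w)) * 10)) t := by
    have h3 : HasDerivAt (fun t : ℝ => 10 * (t - w)) 10 t := by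
      simpa using ((hasDerivAt_id t).sub_const w).const_mul 10
    have h4 : HasDerivAt Real.smoothTransition (deriv Real.smoothTransition (10 * (t - w)))
        (10 * (t - w)) :=
      (((Real.smoothTransition.contDiff (n := 1)).differentiable (by simp)) _).hasDerivAt
    exact (h4.comp t h3).const_sub 1
  rw [hd.deriv]
  have := deriv_smoothTransition_pos (x := 10 * (t - w)) (by linarith) (by linarith)
  linarith

theorem eq_of_fall_eq {w t t' : ℝ} (h : fall w t = fall w t') (h0 : 0 < fall w t)
    (h1 : fall w t < 1) : t = t' := by
  have a1 := lt_of_fall_lt_one h1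
  have a2 := lt_of_fall_pos h0
  rw [h] at h0 h1
  have b1 := lt_of_fall_lt_one h1
  have b2 := lt_of_fall_pos h0
  have h2 : Real.smoothTransition (10 * (t - w)) = Real.smoothTransition (10 * (t' - w)) := by
    unfold fall at h
    linarith
  have h3 := strictMonoOn_smoothTransition.injOn (x₁ := 10 * (t - w)) (x₂ := 10 * (t' - w))
    ⟨by linarith, by linarith⟩ ⟨by linarith, by linarith⟩ h2
  linarith

theorem exists_fall_eq (w : ℝ) {c : ℝ} (h0 : 0 ≤ c) (h1 : c ≤ 1) :
    ∃ t ∈ Icc w (w + 1 / 10), fall w t = c := by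
  have h := intermediate_value_Icc' (show w ≤ w + 1 / 10 by linarith)
    (contDiff_fall w).continuous.continuousOn
  rw [fall_eq_one le_rfl, fall_eq_zero le_rfl] at h
  exact h ⟨h0, h1⟩

/-! ### The trace of a disk in the product of the model ball and the interval -/

/-- The strands of the trivial tangle. -/
def strand (i : Bool) (v : ℝ) : E3 := flat (sgn i) (planePoint (1 / 2) v)

/-- The properties of the functions that `exists_profile` provides. -/
structure IsProfile (r : ℝ) (U : ℝ → ℝ) : Prop where
  smooth : ContDiff ℝ ∞ U
  nonneg : ∀ v, 0 ≤ U v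
  near_end : ∃ a < halfChord, ∀ v, a ≤ |v| → U v = 0
  norm_mem : ∀ v, |v| ≤ halfChord → r ≤ ‖planePoint (1 / 2 + U v) v‖ ∧
    ‖planePoint (1 / 2 + U v) v‖ ≤ 1
  norm_lt : ∀ v, |v| < halfChord → ‖planePoint (1 / 2 + U v) v‖ < 1
  above : ∀ q : E2, 1 / 2 ≤ q 0 → ‖q‖ < r → q 0 < 1 / 2 + U (q 1)

/-- The strand moves in the flat half-moon towards the arc and then, in the time window from `w` to
`w + 1 / 10`, back to the chord through the disk `e`. -/
def pushedStrand (σ : ℝ) (e : E2 → E3) (U : ℝ → ℝ) (w : ℝ) (p : ℝ × ℝ) : E3 :=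
  if p.2 < 1 / 2 then flat σ (graphPoint U (rise p.2) p.1) else e (graphPoint U (fall w p.2) p.1)

/-- The direction along the strand is visible in the second coordinate of the half-moon. The time
direction is visible either because the strand moves (`deriv θ p.2 * U p.1 ≠ 0`) or because the
height is time itself. This permits changing the height wherever the strand moves. -/
theorem injective_fderiv_of_graph {f : E2 → E3} (hf : ContDiff ℝ ∞ f) {U θ : ℝ → ℝ}
    (hU : ContDiff ℝ ∞ U) (hθ : ContDiff ℝ ∞ θ) {y : ℝ × ℝ → E3} {k : ℝ × ℝ → ℝ} {p : ℝ × ℝ}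
    (hk : ContDiff ℝ ∞ k) (hy : y =ᶠ[𝓝 p] fun p => f (graphPoint U (θ p.2) p.1))
    (hinj : Function.Injective (fderiv ℝ f (graphPoint U (θ p.2) p.1)))
    (hor : deriv θ p.2 * U p.1 ≠ 0 ∨ k =ᶠ[𝓝 p] Prod.snd) :
    Function.Injective (fderiv ℝ (fun p => (y p, k p)) p) := by
  set g : ℝ × ℝ → E2 := fun p => graphPoint U (θ p.2) p.1 with hg
  have hgs : ContDiff ℝ ∞ g := contDiff_graphPoint hU hθ
  have hgd : HasFDerivAt g (fderiv ℝ g p) p := ((hgs.differentiable (by simp)) p).hasFDerivAt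
  have hfd : HasFDerivAt f (fderiv ℝ f (g p)) (g p) :=
    ((hf.differentiable (by simp)) _).hasFDerivAt
  have hkd : HasFDerivAt k (fderiv ℝ k p) p := ((hk.differentiable (by simp)) p).hasFDerivAt
  have hyd : HasFDerivAt y ((fderiv ℝ f (g p)).comp (fderiv ℝ g p)) p :=
    (hfd.comp p hgd).congr_of_eventuallyEq hy
  rw [(hyd.prodMk hkd).fderiv, injective_iff_map_eq_zero]
  intro u hu
  have hu1 : fderiv ℝ f (g p) (fderiv ℝ g p u) = 0 := congrArg Prod.fst hu
  have hu2 : fderiv ℝ k p u = 0 := congrArg Prod.snd hu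
  have hg0 : fderiv ℝ g p u = 0 := (injective_iff_map_eq_zero _).1 hinj _ hu1
  have hv : u.1 = 0 := by
    have h1 : HasFDerivAt (fun p => (g p) 1) (ContinuousLinearMap.fst ℝ ℝ ℝ) p := hasFDerivAt_fst
    have h2 := ((EuclideanSpace.proj (𝕜 := ℝ) (1 : Fin 2)).hasFDerivAt (x := g p)).comp p hgd
    have h3 := congrArg (fun T => T u) (h1.unique h2)
    simpa [hg0] using h3
  refine Prod.ext hv ?_
  rcases hor with hor | hor
  · have hUd : HasFDerivAt (fun p : ℝ × ℝ => U p.1) _ p :=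
      (((hU.differentiable (by simp)) p.1).hasDerivAt).comp_hasFDerivAt p (hasFDerivAt_fst (𝕜 := ℝ))
    have hθd : HasFDerivAt (fun p : ℝ × ℝ => θ p.2) _ p :=
      (((hθ.differentiable (by simp)) p.2).hasDerivAt).comp_hasFDerivAt p (hasFDerivAt_snd (𝕜 := ℝ))
    have h1 : HasFDerivAt (fun p => (g p) 0) _ p := (hθd.mul hUd).const_add (1 / 2)
    have h2 := ((EuclideanSpace.proj (𝕜 := ℝ) (0 : Fin 2)).hasFDerivAt (x := g p)).comp p hgd
    have h3 := congrArg (fun T => T u) (h1.unique h2)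
    simp only [add_apply, smul_apply,
      ContinuousLinearMap.comp_apply, hg0, map_zero, ContinuousLinearMap.coe_fst',
      ContinuousLinearMap.coe_snd', hv, smul_eq_mul, mul_zero, zero_add] at h3
    have h4 : (deriv θ p.2 * U p.1) * u.2 = 0 := by linear_combination h3
    exact (mul_eq_zero.1 h4).resolve_left hor
  · rw [hor.fderiv_eq] at hu2
    have h5 : fderiv ℝ (Prod.snd : ℝ × ℝ → ℝ) p = ContinuousLinearMap.snd ℝ ℝ ℝ := fderiv_snd
    rw [h5] at hu2
    exact hu2

/-! ### The trace of a single strand: smoothness, immersion and injectivity. -/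

section PushedStrand

variable {σ r w : ℝ} {e : E2 → E3} {U : ℝ → ℝ}

theorem graphPoint_rise_mem (hU : IsProfile r U) {v t : ℝ} (hv : |v| ≤ halfChord) :
    graphPoint U (rise t) v ∈ halfMoon :=
  graphPoint_mem hU.nonneg (fun v hv => (hU.norm_mem v hv).2) (rise_nonneg t) (rise_le_one t) hv

theorem graphPoint_fall_mem (hU : IsProfile r U) {v t : ℝ} (hv : |v| ≤ halfChord) :
    graphPoint U (fall w t) v ∈ halfMoon :=
  graphPoint_mem hU.nonneg (fun v hv => (hU.norm_mem v hv).2) (fall_nonneg w t) (fall_le_one w t) hv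

theorem norm_le_of_mem_halfMoon (hσ : σ ^ 2 = 1) (he : IsTangleDisk σ e) {q : E2}
    (hq : q ∈ halfMoon) : ‖e q‖ ≤ 1 := by
  rcases hq.1.lt_or_eq with h | h
  · exact (he.interior q hq h).le
  · obtain ⟨r, hr, hflat⟩ := he.flat_near_arc
    rw [hflat q hq (by linarith), norm_flat hσ]
    exact hq.1

theorem pushedStrand_of_lt {p : ℝ × ℝ} (h : p.2 < 1 / 2) :
    pushedStrand σ e U w p = flat σ (graphPoint U (rise p.2) p.1) := if_pos h

theorem pushedStrand_of_ge {p : ℝ × ℝ} (h : 1 / 2 ≤ p.2) :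
    pushedStrand σ e U w p = e (graphPoint U (fall w p.2) p.1) := if_neg (not_lt.2 h)

/-- From time `3 / 8` to `w` the strand rests on the graph of the profile, outside radius `r`, where
the disk is flat. The switch from the flat half-moon to the disk at time `1 / 2` is therefore
invisible. -/
theorem pushedStrand_eq_disk (hU : IsProfile r U) (hw : 1 / 2 ≤ w)
    (hflat : ∀ q ∈ halfMoon, r ≤ ‖q‖ → e q = flat σ q) {p : ℝ × ℝ} (hv : |p.1| ≤ halfChord)
    (ht : 3 / 8 ≤ p.2) : pushedStrand σ e U w p = e (graphPoint U (fall w p.2) p.1) := by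
  rcases lt_or_ge p.2 (1 / 2) with h | h
  · rw [pushedStrand_of_lt h, rise_eq_one ht, fall_eq_one (by linarith), hflat]
    · exact graphPoint_mem hU.nonneg (fun v hv => (hU.norm_mem v hv).2) zero_le_one le_rfl hv
    · rw [graphPoint, one_mul]
      exact (hU.norm_mem p.1 hv).1
  · exact pushedStrand_of_ge h

theorem pushedStrand_eventuallyEq_disk (hU : IsProfile r U) (hw : 1 / 2 ≤ w)
    (hflat : ∀ q ∈ halfMoon, r ≤ ‖q‖ → e q = flat σ q) {p : ℝ × ℝ} (hv : |p.1| < halfChord)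
    (ht : 3 / 8 < p.2) :
    pushedStrand σ e U w =ᶠ[𝓝 p] fun p => e (graphPoint U (fall w p.2) p.1) := by
  have h1 : ∀ᶠ q : ℝ × ℝ in 𝓝 p, |q.1| < halfChord :=
    (continuous_fst.abs.continuousAt).eventually (gt_mem_nhds hv)
  have h2 : ∀ᶠ q : ℝ × ℝ in 𝓝 p, 3 / 8 < q.2 :=
    continuous_snd.continuousAt.eventually (lt_mem_nhds ht)
  filter_upwards [h1, h2] with q hq1 hq2
  exact pushedStrand_eq_disk hU hw hflat hq1.le hq2.le

theorem pushedStrand_eventuallyEq_flat {p : ℝ × ℝ} (ht : p.2 < 1 / 2) :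
    pushedStrand σ e U w =ᶠ[𝓝 p] fun p => flat σ (graphPoint U (rise p.2) p.1) := by
  have h2 : ∀ᶠ q : ℝ × ℝ in 𝓝 p, q.2 < 1 / 2 :=
    continuous_snd.continuousAt.eventually (gt_mem_nhds ht)
  filter_upwards [h2] with q hq
  exact pushedStrand_of_lt hq

theorem contDiffAt_pushedStrand (he : IsTangleDisk σ e) (hU : IsProfile r U) (hw : 1 / 2 ≤ w)
    (hflat : ∀ q ∈ halfMoon, r ≤ ‖q‖ → e q = flat σ q) {p : ℝ × ℝ} (hv : |p.1| < halfChord) :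
    ContDiffAt ℝ ∞ (pushedStrand σ e U w) p := by
  rcases lt_or_ge p.2 (1 / 2) with h | h
  · exact ((contDiff_flat σ).comp (contDiff_graphPoint hU.smooth contDiff_rise)).contDiffAt
      |>.congr_of_eventuallyEq (pushedStrand_eventuallyEq_flat h)
  · exact (he.smooth.comp (contDiff_graphPoint hU.smooth (contDiff_fall w))).contDiffAt
      |>.congr_of_eventuallyEq (pushedStrand_eventuallyEq_disk hU hw hflat hv (by linarith))

theorem norm_pushedStrand_le (hσ : σ ^ 2 = 1) (he : IsTangleDisk σ e) (hU : IsProfile r U)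
    {p : ℝ × ℝ} (hv : |p.1| ≤ halfChord) : ‖pushedStrand σ e U w p‖ ≤ 1 := by
  rcases lt_or_ge p.2 (1 / 2) with h | h
  · rw [pushedStrand_of_lt h, norm_flat hσ]
    exact (graphPoint_rise_mem hU hv).1
  · rw [pushedStrand_of_ge h]
    exact norm_le_of_mem_halfMoon hσ he (graphPoint_fall_mem hU hv)

theorem pushedStrand_of_profile_zero (hU : IsProfile r U)
    (hflat : ∀ q ∈ halfMoon, r ≤ ‖q‖ → e q = flat σ q) {p : ℝ × ℝ} (hv : |p.1| ≤ halfChord)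
    (h0 : U p.1 = 0) : pushedStrand σ e U w p = flat σ (planePoint (1 / 2) p.1) := by
  have h1 : ∀ c, graphPoint U c p.1 = planePoint (1 / 2) p.1 := fun c => by
    rw [graphPoint, h0, mul_zero, add_zero]
  rcases lt_or_ge p.2 (1 / 2) with h | h
  · rw [pushedStrand_of_lt h, h1]
  · have h2 := (hU.norm_mem p.1 hv).1
    have h3 := graphPoint_fall_mem (w := w) (t := p.2) hU hv
    rw [h0, add_zero] at h2
    rw [pushedStrand_of_ge h, h1] at *
    exact hflat _ h3 h2

theorem pushedStrand_bottom {p : ℝ × ℝ} (ht : p.2 ≤ 1 / 8) :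
    pushedStrand σ e U w p = flat σ (planePoint (1 / 2) p.1) := by
  rw [pushedStrand_of_lt (by linarith), rise_eq_zero ht, graphPoint, zero_mul, add_zero]

theorem pushedStrand_top {p : ℝ × ℝ} (hw : 1 / 2 ≤ w) (ht : w + 1 / 10 ≤ p.2) :
    pushedStrand σ e U w p = e (planePoint (1 / 2) p.1) := by
  rw [pushedStrand_of_ge (by linarith), fall_eq_zero ht, graphPoint, zero_mul, add_zero]

/-- A height function that agrees with the projection except on a compact set of points in the
moving part of the strand. -/
structure IsPitFunction (U : ℝ → ℝ) (w : ℝ) (k : ℝ × ℝ → ℝ) : Prop where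
  smooth : ContDiff ℝ ∞ k
  morse : ∀ p, MorseNoMaxAt k p
  support : ∃ N : Set (ℝ × ℝ), IsClosed N ∧ (∀ p ∉ N, k p = p.2) ∧
    ∀ p ∈ N, w < p.2 ∧ p.2 < w + 1 / 10 ∧ 0 < U p.1 ∧ 1 / 2 < k p ∧ k p < 9 / 10

theorem isPitFunction_snd : IsPitFunction U w Prod.snd := by
  refine ⟨contDiff_snd, ?_, ∅, isClosed_empty, fun p _ => rfl, fun p hp => hp.elim⟩
  intro p hp
  have h5 : fderiv ℝ (Prod.snd : ℝ × ℝ → ℝ) p = ContinuousLinearMap.snd ℝ ℝ ℝ := fderiv_snd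
  rw [h5] at hp
  have := congrArg (fun T => T (0, 1)) hp
  simp at this

variable {k : ℝ × ℝ → ℝ}

theorem IsPitFunction.eq_snd (hk : IsPitFunction U w k) {p : ℝ × ℝ}
    (hp : p.2 ≤ w ∨ w + 1 / 10 ≤ p.2 ∨ U p.1 = 0) : k p = p.2 := by
  obtain ⟨N, -, h1, h2⟩ := hk.support
  apply h1
  intro hN
  obtain ⟨a, b, c, -⟩ := h2 p hN
  rcases hp with h | h | h <;> linarith

theorem IsPitFunction.ge_half (hk : IsPitFunction U w k) {p : ℝ × ℝ} (hp : 1 / 2 ≤ p.2) :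
    1 / 2 ≤ k p := by
  obtain ⟨N, -, h1, h2⟩ := hk.support
  by_cases hN : p ∈ N
  · exact (h2 p hN).2.2.2.1.le
  · rwa [h1 p hN]

theorem IsPitFunction.mem_Ioo (hk : IsPitFunction U w k) {p : ℝ × ℝ} (hp : p.2 ∈ Ioo (0 : ℝ) 1) :
    k p ∈ Ioo (0 : ℝ) 1 := by
  obtain ⟨N, -, h1, h2⟩ := hk.support
  by_cases hN : p ∈ N
  · obtain ⟨-, -, -, h3, h4⟩ := h2 p hN
    constructor <;> linarith
  · rwa [h1 p hN]

theorem immersion_pushedStrand (hσ : σ ^ 2 = 1) (he : IsTangleDisk σ e) (hU : IsProfile r U)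
    (hw : 1 / 2 ≤ w) (hflat : ∀ q ∈ halfMoon, r ≤ ‖q‖ → e q = flat σ q)
    (hk : IsPitFunction U w k) {p : ℝ × ℝ} (hv : |p.1| < halfChord) :
    Function.Injective (fderiv ℝ (fun p => (pushedStrand σ e U w p, k p)) p) := by
  obtain ⟨N, hN, h1, h2⟩ := hk.support
  have hsnd : p ∉ N → k =ᶠ[𝓝 p] Prod.snd := by
    intro hp
    filter_upwards [hN.isOpen_compl.mem_nhds hp] with q hq
    exact h1 q hq
  rcases lt_or_ge p.2 (1 / 2) with h | h
  · refine injective_fderiv_of_graph (contDiff_flat σ) hU.smooth contDiff_rise hk.smooth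
      (pushedStrand_eventuallyEq_flat h) (fderiv_flat_injective hσ _) (Or.inr (hsnd ?_))
    intro hpN
    linarith [(h2 p hpN).1]
  · refine injective_fderiv_of_graph he.smooth hU.smooth (contDiff_fall w) hk.smooth
      (pushedStrand_eventuallyEq_disk hU hw hflat hv (by linarith))
      (he.immersion _ (graphPoint_fall_mem hU hv.le)) ?_
    by_cases hpN : p ∈ N
    · obtain ⟨a, b, c, -⟩ := h2 p hpN
      exact Or.inl (mul_ne_zero (deriv_fall_ne_zero a b) c.ne')
    · exact Or.inr (hsnd hpN)

/-- In the phase of return, the position on the disk determines the place along the strand and the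
height `fall` under the graph. While the strand moves, this determines the time. Where it rests, the
height function is undisturbed time. The phases before and after `1 / 2` are told apart by `k`,
since pits stay above `1 / 2`. -/
theorem injective_pushedStrand (he : IsTangleDisk σ e) (hσ : σ ^ 2 = 1) (hU : IsProfile r U)
    (hk : IsPitFunction U w k) (hw : 1 / 2 ≤ w) {p p' : ℝ × ℝ} (hv : |p.1| ≤ halfChord)
    (hv' : |p'.1| ≤ halfChord) (hy : pushedStrand σ e U w p = pushedStrand σ e U w p')
    (hkp : k p = k p') : p = p' := by
  have hlow : ∀ p : ℝ × ℝ, p.2 < 1 / 2 → k p = p.2 := fun p hp => hk.eq_snd (Or.inl (by linarith))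
  have hcomm : ∀ {c c' v v' : ℝ}, graphPoint U c v = graphPoint U c' v' → v = v' ∧
      c * U v = c' * U v := by
    intro c c' v v' h
    obtain ⟨h1, rfl⟩ := planePoint_inj h
    exact ⟨rfl, by linarith⟩
  rcases lt_or_ge p.2 (1 / 2) with h | h <;> rcases lt_or_ge p'.2 (1 / 2) with h' | h'
  · rw [pushedStrand_of_lt h, pushedStrand_of_lt h'] at hy
    rw [hlow p h, hlow p' h'] at hkp
    exact Prod.ext (hcomm (flat_injective hσ hy)).1 hkp
  · have := hk.ge_half h'
    rw [hlow p h] at hkp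
    linarith
  · have := hk.ge_half h
    rw [hlow p' h'] at hkp
    linarith
  · rw [pushedStrand_of_ge h, pushedStrand_of_ge h'] at hy
    obtain ⟨hvv, hc⟩ := hcomm (he.injective (graphPoint_fall_mem hU hv)
      (graphPoint_fall_mem hU hv') hy)
    refine Prod.ext hvv ?_
    by_cases hU0 : U p.1 = 0
    · rw [hk.eq_snd (Or.inr (Or.inr hU0)), hk.eq_snd (Or.inr (Or.inr (hvv ▸ hU0)))] at hkp
      exact hkp
    · have hf := mul_right_cancel₀ hU0 hc
      by_cases h0 : 0 < fall w p.2
      · by_cases h1 : fall w p.2 < 1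
        · exact eq_of_fall_eq hf h0 h1
        · have hs : ∀ q : ℝ × ℝ, ¬ fall w q.2 < 1 → k q = q.2 := by
            intro q hq
            obtain ⟨N, -, h3, h4⟩ := hk.support
            apply h3
            intro hN
            apply hq
            obtain ⟨a, b, -⟩ := h4 q hN
            rw [fall, sub_lt_self_iff]
            exact Real.smoothTransition.pos_of_pos (by linarith)
          rw [hs p h1, hs p' (hf ▸ h1)] at hkp
          exact hkp
      · have hs : ∀ q : ℝ × ℝ, ¬ 0 < fall w q.2 → k q = q.2 := by
          intro q hq
          obtain ⟨N, -, h3, h4⟩ := hk.support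
          apply h3
          intro hN
          apply hq
          obtain ⟨a, b, -⟩ := h4 q hN
          rw [fall, sub_pos]
          exact Real.smoothTransition.lt_one_of_lt_one (by linarith)
        rw [hs p h0, hs p' (hf ▸ h0)] at hkp
        exact hkp

end PushedStrand

/-- Two disks in the product of the model ball and the interval that connect the trivial tangle to
the tangle `R`. -/
structure IsBallCobordism (R : Set E3) (y : Bool → ℝ × ℝ → E3) (k : Bool → ℝ × ℝ → ℝ) : Prop where
  smooth_fst : ∀ i p, |p.1| < halfChord → ContDiffAt ℝ ∞ (y i) p
  smooth_snd : ∀ i, ContDiff ℝ ∞ (k i)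
  near_end : ∃ a < halfChord, ∀ i v t, a ≤ |v| → |v| ≤ halfChord →
    y i (v, t) = strand i v ∧ k i (v, t) = t
  bottom : ∀ i v t, t ≤ 1 / 10 → y i (v, t) = strand i v ∧ k i (v, t) = t
  top : ∀ i v t, 9 / 10 ≤ t → y i (v, t) = y i (v, 1) ∧ k i (v, t) = t
  norm_le : ∀ i v t, |v| ≤ halfChord → ‖y i (v, t)‖ ≤ 1
  range_top : ∀ p, p ∈ R ↔ ∃ i v, |v| ≤ halfChord ∧ y i (v, 1) = p
  mem_Ioo : ∀ i v, ∀ t ∈ Ioo (0 : ℝ) 1, k i (v, t) ∈ Ioo (0 : ℝ) 1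
  injective : ∀ i j p p', |p.1| ≤ halfChord → |p'.1| ≤ halfChord → y i p = y j p' → k i p = k j p' →
    i = j ∧ p = p'
  immersion : ∀ i p, |p.1| < halfChord → Function.Injective (fderiv ℝ (fun p => (y i p, k i p)) p)
  morse : ∀ i p, MorseNoMaxAt (k i) p

/-! ### The disks of a ribbon band do not interfere when pushed one after the other -/

/-- A properly embedded arc in the half-moon. -/
structure IsHalfMoonArc (c : ℝ → E2) : Prop where
  smooth : ContDiff ℝ ∞ c
  injective : InjOn c (Icc 0 1)
  regular : ∀ t ∈ Icc (0 : ℝ) 1, deriv c t ≠ 0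
  mem : ∀ t ∈ Icc (0 : ℝ) 1, c t ∈ halfMoon

theorem chord_subset : chord ⊆ halfMoon := fun _ hq => ⟨hq.1, hq.2.ge⟩

theorem halfMoonInterior_subset : halfMoonInterior ⊆ halfMoon := fun _ hq => ⟨hq.1.le, hq.2.le⟩

theorem IsRibbonSingularity.exists_arc {e e' : E2 → E3} {A : Set E3}
    (h : IsRibbonSingularity e e' A) :
    ∃ c, IsHalfMoonArc c ∧ (fun t => e (c t)) '' Icc 0 1 = A := by
  obtain ⟨⟨c, h1, h2, h3, h4, h5, h6, h7⟩, -⟩ := h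
  refine ⟨c, ⟨h1, h2, h3, ?_⟩, h7⟩
  rintro t ⟨ht0, ht1⟩
  rcases ht0.eq_or_lt with rfl | ht0
  · exact chord_subset h4
  rcases ht1.eq_or_lt with rfl | ht1
  · exact chord_subset h5
  exact halfMoonInterior_subset (h6 t ⟨ht0, ht1⟩)

theorem IsRibbonSingularity.isCompact {e e' : E2 → E3} {A : Set E3} (he : ContDiff ℝ ∞ e)
    (h : IsRibbonSingularity e e' A) : IsCompact A := by
  obtain ⟨c, hc, rfl⟩ := h.exists_arc
  exact isCompact_Icc.image (he.continuous.comp hc.smooth.continuous)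

/-- The two disks of a ribbon band, ordered such that at most one of the two double arcs lies in
the interior of the disk `e b`. -/
structure IsOrderedBand (R : Set E3) (e : Bool → E2 → E3) (b : Bool) (A B : Set E3) : Prop where
  disk : ∀ i, IsTangleDisk (sgn i) (e i)
  isCompact_fst : IsCompact A
  isCompact_snd : IsCompact B
  disjoint : Disjoint A B
  mem : ∀ q ∈ halfMoon, ∀ q' ∈ halfMoon, e b q = e (!b) q' → e b q ∈ A ∪ B
  subset : A ⊆ e (!b) '' halfMoonInterior
  arc : B = ∅ ∨ B ⊆ e b '' halfMoonInterior ∧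
    ∃ c, IsHalfMoonArc c ∧ (fun t => e (!b) (c t)) '' Icc 0 1 = B
  mem_iff : ∀ p, p ∈ R ↔ ∃ i v, |v| ≤ halfChord ∧ e i (planePoint (1 / 2) v) = p

/-- Two double arcs inside the same disk are merged into `A`, that disk belongs to the strand `!b`,
and `B` is empty. If each disk contains one arc in its interior, both orders would serve. -/
theorem IsRibbonBand.exists_isOrderedBand {R : Set E3} (h : IsRibbonBand R) :
    ∃ e b A B, IsOrderedBand R e b A B := by
  obtain ⟨e₁, e₂, h₁, h₂, ⟨A, B, hAB, hD, hA, hB⟩, rfl⟩ := h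
  set e : Bool → E2 → E3 := fun i => if i then e₂ else e₁ with he
  have hdisk : ∀ i, IsTangleDisk (sgn i) (e i) := by
    intro i
    cases i
    · simpa [he, sgn] using h₁
    · simpa [he, sgn] using h₂
  have hR : ∀ p, p ∈ e₁ '' chord ∪ e₂ '' chord ↔
      ∃ i v, |v| ≤ halfChord ∧ e i (planePoint (1 / 2) v) = p := by
    intro p
    constructor
    · rintro (⟨q, hq, rfl⟩ | ⟨q, hq, rfl⟩) <;> obtain ⟨v, hv, rfl⟩ := mem_chord.1 hq
      · exact ⟨false, v, hv, rfl⟩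
      · exact ⟨true, v, hv, rfl⟩
    · rintro ⟨i, v, hv, rfl⟩
      have hq := mem_chord.2 ⟨v, hv, rfl⟩
      cases i
      · exact Or.inl ⟨_, hq, rfl⟩
      · exact Or.inr ⟨_, hq, rfl⟩
  have hmem : ∀ b, ∀ q ∈ halfMoon, ∀ q' ∈ halfMoon, e b q = e (!b) q' → e b q ∈ A ∪ B := by
    intro b q hq q' hq' hqq
    rw [← hD]
    cases b
    · exact ⟨⟨q, hq, rfl⟩, ⟨q', hq', hqq.symm⟩⟩
    · exact ⟨⟨q', hq', hqq.symm⟩, ⟨q, hq, rfl⟩⟩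
  have hcA : IsCompact A := hA.elim (·.isCompact h₁.smooth) (·.isCompact h₂.smooth)
  have hcB : IsCompact B := hB.elim (·.isCompact h₁.smooth) (·.isCompact h₂.smooth)
  rcases hA with hA | hA <;> rcases hB with hB | hB
  · refine ⟨e, false, A ∪ B, ∅, hdisk, hcA.union hcB, isCompact_empty, disjoint_bot_right, ?_,
      union_subset hA.2.1 hB.2.1, Or.inl rfl, hR⟩
    intro q hq q' hq' hqq
    rw [union_empty]
    exact hmem _ q hq q' hq' hqq
  · exact ⟨e, false, A, B, hdisk, hcA, hcB, hAB, hmem _, hA.2.1, Or.inr ⟨hB.2.1, hB.exists_arc⟩, hR⟩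
  · refine ⟨e, false, B, A, hdisk, hcB, hcA, hAB.symm, ?_, hB.2.1,
      Or.inr ⟨hA.2.1, hA.exists_arc⟩, hR⟩
    intro q hq q' hq' hqq
    rw [union_comm]
    exact hmem _ q hq q' hq' hqq
  · refine ⟨e, true, A ∪ B, ∅, hdisk, hcA.union hcB, isCompact_empty, disjoint_bot_right, ?_,
      union_subset hA.2.1 hB.2.1, Or.inl rfl, hR⟩
    intro q hq q' hq' hqq
    rw [union_empty]
    exact hmem _ q hq q' hq' hqq

/-- Double points of the two disks keep away from the arcs. -/
theorem exists_radius {e : Bool → E2 → E3} (he : ∀ i, IsTangleDisk (sgn i) (e i)) :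
    ∃ r, 1 / 2 < r ∧ r < 1 ∧ (∀ i, ∀ q ∈ halfMoon, r ≤ ‖q‖ → e i q = flat (sgn i) q) ∧
      ∀ i, ∀ q ∈ halfMoon, ∀ q' ∈ halfMoon, e i q = e (!i) q' → ‖q‖ < r := by
  obtain ⟨r₁, hr₁, hf₁⟩ := (he false).flat_near_arc
  obtain ⟨r₂, hr₂, hf₂⟩ := (he true).flat_near_arc
  set D : Set (E2 × E2) := (halfMoon ×ˢ halfMoon) ∩ {p | e false p.1 = e true p.2} with hD
  have hDc : IsCompact D := by
    apply (isCompact_halfMoon.prod isCompact_halfMoon).inter_right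
    exact isClosed_eq ((he false).smooth.continuous.comp continuous_fst)
      ((he true).smooth.continuous.comp continuous_snd)
  have hbd : ∀ i, ∀ q ∈ halfMoon, ‖q‖ = 1 → e i q = flat (sgn i) q := by
    intro i q hq h
    obtain ⟨r, hr, hf⟩ := (he i).flat_near_arc
    exact hf q hq (by linarith)
  -- A double point on one arc lies on the unit sphere, hence on the arc of the other disk as well,
  -- and the two arcs are disjoint.
  have hlt : ∀ i, ∀ q ∈ halfMoon, ∀ q' ∈ halfMoon, e i q = e (!i) q' → ‖q‖ < 1 := by
    intro i q hq q' hq' h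
    by_contra hge
    have h1 : ‖q‖ = 1 := le_antisymm hq.1 (not_lt.1 hge)
    have h2 := hbd i q hq h1
    have h3 : ‖q'‖ = 1 := by
      by_contra hne
      have h4 := (he !i).interior q' hq' (lt_of_le_of_ne hq'.1 hne)
      rw [← h, h2, norm_flat (sgn_sq i), h1] at h4
      exact lt_irrefl _ h4
    rw [h2, hbd _ q' hq' h3] at h
    exact flat_ne_flat_not hq hq' h
  -- Compactness of the set of double pairs gives a uniform distance from the arcs.
  obtain ⟨c, hc, hcD⟩ := hDc.exists_forall_le' (f := fun p : E2 × E2 => 1 - max ‖p.1‖ ‖p.2‖)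
    (a := 0) (by fun_prop) (by
      rintro ⟨q, q'⟩ ⟨⟨hq, hq'⟩, h⟩
      have h1 := hlt false q hq q' hq' h
      have h2 := hlt true q' hq' q hq h.symm
      simp only [sub_pos, max_lt_iff]
      exact ⟨h1, h2⟩)
  refine ⟨max (max r₁ r₂) (max (1 - c / 2) (3 / 4)), ?_, ?_, ?_, ?_⟩
  · exact lt_max_of_lt_right (lt_max_of_lt_right (by norm_num))
  · simp only [max_lt_iff]
    refine ⟨⟨hr₁, hr₂⟩, by linarith, by norm_num⟩
  · intro i q hq h
    simp only [max_le_iff] at h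
    cases i
    · simpa [sgn] using hf₁ q hq h.1.1
    · simpa [sgn] using hf₂ q hq h.1.2
  · intro i q hq q' hq' h
    apply lt_max_of_lt_right
    apply lt_max_of_lt_left
    cases i
    · have h1 := hcD (q, q') ⟨⟨hq, hq'⟩, h⟩
      have h2 : ‖q‖ ≤ 1 - c := by
        simp only at h1
        linarith [le_max_left ‖q‖ ‖q'‖]
      linarith
    · have h1 := hcD (q', q) ⟨⟨hq', hq⟩, h.symm⟩
      have h2 : ‖q‖ ≤ 1 - c := by
        simp only at h1
        linarith [le_max_right ‖q'‖ ‖q‖]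
      linarith

/-! ### What the position of a moving strand says about the time. -/

section Moving

variable {r w : ℝ} {e : E2 → E3} {U : ℝ → ℝ}

/-- Points of norm less than `r` lie strictly below the graph. A strand at such a point has thus
left its resting position near the arc. -/
theorem graphPoint_norm_lt (hU : IsProfile r U) {θ v : ℝ} (hmem : graphPoint U θ v ∈ halfMoon)
    (hr : ‖graphPoint U θ v‖ < r) : 0 < U v ∧ θ < 1 := by
  have h1 := hU.above _ hmem.2 hr
  have h2 := hmem.2
  simp only [graphPoint, planePoint_zero, planePoint_one] at h1 h2
  have h3 := hU.nonneg v
  have h4 : 0 < U v := by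
    rcases h3.eq_or_lt with h | h
    · rw [← h] at h1
      simp at h1
    · exact h
  refine ⟨h4, ?_⟩
  by_contra hle
  nlinarith [not_lt.1 hle]

theorem graphPoint_pos (hU : IsProfile r U) {θ v : ℝ}
    (hmem : graphPoint U θ v ∈ halfMoonInterior) : 0 < θ := by
  have h2 := hmem.2
  simp only [graphPoint, planePoint_zero] at h2
  have h3 := hU.nonneg v
  by_contra hle
  nlinarith [not_lt.1 hle, mul_nonneg (neg_nonneg.2 (not_lt.1 hle)) h3]

theorem exists_graphPoint_eq (hU : IsProfile r U) {q : E2} (hq : q ∈ halfMoon) (hr : ‖q‖ < r) :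
    ∃ t ∈ Icc w (w + 1 / 10), graphPoint U (fall w t) (q 1) = q := by
  have h1 := hU.above q hq.2 hr
  have h2 := hq.2
  have hU0 : 0 < U (q 1) := by linarith
  obtain ⟨t, ht, htw⟩ := exists_fall_eq w (c := (q 0 - 1 / 2) / U (q 1))
    (div_nonneg (by linarith) hU0.le) ((div_le_one hU0).2 (by linarith))
  refine ⟨t, ht, ?_⟩
  rw [graphPoint, htw, div_mul_cancel₀ _ hU0.ne']
  rw [show 1 / 2 + (q 0 - 1 / 2) = q 0 by ring, planePoint_self]

theorem continuous_disk_graph (he : ContDiff ℝ ∞ e) (hU : IsProfile r U) :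
    ContDiff ℝ ∞ fun p : ℝ × ℝ => e (graphPoint U (fall w p.2) p.1) :=
  he.comp (contDiff_graphPoint hU.smooth (contDiff_fall w))

end Moving

/-- The pit function for the disk that is pushed later. -/
theorem IsOrderedBand.exists_pit {R : Set E3} {e : Bool → E2 → E3} {b : Bool} {A B : Set E3}
    (h : IsOrderedBand R e b A B) {r : ℝ} {U : ℝ → ℝ} (hU : IsProfile r U)
    (hr : ∀ i, ∀ q ∈ halfMoon, ∀ q' ∈ halfMoon, e i q = e (!i) q' → ‖q‖ < r) :
    ∃ k, IsPitFunction U (4 / 5) k ∧ ∀ p p' : ℝ × ℝ, |p.1| ≤ halfChord → |p'.1| ≤ halfChord →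
      e b (graphPoint U (fall (4 / 5) p.2) p.1) = e (!b) (graphPoint U (fall (3 / 5) p'.2) p'.1) →
      k p ≠ p'.2 := by
  set L : ℝ × ℝ → E3 := fun p => e b (graphPoint U (fall (4 / 5) p.2) p.1) with hL
  set M : ℝ × ℝ → E3 := fun p => e (!b) (graphPoint U (fall (3 / 5) p.2) p.1) with hM
  have hLs : ContDiff ℝ ∞ L := continuous_disk_graph (h.disk b).smooth hU
  have hMs : ContDiff ℝ ∞ M := continuous_disk_graph (h.disk !b).smooth hU
  have hgm : ∀ w t v, |v| ≤ halfChord → graphPoint U (fall w t) v ∈ halfMoon :=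
    fun w t v hv => graphPoint_fall_mem hU hv
  -- double points in the disk that is pushed later
  have hdL : ∀ p p' : ℝ × ℝ, |p.1| ≤ halfChord → |p'.1| ≤ halfChord → L p = M p' →
      0 < U p.1 ∧ 4 / 5 < p.2 ∧ 0 < U p'.1 ∧ 3 / 5 < p'.2 := by
    intro p p' hp hp' hpp
    have h1 := hr b _ (hgm (4 / 5) p.2 p.1 hp) _ (hgm (3 / 5) p'.2 p'.1 hp') hpp
    have h2 := hr (!b) _ (hgm (3 / 5) p'.2 p'.1 hp') _ (hgm (4 / 5) p.2 p.1 hp) (by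
      rw [Bool.not_not]
      exact hpp.symm)
    obtain ⟨h3, h4⟩ := graphPoint_norm_lt hU (hgm _ _ _ hp) h1
    obtain ⟨h5, h6⟩ := graphPoint_norm_lt hU (hgm _ _ _ hp') h2
    exact ⟨h3, lt_of_fall_lt_one h4, h5, lt_of_fall_lt_one h6⟩
  -- interior double arcs of the disk that is pushed earlier
  have hA : ∀ p p' : ℝ × ℝ, |p.1| ≤ halfChord → |p'.1| ≤ halfChord → L p = M p' → L p ∈ A →
      p'.2 < 7 / 10 := by
    intro p p' hp hp' hpp hpA
    obtain ⟨q, hq, hqA⟩ := h.subset hpA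
    have h1 : q = graphPoint U (fall (3 / 5) p'.2) p'.1 :=
      (h.disk !b).injective (halfMoonInterior_subset hq) (hgm _ _ _ hp') (hqA.trans hpp)
    rw [h1] at hq
    -- Being in the interior of the half-moon, the strand `!b` has not completed its return, so its
    -- window ending at `3 / 5 + 1 / 10` is still open.
    have h2 := lt_of_fall_pos (graphPoint_pos hU hq)
    linarith
  rcases h.arc with hB | ⟨hBi, c, hc, hcB⟩
  · refine ⟨Prod.snd, isPitFunction_snd, ?_⟩
    intro p p' hp hp' hpp heq
    have h1 := h.mem _ (hgm _ _ _ hp) _ (hgm _ _ _ hp') hpp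
    rw [hB, union_empty] at h1
    -- The strand `!b` meets `A` only before `7 / 10`, the strand `b` only after `4 / 5`; no pit is
    -- needed.
    have h2 := hA p p' hp hp' hpp h1
    have h3 := (hdL p p' hp hp' hpp).2.1
    linarith
  -- The ends of `B` lie on the final strand `!b` and remain occupied, while the strand `b` must
  -- sweep over `B`. So `B` is pulled back to an arc in the parameter plane of `b`, along which the
  -- height is lowered.
  · set S : Set (ℝ × ℝ) := Icc (-halfChord) halfChord ×ˢ Icc (1 / 2) 1 with hS
    have hSc : IsCompact S := isCompact_Icc.prod isCompact_Icc
    have hSv : ∀ p ∈ S, |p.1| ≤ halfChord := fun p hp => abs_le.2 hp.1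
    set AL : Set (ℝ × ℝ) := S ∩ L ⁻¹' A with hAL
    set BL : Set (ℝ × ℝ) := S ∩ L ⁻¹' B with hBL
    set BM : Set (ℝ × ℝ) := S ∩ M ⁻¹' B with hBM
    have hALc : IsCompact AL :=
      hSc.inter_right (h.isCompact_fst.isClosed.preimage hLs.continuous)
    have hBLc : IsCompact BL :=
      hSc.inter_right (h.isCompact_snd.isClosed.preimage hLs.continuous)
    have hBMc : IsCompact BM :=
      hSc.inter_right (h.isCompact_snd.isClosed.preimage hMs.continuous)
    -- points on the arc in terms of both disks
    have hBint : ∀ p : ℝ × ℝ, |p.1| ≤ halfChord → L p ∈ B →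
        4 / 5 < p.2 ∧ p.2 < 9 / 10 ∧ 0 < U p.1 := by
      intro p hp hpB
      obtain ⟨q, hq, hqB⟩ := hBi hpB
      have h1 : q = graphPoint U (fall (4 / 5) p.2) p.1 :=
        (h.disk b).injective (halfMoonInterior_subset hq) (hgm _ _ _ hp) hqB
      have h2 := hpB
      rw [← hcB] at h2
      obtain ⟨t, ht, htB⟩ := h2
      have h3 := hr b _ (hgm _ _ _ hp) _ (hc.mem t ht) htB.symm
      obtain ⟨h4, h5⟩ := graphPoint_norm_lt hU (hgm _ _ _ hp) h3
      rw [h1] at hq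
      have h6 := lt_of_fall_pos (graphPoint_pos hU hq)
      exact ⟨lt_of_fall_lt_one h5, by linarith, h4⟩
    have hBM' : ∀ p ∈ BM, 3 / 5 < p.2 := by
      intro p hp
      obtain ⟨q, hq, hqB⟩ := hBi hp.2
      have h3 := hr (!b) _ (hgm (3 / 5) p.2 p.1 (hSv p hp.1)) _ (halfMoonInterior_subset hq) (by
        rw [Bool.not_not]
        exact hqB.symm)
      exact lt_of_fall_lt_one (graphPoint_norm_lt hU (hgm _ _ _ (hSv p hp.1)) h3).2
    -- The earliest time at which `!b` meets `B` is strictly later than `3 / 5`, by compactness of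
    -- `BM`. It serves as the upper bound for the heights on the arc in the pit.
    obtain ⟨l₀, hl₀, hl₀'⟩ := hBMc.exists_forall_le' continuous_snd.continuousOn hBM'
    set l := min l₀ (7 / 10) with hl
    have hl1 : 3 / 5 < l := lt_min hl₀ (by norm_num)
    have hl2 : l ≤ 7 / 10 := min_le_right _ _
    -- the arc in the coordinates of the later disk
    have hLinj : InjOn L BL := by
      intro p hp p' hp' hpp
      obtain ⟨h1, h2⟩ := planePoint_inj ((h.disk b).injective (hgm _ _ _ (hSv p hp.1))
        (hgm _ _ _ (hSv p' hp'.1)) hpp)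
      obtain ⟨a1, a2, a3⟩ := hBint p (hSv p hp.1) hp.2
      refine Prod.ext h2 (eq_of_fall_eq (w := 4 / 5) ?_ ?_ ?_)
      · rw [← h2] at h1
        exact mul_right_cancel₀ a3.ne' (by linarith)
      · rw [fall, sub_pos]
        exact Real.smoothTransition.lt_one_of_lt_one (by linarith)
      · rw [fall, sub_lt_self_iff]
        exact Real.smoothTransition.pos_of_pos (by linarith)
    have hLimm : ∀ p ∈ BL, Function.Injective (fderiv ℝ L p) := by
      intro p hp
      obtain ⟨a1, a2, a3⟩ := hBint p (hSv p hp.1) hp.2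
      have h1 := injective_fderiv_of_graph (h.disk b).smooth hU.smooth (contDiff_fall (4 / 5))
        (y := L) (k := fun _ => 0) (p := p) contDiff_const (Eventually.of_forall fun _ => rfl)
        ((h.disk b).immersion _ (hgm _ _ _ (hSv p hp.1)))
        (Or.inl (mul_ne_zero (deriv_fall_ne_zero a1 (by linarith)) a3.ne'))
      have h2 : HasFDerivAt (fun p => (L p, (0 : ℝ))) _ p :=
        ((hLs.differentiable (by simp)) p).hasFDerivAt.prodMk (hasFDerivAt_const (0 : ℝ) p)
      rw [h2.fderiv] at h1
      intro x y hxy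
      apply h1
      simp [hxy]
    obtain ⟨g, hg, hgL⟩ := exists_smooth_leftInverse hLs hBLc hLinj hLimm
    set c' : ℝ → ℝ × ℝ := fun t => g (e (!b) (c t)) with hc'
    have hc's : ContDiff ℝ ∞ c' := hg.comp ((h.disk !b).smooth.comp hc.smooth)
    have hBsurj : ∀ x ∈ B, ∃ p ∈ BL, L p = x := by
      intro x hx
      obtain ⟨q, hq, hqB⟩ := hBi hx
      have h2 := hx
      rw [← hcB] at h2
      obtain ⟨t, ht, htB⟩ := h2
      have hqH := halfMoonInterior_subset hq
      have h3 := hr b _ hqH _ (hc.mem t ht) (hqB.trans htB.symm)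
      obtain ⟨s, hs, hsq⟩ := exists_graphPoint_eq (w := 4 / 5) hU hqH h3
      have h4 : L (q 1, s) = x := by
        simp only [hL, hsq, hqB]
      exact ⟨(q 1, s), ⟨⟨abs_le.1 (abs_le_of_mem_halfMoon hqH), by linarith [hs.1],
        by linarith [hs.2]⟩, by rw [mem_preimage, h4]; exact hx⟩, h4⟩
    have hc'mem : ∀ t ∈ Icc (0 : ℝ) 1, c' t ∈ BL ∧ L (c' t) = e (!b) (c t) := by
      intro t ht
      have hx : e (!b) (c t) ∈ B := by
        rw [← hcB]
        exact ⟨t, ht, rfl⟩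
      obtain ⟨p, hp, hpx⟩ := hBsurj _ hx
      have h1 : c' t = p := by
        simp only [hc', ← hpx, hgL p hp]
      rw [h1]
      exact ⟨hp, hpx⟩
    have hc'inj : InjOn c' (Icc 0 1) := by
      intro t ht t' ht' htt
      have h1 := (hc'mem t ht).2
      rw [htt, (hc'mem t' ht').2] at h1
      exact (hc.injective ht' ht
        ((h.disk !b).injective (hc.mem t' ht') (hc.mem t ht) h1)).symm
    have hc'reg : ∀ t ∈ Icc (0 : ℝ) 1, deriv c' t ≠ 0 := by
      intro t ht h0
      -- The relation `L ∘ c' = e (!b) ∘ c` is known on `[0,1]` only, hence derivatives are compared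
      -- within this interval.
      have hu := uniqueDiffOn_Icc (zero_lt_one (α := ℝ)) t ht
      have h1 : HasDerivAt c' (deriv c' t) t := ((hc's.differentiable (by simp)) t).hasDerivAt
      have h2 := (((hLs.differentiable (by simp)) (c' t)).hasFDerivAt.comp_hasDerivAt t h1)
      have h3 : HasDerivAt c (deriv c t) t := ((hc.smooth.differentiable (by simp)) t).hasDerivAt
      have h4 := ((((h.disk !b).smooth.differentiable (by simp)) (c t)).hasFDerivAt.comp_hasDerivAt
        t h3)
      have h5 : HasDerivWithinAt (L ∘ c') (fderiv ℝ (e !b) (c t) (deriv c t)) (Icc 0 1) t :=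
        h4.hasDerivWithinAt.congr (fun s hs => (hc'mem s hs).2) (hc'mem t ht).2
      have h6 := hu.eq_deriv _ h2.hasDerivWithinAt h5
      rw [h0, map_zero] at h6
      exact hc.regular t ht ((injective_iff_map_eq_zero _).1
        ((h.disk !b).immersion _ (hc.mem t ht)) _ h6.symm)
    -- dig the pit
    set O : Set (ℝ × ℝ) := {p | 0 < U p.1 ∧ 4 / 5 < p.2 ∧ p.2 < 9 / 10} \ AL with hO
    have hOo : IsOpen O := by
      apply IsOpen.sdiff _ hALc.isClosed
      exact (isOpen_lt continuous_const (hU.smooth.continuous.comp continuous_fst)).inter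
        ((isOpen_lt continuous_const continuous_snd).inter
          (isOpen_lt continuous_snd continuous_const))
    have hcO : ∀ t ∈ Icc (0 : ℝ) 1, c' t ∈ O := by
      intro t ht
      have h1 := (hc'mem t ht).1
      obtain ⟨a1, a2, a3⟩ := hBint _ (hSv _ h1.1) h1.2
      exact ⟨⟨a3, a1, a2⟩, fun h2 => h.disjoint.le_bot ⟨h2.2, h1.2⟩⟩
    -- The bound `m = 1 / 2` keeps the pit above the phase in which the strands cross the flat
    -- half-moons.
    obtain ⟨k, N, hks, hNc, hNO, hkN, hkc, hkl, hkm⟩ := KnotConcordance.exists_pit hc's hc'inj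
      hc'reg hOo hcO (l := l) (m := 1 / 2) (by linarith) (fun p hp => by linarith [hp.1.2.1])
    refine ⟨k, ⟨hks, hkm, N, hNc.isClosed, hkN, ?_⟩, ?_⟩
    · intro p hp
      obtain ⟨⟨a1, a2, a3⟩, -⟩ := hNO hp
      obtain ⟨b1, q, hq, b2⟩ := hkl p hp
      have b3 := (hNO hq).1.2.2
      exact ⟨a2, by linarith, a1, b1, by linarith⟩
    · intro p p' hp hp' hpp heq
      obtain ⟨d1, d2, d3, d4⟩ := hdL p p' hp hp' hpp
      rcases h.mem _ (hgm _ _ _ hp) _ (hgm _ _ _ hp') hpp with hpA | hpB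
      · have h1 := hA p p' hp hp' hpp hpA
        -- The preimage of `A` was removed from `O`, so the height at `p` is still time, later than
        -- `4 / 5`.
        have h2 : p ∉ N := by
          intro hpN
          have h3 := hNO hpN
          exact h3.2 ⟨⟨abs_le.1 hp, by linarith, by linarith [h3.1.2.2]⟩, hpA⟩
        rw [hkN p h2] at heq
        linarith
      · obtain ⟨a1, a2, a3⟩ := hBint p hp hpB
        have hpBL : p ∈ BL := ⟨⟨abs_le.1 hp, by linarith, by linarith⟩, hpB⟩
        have hpB' := hpB
        rw [← hcB] at hpB'
        obtain ⟨t, ht, htp⟩ := hpB'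
        have h1 : c' t = p := by
          have h2 : e (!b) (c t) = L p := htp
          simp only [hc', h2, hgL p hpBL]
        have h2 := hkc t ht
        rw [h1, heq] at h2
        -- Now `p'.2 < l`. Up to time 1 this contradicts the choice of `l₀`; beyond 1 it contradicts
        -- `l ≤ 7 / 10`.
        rcases le_or_gt p'.2 1 with h3 | h3
        · have h4 : p' ∈ BM := ⟨⟨abs_le.1 hp', by linarith, h3⟩, by
            change L p = M p' at hpp
            rw [mem_preimage, ← hpp]
            exact hpB⟩
          have h5 := hl₀' p' h4
          linarith [min_le_left l₀ (7 / 10)]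
        · linarith

theorem eq_not_of_ne : ∀ i j : Bool, i ≠ j → j = !i := by decide

/-- Strand `!b` returns between `3 / 5` and `7 / 10`, strand `b` between `4 / 5` and `9 / 10` and
with the pit. Before `1 / 2` the strands run in disjoint flat half-moons, afterwards the pit
function separates them, and the heights of the two phases differ. -/
theorem IsRibbonBand.exists_isBallCobordism {R : Set E3} (h : IsRibbonBand R) :
    ∃ y k, IsBallCobordism R y k := by
  obtain ⟨e, b, A, B, hband⟩ := h.exists_isOrderedBand
  obtain ⟨r, hr2, hr1, hflat, hrad⟩ := exists_radius hband.disk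
  obtain ⟨U, hU1, hU2, hU3, hU4, hU5, hU6⟩ := exists_profile hr2 hr1
  have hU : IsProfile r U := ⟨hU1, hU2, hU3, hU4, hU5, hU6⟩
  obtain ⟨k₀, hk₀, hsep⟩ := hband.exists_pit hU hrad
  set W : Bool → ℝ := fun i => if i = b then 4 / 5 else 3 / 5 with hW
  set k : Bool → ℝ × ℝ → ℝ := fun i => if i = b then k₀ else Prod.snd with hk
  have hWb : W b = 4 / 5 := if_pos rfl
  have hkb : k b = k₀ := if_pos rfl
  have hWn : W (!b) = 3 / 5 := if_neg (by simp)
  have hkn : k (!b) = Prod.snd := if_neg (by simp)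
  have hW1 : ∀ i, 1 / 2 ≤ W i := by
    intro i
    simp only [hW]
    split_ifs <;> norm_num
  have hW2 : ∀ i, W i + 1 / 10 ≤ 9 / 10 := by
    intro i
    simp only [hW]
    split_ifs <;> norm_num
  have hkp : ∀ i, IsPitFunction U (W i) (k i) := by
    intro i
    simp only [hW, hk]
    split_ifs
    · exact hk₀
    · exact isPitFunction_snd
  have hboth : ∀ p p' : ℝ × ℝ, |p.1| ≤ halfChord → |p'.1| ≤ halfChord →
      pushedStrand (sgn b) (e b) U (W b) p = pushedStrand (sgn !b) (e !b) U (W !b) p' →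
      k b p ≠ k (!b) p' := by
    intro p p' hp hp' hpp hkk
    have hlow : ∀ i, ∀ p : ℝ × ℝ, p.2 < 1 / 2 → k i p = p.2 :=
      fun i p hp => (hkp i).eq_snd (Or.inl (by linarith [hW1 i]))
    rcases lt_or_ge p.2 (1 / 2) with h | h <;> rcases lt_or_ge p'.2 (1 / 2) with h' | h'
    · rw [pushedStrand_of_lt h, pushedStrand_of_lt h'] at hpp
      exact flat_ne_flat_not (graphPoint_rise_mem hU hp) (graphPoint_rise_mem hU hp') hpp
    · have := (hkp !b).ge_half h'
      rw [hlow b p h] at hkk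
      linarith
    · have := (hkp b).ge_half h
      rw [hlow _ p' h'] at hkk
      linarith
    · rw [pushedStrand_of_ge h, pushedStrand_of_ge h', hWb, hWn] at hpp
      rw [hkb, hkn] at hkk
      exact hsep p p' hp hp' hpp hkk
  refine ⟨fun i => pushedStrand (sgn i) (e i) U (W i), k, ?_, ?_, ?_, ?_, ?_, ?_, ?_, ?_, ?_, ?_, ?_⟩
  · exact fun i p hp => contDiffAt_pushedStrand (hband.disk i) hU (hW1 i) (hflat i) hp
  · exact fun i => (hkp i).smooth
  · obtain ⟨a, ha, ha0⟩ := hU3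
    refine ⟨a, ha, fun i v t hv hv' => ⟨?_, ?_⟩⟩
    · exact pushedStrand_of_profile_zero hU (hflat i) (p := (v, t)) hv' (ha0 v hv)
    · exact (hkp i).eq_snd (Or.inr (Or.inr (ha0 v hv)))
  · intro i v t ht
    exact ⟨pushedStrand_bottom (p := (v, t)) (ht.trans (by norm_num)),
      (hkp i).eq_snd (Or.inl (by linarith [hW1 i]))⟩
  · intro i v t ht
    refine ⟨?_, (hkp i).eq_snd (Or.inr (Or.inl ((hW2 i).trans ht)))⟩
    rw [pushedStrand_top (hW1 i) ((hW2 i).trans ht),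
      pushedStrand_top (p := (v, 1)) (hW1 i) (by linarith [hW2 i])]
  · exact fun i v t hv => norm_pushedStrand_le (sgn_sq i) (hband.disk i) hU hv
  · intro p
    rw [hband.mem_iff]
    have : ∀ i v, pushedStrand (sgn i) (e i) U (W i) (v, 1) = e i (planePoint (1 / 2) v) :=
      fun i v => pushedStrand_top (hW1 i) (by linarith [hW2 i])
    simp only [this]
  · exact fun i v t ht => (hkp i).mem_Ioo ht
  · intro i j p p' hp hp' hy hkk
    by_cases hij : i = j
    · subst hij
      exact ⟨rfl, injective_pushedStrand (hband.disk i) (sgn_sq i) hU (hkp i) (hW1 i) hp hp' hy hkk⟩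
    · exfalso
      by_cases hib : i = b
      · have hjb : j = !b := by
          rw [← hib]
          exact eq_not_of_ne i j hij
        subst hib hjb
        exact hboth p p' hp hp' hy hkk
      · have hjb : j = b := (eq_not_of_ne i j hij).trans (eq_not_of_ne i b hib).symm
        have hib' : i = !b := eq_not_of_ne b i (Ne.symm hib)
        subst hjb hib'
        exact hboth p' p hp' hp hy.symm hkk.symm
  · exact fun i p hp => immersion_pushedStrand (sgn_sq i) (hband.disk i) hU (hW1 i) (hflat i)
      (hkp i) hp
  · exact fun i p => (hkp i).morse p

/-! ### Knots near a point -/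

section Knot

variable {γ : ℝ → E4}

theorem IsKnotParam.add_int (hγ : IsKnotParam γ) (s : ℝ) (n : ℤ) : γ (s + n) = γ s := by
  simpa using hγ.periodic.int_mul n s

theorem IsKnotParam.exists_mem_Ico (hγ : IsKnotParam γ) (s a : ℝ) :
    ∃ s' ∈ Ico a (a + 1), γ s' = γ s := by
  obtain ⟨s', hs', h⟩ := hγ.periodic.exists_mem_Ico zero_lt_one s a
  exact ⟨s', hs', h.symm⟩

/-- Points of a knot that are close in space are close along the knot. -/
theorem IsKnotParam.eventually_exists (hγ : IsKnotParam γ) (s₁ : ℝ) {ε : ℝ} (hε : 0 < ε) :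
    ∀ᶠ z in 𝓝 (γ s₁), ∀ s, γ s = z → ∃ n : ℤ, |s + n - s₁| < ε := by
  -- One full period around `s₁` without the `ε`-ball: its image is compact and misses `γ s₁`, so
  -- nearby points of the knot have a parameter in the ball.
  set C : Set ℝ := Icc (s₁ - 1 / 2) (s₁ + 1 / 2) \ Metric.ball s₁ ε with hC
  have hCc : IsCompact C := isCompact_Icc.diff Metric.isOpen_ball
  have hnot : γ s₁ ∉ γ '' C := by
    rintro ⟨s, ⟨⟨h1, h2⟩, h3⟩, h⟩
    obtain ⟨n, hn⟩ := hγ.simple s s₁ h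
    have h4 : |(n : ℝ)| < 1 := by
      rw [abs_lt]
      constructor <;> linarith
    have h5 : n = 0 := by
      rw [← Int.cast_abs] at h4
      have : |n| < 1 := by exact_mod_cast h4
      exact Int.abs_lt_one_iff.1 this
    rw [h5, Int.cast_zero, add_zero] at hn
    apply h3
    rw [hn]
    exact Metric.mem_ball_self hε
  filter_upwards [(hCc.image hγ.smooth.continuous).isClosed.isOpen_compl.mem_nhds hnot] with z hz
  rintro s rfl
  obtain ⟨s', hs', hss⟩ := hγ.exists_mem_Ico s (s₁ - 1 / 2)
  obtain ⟨n, hn⟩ := hγ.simple s s' hss.symm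
  refine ⟨n, ?_⟩
  rw [← hn]
  by_contra hge
  apply hz
  refine ⟨s', ⟨⟨hs'.1, by linarith [hs'.2]⟩, fun hb => hge ?_⟩, hss⟩
  rwa [Metric.mem_ball, Real.dist_eq] at hb

theorem IsKnotParam.exists_local_inverse (hγ : IsKnotParam γ) (s₁ : ℝ) :
    ∃ G : E4 → ℝ, ContDiff ℝ ∞ G ∧ ∀ s, |s - s₁| ≤ 1 / 4 → G (γ s) = s := by
  obtain ⟨G, hG, hGγ⟩ := exists_smooth_leftInverse hγ.smooth
    (isCompact_Icc (a := s₁ - 1 / 4) (b := s₁ + 1 / 4)) (by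
      rintro s ⟨h1, h2⟩ s' ⟨h3, h4⟩ h
      obtain ⟨n, hn⟩ := hγ.simple s s' h
      have h4 : |(n : ℝ)| < 1 := by
        rw [abs_lt]
        constructor <;> linarith
      have h5 : n = 0 := by
        rw [← Int.cast_abs] at h4
        have : |n| < 1 := by exact_mod_cast h4
        exact Int.abs_lt_one_iff.1 this
      rw [hn, h5, Int.cast_zero, add_zero]) (by
      intro s _
      rw [injective_iff_map_eq_zero]
      intro u hu
      rw [← toSpanSingleton_deriv] at hu
      simpa [hγ.regular s] using hu)
  refine ⟨G, hG, fun s hs => hGγ s ?_⟩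
  rw [abs_le] at hs
  constructor <;> linarith

/-- If a regular curve runs in a knot, then a neighbourhood of a point in the knot is contained in
the curve. -/
theorem IsKnotParam.eventually_mem_curve (hγ : IsKnotParam γ) {a : ℝ → E4} {s₁ v₁ : ℝ}
    (ha : ContDiffAt ℝ ∞ a v₁) (ha' : deriv a v₁ ≠ 0) (hav : a v₁ = γ s₁)
    (haK : ∀ᶠ v in 𝓝 v₁, a v ∈ range γ) {P : ℝ → Prop} (hP : ∀ᶠ v in 𝓝 v₁, P v) :
    ∀ᶠ s in 𝓝 s₁, ∃ v, P v ∧ γ s = a v := by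
  obtain ⟨G, hG, hGγ⟩ := hγ.exists_local_inverse s₁
  have h1 : ∀ᶠ v in 𝓝 v₁, γ (G (a v)) = a v := by
    have h2 := hγ.eventually_exists s₁ (show (0 : ℝ) < 1 / 4 by norm_num)
    rw [← hav] at h2
    filter_upwards [ha.continuousAt.tendsto.eventually h2, haK] with v hv hvK
    obtain ⟨s, hs⟩ := hvK
    obtain ⟨n, hn⟩ := hv s hs
    rw [← hs, ← hγ.add_int s n, hGγ _ hn.le]
  have hS : ContDiffAt ℝ ∞ (fun v => G (a v)) v₁ := hG.contDiffAt.comp v₁ ha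
  have hS1 : G (a v₁) = s₁ := by
    rw [hav]
    exact hGγ s₁ (by simp)
  have hd : HasStrictDerivAt (fun v => G (a v)) (deriv (fun v => G (a v)) v₁) v₁ :=
    hS.hasStrictDerivAt (by simp)
  -- A stationary parameter `G ∘ a` would make `a = γ ∘ G ∘ a` stationary. Since it is not, the
  -- parameter covers a neighbourhood of `s₁`.
  have hne : deriv (fun v => G (a v)) v₁ ≠ 0 := by
    intro h0
    have h3 : HasDerivAt (fun v => γ (G (a v))) _ v₁ :=
      (((hγ.smooth.differentiable (by simp)) (G (a v₁))).hasDerivAt).scomp v₁ hd.hasDerivAt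
    have h4 := h3.congr_of_eventuallyEq (h1.mono fun v hv => hv.symm)
    rw [h0, zero_smul] at h4
    exact ha' h4.deriv
  have hmap := hd.map_nhds_eq hne
  rw [hS1] at hmap
  rw [← hmap, eventually_map]
  filter_upwards [h1, hP] with v hv hPv
  exact ⟨v, hPv, hv⟩

end Knot

/-! ### The annulus of a ribbon band attachment -/

/-- The map from the annulus is a product near both ends. -/
structure IsCollared (x : ℝ × ℝ → E4) (h : ℝ × ℝ → ℝ) : Prop where
  bottom : ∀ s t, t ≤ 1 / 10 → x (s, t) = x (s, 0) ∧ h (s, t) = t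
  top : ∀ s t, 9 / 10 ≤ t → x (s, t) = x (s, 1) ∧ h (s, t) = t

theorem mem_trivialTangle {p : E3} :
    p ∈ trivialTangle ↔ ∃ i v, |v| ≤ halfChord ∧ strand i v = p := by
  constructor
  · rintro (⟨q, hq, rfl⟩ | ⟨q, hq, rfl⟩) <;> obtain ⟨v, hv, rfl⟩ := mem_chord.1 hq
    · exact ⟨false, v, hv, by simp [strand, sgn]⟩
    · exact ⟨true, v, hv, by simp [strand, sgn]⟩
  · rintro ⟨i, v, hv, rfl⟩
    have hq := mem_chord.2 ⟨v, hv, rfl⟩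
    cases i
    · exact Or.inl ⟨_, hq, by simp [strand, sgn]⟩
    · exact Or.inr ⟨_, hq, by simp [strand, sgn]⟩

theorem planePoint_mem_chord {v : ℝ} (hv : |v| ≤ halfChord) : planePoint (1 / 2) v ∈ chord :=
  mem_chord.2 ⟨v, hv, rfl⟩

theorem strand_mem {v : ℝ} (i : Bool) (hv : |v| ≤ halfChord) :
    strand i v ∈ Metric.closedBall (0 : E3) 1 := by
  rw [mem_closedBall_zero_iff, strand, norm_flat (sgn_sq i)]
  exact (planePoint_mem_chord hv).1

theorem strand_two (i : Bool) (v : ℝ) : strand i v 2 = v := rfl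

theorem strand_inj {i j : Bool} {v v' : ℝ} (hv : |v| ≤ halfChord) (hv' : |v'| ≤ halfChord)
    (h : strand i v = strand j v') : i = j ∧ v = v' := by
  refine ⟨?_, by simpa [strand_two] using congrArg (fun p : E3 => p 2) h⟩
  by_contra hij
  rw [eq_not_of_ne i j hij] at h
  exact flat_ne_flat_not (chord_subset (planePoint_mem_chord hv))
    (chord_subset (planePoint_mem_chord hv')) h

theorem contDiff_strand (i : Bool) : ContDiff ℝ ∞ (strand i) := by
  apply (contDiff_flat _).comp
  rw [contDiff_euclidean]
  intro j
  fin_cases j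
  · exact contDiff_const
  · exact contDiff_id

theorem morseNoMaxAt_snd (p : ℝ × ℝ) : MorseNoMaxAt (Prod.snd : ℝ × ℝ → ℝ) p :=
  (isPitFunction_snd (U := 0) (w := 0)).morse p

/-- Over the part of the knot inside the ball the annulus is the ball cobordism transported by `φ`,
elsewhere it is the product. The pieces fit smoothly since the cobordism is constant near the ends
of the strands. They stay disjoint since the cobordism remains in the ball, which the rest of the
knot avoids. -/
theorem exists_collared_concordance {K K' : Set E4} {γ : ℝ → E4} (hγ : IsKnotParam γ)
    (hK : range γ = K) {φ : E3 → E4} (hφ : IsBallEmbedding φ) {R : Set E3}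
    {y : Bool → ℝ × ℝ → E3} {k : Bool → ℝ × ℝ → ℝ} (hR : IsBallCobordism R y k)
    (hKT : K ∩ φ '' Metric.closedBall 0 1 = φ '' trivialTangle)
    (hK' : K' = (K \ φ '' Metric.closedBall 0 1) ∪ φ '' R) :
    ∃ x h, IsConcordance K K' x h ∧ IsCollared x h ∧ ∀ p, MorseNoMaxAt h p := by
  classical
  obtain ⟨g, hg, hgφ⟩ := exists_smooth_leftInverse hφ.smooth (isCompact_closedBall (0 : E3) 1)
    hφ.injective hφ.immersion
  -- The third coordinate of the model ball is the parameter of both model strands, so `V` is a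
  -- smooth strand parameter along the knot.
  set V : ℝ → ℝ := fun s => (g (γ s)) 2 with hV
  have hVs : ContDiff ℝ ∞ V :=
    (EuclideanSpace.proj (𝕜 := ℝ) (2 : Fin 3)).contDiff.comp (hg.comp hγ.smooth)
  set a : Bool → ℝ → E4 := fun i v => φ (strand i v) with ha
  have has : ∀ i, ContDiff ℝ ∞ (a i) := fun i => hφ.smooth.comp (contDiff_strand i)
  set I : Set ℝ := Icc (-halfChord) halfChord with hI
  have hIv : ∀ v, v ∈ I ↔ |v| ≤ halfChord := fun v => abs_le.symm
  set T : Bool → Set E4 := fun i => a i '' I with hT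
  have hTc : ∀ i, IsClosed (T i) := fun i =>
    (isCompact_Icc.image (has i).continuous).isClosed
  have hgT : ∀ i v, |v| ≤ halfChord → (g (a i v)) 2 = v := by
    intro i v hv
    simp only [ha, hgφ _ (strand_mem i hv), strand_two]
  have hJ : ∀ i s, γ s ∈ T i → |V s| ≤ halfChord ∧ γ s = a i (V s) := by
    rintro i s ⟨v, hv, hvs⟩
    have hv' := (hIv v).1 hv
    have h1 : V s = v := by
      simp only [hV, ← hvs, hgT i v hv']
    rw [h1]
    exact ⟨hv', hvs.symm⟩
  have hTdisj : ∀ i j s, γ s ∈ T i → γ s ∈ T j → i = j := by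
    intro i j s hi hj
    obtain ⟨h1, h2⟩ := hJ i s hi
    obtain ⟨-, h3⟩ := hJ j s hj
    have h4 := hφ.injective (strand_mem i h1) (strand_mem j h1) (h2.symm.trans h3)
    exact (strand_inj h1 h1 h4).1
  have hTK : ∀ i v, |v| ≤ halfChord → a i v ∈ range γ := by
    intro i v hv
    have h1 : a i v ∈ φ '' trivialTangle := ⟨_, mem_trivialTangle.2 ⟨i, v, hv, rfl⟩, rfl⟩
    rw [← hKT, ← hK] at h1
    exact h1.1
  have hball : ∀ s, γ s ∈ φ '' Metric.closedBall 0 1 → ∃ i, γ s ∈ T i := by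
    intro s hs
    have h1 : γ s ∈ φ '' trivialTangle := by
      rw [← hKT, ← hK]
      exact ⟨⟨s, rfl⟩, hs⟩
    obtain ⟨p, hp, hps⟩ := h1
    obtain ⟨i, v, hv, rfl⟩ := mem_trivialTangle.1 hp
    exact ⟨i, v, (hIv v).2 hv, hps⟩
  set x : ℝ × ℝ → E4 := fun p => if γ p.1 ∈ T false then φ (y false (V p.1, p.2)) else
    if γ p.1 ∈ T true then φ (y true (V p.1, p.2)) else γ p.1 with hx
  set h : ℝ × ℝ → ℝ := fun p => if γ p.1 ∈ T false then k false (V p.1, p.2) else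
    if γ p.1 ∈ T true then k true (V p.1, p.2) else p.2 with hh
  have hx1 : ∀ i s t, γ s ∈ T i → x (s, t) = φ (y i (V s, t)) ∧ h (s, t) = k i (V s, t) := by
    intro i s t hs
    cases i
    · simp only [hx, hh, if_pos hs, and_self]
    · have : γ s ∉ T false := fun h0 => Bool.noConfusion (hTdisj _ _ s h0 hs)
      simp only [hx, hh, if_neg this, if_pos hs, and_self]
  have hx0 : ∀ s t, (∀ i, γ s ∉ T i) → x (s, t) = γ s ∧ h (s, t) = t := by
    intro s t hs
    simp only [hx, hh, if_neg (hs false), if_neg (hs true), and_self]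
  have hcase : ∀ s, (∀ i, γ s ∉ T i) ∨ ∃ i, γ s ∈ T i := fun s => by
    by_cases hs : ∃ i, γ s ∈ T i
    · exact Or.inr hs
    · exact Or.inl (not_exists.1 hs)
  have had : ∀ i v, |v| < halfChord → deriv (a i) v ≠ 0 := by
    intro i v hv h0
    have h1 : HasDerivAt (a i) (deriv (a i) v) v :=
      (((has i).differentiable (by simp)) v).hasDerivAt
    have h2 : ContDiff ℝ ∞ fun z => (g z) 2 :=
      (EuclideanSpace.proj (𝕜 := ℝ) (2 : Fin 3)).contDiff.comp hg
    have h3 := ((h2.differentiable (by simp)) (a i v)).hasFDerivAt.comp_hasDerivAt v h1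
    rw [h0, map_zero] at h3
    have h4 : (fun z => (g z) 2) ∘ a i =ᶠ[𝓝 v] id := by
      filter_upwards [continuous_abs.continuousAt.eventually (gt_mem_nhds hv)] with w hw
      exact hgT i w (le_of_lt hw)
    have h5 := h3.unique ((hasDerivAt_id v).congr_of_eventuallyEq h4)
    exact zero_ne_one h5
  -- the local form of the annulus
  have hlocal : ∀ s, (∀ᶠ s' in 𝓝 s, ∀ t, x (s', t) = γ s' ∧ h (s', t) = t) ∨
      ∃ i, |V s| < halfChord ∧ ∀ᶠ s' in 𝓝 s, γ s' ∈ T i := by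
    intro s
    rcases hcase s with hs | ⟨i, hi⟩
    · left
      have h1 : ∀ i, ∀ᶠ s' in 𝓝 s, γ s' ∉ T i := fun i =>
        hγ.smooth.continuous.continuousAt.eventually ((hTc i).isOpen_compl.mem_nhds (hs i))
      filter_upwards [h1 false, h1 true] with s' h2 h3 t
      exact hx0 s' t (fun i => by cases i <;> assumption)
    · obtain ⟨h1, h2⟩ := hJ i s hi
      rcases h1.lt_or_eq with h1 | h1
      · right
        refine ⟨i, h1, ?_⟩
        have h3 : ∀ᶠ v in 𝓝 (V s), |v| ≤ halfChord :=
          (continuous_abs.continuousAt.eventually (gt_mem_nhds h1)).mono fun v hv => le_of_lt hv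
        -- In the interior of a strand, the strand fills a neighbourhood in the knot, so the
        -- cobordism describes the annulus nearby.
        filter_upwards [hγ.eventually_mem_curve (has i).contDiffAt (had i _ h1) h2.symm
          (h3.mono fun v hv => hTK i v hv) h3] with s' hs'
        obtain ⟨v, hv, hvs⟩ := hs'
        exact ⟨v, (hIv v).2 hv, hvs.symm⟩
      · left
        -- At an end of a strand the knot leaves the ball; on both sides the annulus is the product,
        -- because the cobordism is constant for `|v| ≥ c`.
        obtain ⟨c, hc, hcend⟩ := hR.near_end
        have h3 : ∀ᶠ s' in 𝓝 s, c < |V s'| :=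
          hVs.continuous.abs.continuousAt.eventually (lt_mem_nhds (show c < |V s| by rw [h1]; exact hc))
        have h4 : ∀ᶠ s' in 𝓝 s, γ s' ∉ T (!i) :=
          hγ.smooth.continuous.continuousAt.eventually ((hTc (!i)).isOpen_compl.mem_nhds
            (fun h5 => by
              have := hTdisj _ _ s hi h5
              cases i <;> exact Bool.noConfusion this))
        filter_upwards [h3, h4] with s' h5 h6 t
        by_cases h7 : γ s' ∈ T i
        · obtain ⟨h8, h9⟩ := hJ i s' h7
          obtain ⟨h10, h11⟩ := hcend i (V s') t h5.le h8
          obtain ⟨h12, h13⟩ := hx1 i s' t h7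
          rw [h12, h13, h10, h11]
          exact ⟨h9.symm, rfl⟩
        · apply hx0
          intro j
          by_cases hj : j = i
          · rwa [hj]
          · rwa [eq_not_of_ne i j (Ne.symm hj)]
  have hfst : ∀ {P : ℝ → Prop} (p : ℝ × ℝ), (∀ᶠ s in 𝓝 p.1, P s) → ∀ᶠ q : ℝ × ℝ in 𝓝 p, P q.1 :=
    fun p hP => continuous_fst.continuousAt.eventually hP
  set W : ℝ × ℝ → ℝ × ℝ := fun p => (V p.1, p.2) with hW
  have hWs : ContDiff ℝ ∞ W := by fun_prop
  have hlocal' : ∀ p : ℝ × ℝ, ((x =ᶠ[𝓝 p] fun p => γ p.1) ∧ h =ᶠ[𝓝 p] Prod.snd) ∨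
      ∃ i, |V p.1| < halfChord ∧ (∀ᶠ s' in 𝓝 p.1, γ s' ∈ T i) ∧
        (x =ᶠ[𝓝 p] fun p => φ (y i (W p))) ∧ h =ᶠ[𝓝 p] k i ∘ W := by
    intro p
    rcases hlocal p.1 with h1 | ⟨i, h1, h2⟩
    · left
      have h2 := hfst p h1
      exact ⟨h2.mono fun q hq => (hq q.2).1, h2.mono fun q hq => (hq q.2).2⟩
    · right
      have h3 := hfst p h2
      exact ⟨i, h1, h2, h3.mono fun q hq => (hx1 i q.1 q.2 hq).1,
        h3.mono fun q hq => (hx1 i q.1 q.2 hq).2⟩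
  -- Locally `γ = a i ∘ V`, and `γ` is regular.
  have hVd : ∀ i s, |V s| < halfChord → (∀ᶠ s' in 𝓝 s, γ s' ∈ T i) → deriv V s ≠ 0 := by
    intro i s hs hev h0
    have h1 : HasDerivAt V (deriv V s) s := ((hVs.differentiable (by simp)) s).hasDerivAt
    have h2 : HasDerivAt (fun s => a i (V s)) _ s :=
      ((((has i).differentiable (by simp)) (V s)).hasDerivAt).scomp s h1
    rw [h0, zero_smul] at h2
    have h3 := h2.congr_of_eventuallyEq (f₁ := γ) (hev.mono fun s' hs' => (hJ i s' hs').2)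
    exact hγ.regular s h3.deriv
  have hWinj : ∀ p : ℝ × ℝ, deriv V p.1 ≠ 0 → Function.Injective (fderiv ℝ W p) := by
    intro p hp
    have h1 : HasFDerivAt (fun p : ℝ × ℝ => V p.1) _ p :=
      (((hVs.differentiable (by simp)) p.1).hasDerivAt).comp_hasFDerivAt p
        (hasFDerivAt_fst (𝕜 := ℝ))
    have h2 : HasFDerivAt W _ p := h1.prodMk (hasFDerivAt_snd (𝕜 := ℝ))
    rw [h2.fderiv, injective_iff_map_eq_zero]
    intro u hu
    have h3 := congrArg Prod.fst hu
    have h4 := congrArg Prod.snd hu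
    simp at h3 h4
    exact Prod.ext (h3.resolve_left hp) h4
  have hbot : ∀ s t, t ≤ 1 / 10 → x (s, t) = γ s ∧ h (s, t) = t := by
    intro s t ht
    rcases hcase s with hs | ⟨i, hi⟩
    · exact hx0 s t hs
    · obtain ⟨h1, h2⟩ := hx1 i s t hi
      obtain ⟨h3, h4⟩ := hR.bottom i (V s) t ht
      rw [h1, h2, h3, h4]
      exact ⟨(hJ i s hi).2.symm, rfl⟩
  have htop : ∀ s t, 9 / 10 ≤ t → x (s, t) = x (s, 1) ∧ h (s, t) = t := by
    intro s t ht
    rcases hcase s with hs | ⟨i, hi⟩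
    · exact ⟨(hx0 s t hs).1.trans (hx0 s 1 hs).1.symm, (hx0 s t hs).2⟩
    · obtain ⟨h1, h2⟩ := hx1 i s t hi
      obtain ⟨h3, h4⟩ := hR.top i (V s) t ht
      rw [h1, h2, h3, h4, (hx1 i s 1 hi).1]
      exact ⟨rfl, rfl⟩
  have hyb : ∀ i s t, γ s ∈ T i → y i (V s, t) ∈ Metric.closedBall (0 : E3) 1 := by
    intro i s t hs
    rw [mem_closedBall_zero_iff]
    exact hR.norm_le i _ _ (hJ i s hs).1
  have hhmem : ∀ s, ∀ t ∈ Ioo (0 : ℝ) 1, h (s, t) ∈ Ioo (0 : ℝ) 1 := by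
    intro s t ht
    rcases hcase s with hs | ⟨i, hi⟩
    · rw [(hx0 s t hs).2]
      exact ht
    · rw [(hx1 i s t hi).2]
      exact hR.mem_Ioo i _ t ht
  have hh0 : ∀ s, h (s, 0) = 0 := fun s => (hbot s 0 (by norm_num)).2
  have hh1 : ∀ s, h (s, 1) = 1 := fun s => (htop s 1 (by norm_num)).2
  have hneat : ∀ p : ℝ × ℝ, h =ᶠ[𝓝 p] Prod.snd → fderiv ℝ h p ≠ 0 := by
    intro p hp h0
    have h5 : fderiv ℝ (Prod.snd : ℝ × ℝ → ℝ) p = ContinuousLinearMap.snd ℝ ℝ ℝ := fderiv_snd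
    rw [hp.fderiv_eq, h5] at h0
    have := congrArg (fun T => T (0, 1)) h0
    simp at this
  refine ⟨x, h, ⟨?_, ?_, ?_, ?_, ?_, ?_, ?_, ?_, ?_, ?_, ?_, ?_, ?_, ?_⟩, ⟨?_, htop⟩, ?_⟩
  · rw [contDiff_iff_contDiffAt]
    intro p
    rcases hlocal' p with ⟨h1, -⟩ | ⟨i, h1, -, h2, -⟩
    · exact (hγ.smooth.comp contDiff_fst).contDiffAt.congr_of_eventuallyEq h1
    · exact (hφ.smooth.contDiffAt.comp p ((hR.smooth_fst i (W p) h1).comp p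
        hWs.contDiffAt)).congr_of_eventuallyEq h2
  · rw [contDiff_iff_contDiffAt]
    intro p
    rcases hlocal' p with ⟨-, h1⟩ | ⟨i, -, -, -, h1⟩
    · exact contDiff_snd.contDiffAt.congr_of_eventuallyEq h1
    · exact ((hR.smooth_snd i).comp hWs).contDiffAt.congr_of_eventuallyEq h1
  · intro s t
    simp only [hx, hV, hγ.periodic s]
  · intro s t
    simp only [hh, hV, hγ.periodic s]
  · intro s t ht
    rcases hcase s with hs | ⟨i, hi⟩
    · rw [(hx0 s t hs).1, hγ.mem_sphere]
    · rw [(hx1 i s t hi).1, hφ.mem_sphere _ (hyb i s t hi)]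
  · rintro s t ⟨ht0, ht1⟩
    rcases ht0.eq_or_lt with rfl | ht0
    · rw [hh0]
      simp
    rcases ht1.eq_or_lt with rfl | ht1
    · rw [hh1]
      simp
    exact Ioo_subset_Icc_self (hhmem s t ⟨ht0, ht1⟩)
  · intro s s' t ht t' ht' hxx hhh
    have hout : ∀ s, (∀ i, γ s ∉ T i) → γ s ∉ φ '' Metric.closedBall 0 1 := fun s hs hb =>
      let ⟨i, hi⟩ := hball s hb
      hs i hi
    have hin : ∀ i s t, γ s ∈ T i → x (s, t) ∈ φ '' Metric.closedBall 0 1 := fun i s t hs => by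
      rw [(hx1 i s t hs).1]
      exact ⟨_, hyb i s t hs, rfl⟩
    rcases hcase s with hs | ⟨i, hi⟩ <;> rcases hcase s' with hs' | ⟨j, hj⟩
    · rw [(hx0 s t hs).1, (hx0 s' t' hs').1] at hxx
      rw [(hx0 s t hs).2, (hx0 s' t' hs').2] at hhh
      exact ⟨hhh, hγ.simple s s' hxx⟩
    · have h1 := hin j s' t' hj
      rw [← hxx, (hx0 s t hs).1] at h1
      exact (hout s hs h1).elim
    · have h1 := hin i s t hi
      rw [hxx, (hx0 s' t' hs').1] at h1
      exact (hout s' hs' h1).elim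
    · rw [(hx1 i s t hi).1, (hx1 j s' t' hj).1] at hxx
      rw [(hx1 i s t hi).2, (hx1 j s' t' hj).2] at hhh
      obtain ⟨rfl, h2⟩ := hR.injective i j _ _ (hJ i s hi).1 (hJ j s' hj).1
        (hφ.injective (hyb i s t hi) (hyb j s' t' hj) hxx) hhh
      obtain ⟨h3, h4⟩ := Prod.ext_iff.1 h2
      refine ⟨h4, hγ.simple s s' ?_⟩
      rw [(hJ i s hi).2, (hJ i s' hj).2]
      exact congrArg (a i) h3
  · intro s t ht
    rcases hlocal' (s, t) with ⟨h1, h2⟩ | ⟨i, h1, h2, h3, h4⟩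
    · have h5 : HasFDerivAt (fun p : ℝ × ℝ => γ p.1)
          ((fderiv ℝ γ s).comp (ContinuousLinearMap.fst ℝ ℝ ℝ)) (s, t) := by
        have h6 : HasFDerivAt γ (fderiv ℝ γ s) ((s, t) : ℝ × ℝ).1 :=
          ((hγ.smooth.differentiable (by simp)) s).hasFDerivAt
        exact h6.comp (s, t) (hasFDerivAt_fst (𝕜 := ℝ))
      have h6 : HasFDerivAt (fun p => (x p, h p)) _ (s, t) :=
        (h5.congr_of_eventuallyEq h1).prodMk
          ((hasFDerivAt_snd (𝕜 := ℝ) (p := (s, t))).congr_of_eventuallyEq h2)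
      rw [h6.fderiv, injective_iff_map_eq_zero]
      intro u hu
      have h7 : fderiv ℝ γ s u.1 = 0 := congrArg Prod.fst hu
      have h8 : u.2 = 0 := congrArg Prod.snd hu
      rw [← toSpanSingleton_deriv] at h7
      exact Prod.ext (by simpa [hγ.regular s] using h7) h8
    · have hs : γ s ∈ T i := h2.self_of_nhds
      have hWd : HasFDerivAt W (fderiv ℝ W (s, t)) (s, t) :=
        ((hWs.differentiable (by simp)) _).hasFDerivAt
      have hyd : HasFDerivAt (y i) (fderiv ℝ (y i) (W (s, t))) (W (s, t)) :=
        ((hR.smooth_fst i (W (s, t)) h1).differentiableAt (by simp)).hasFDerivAt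
      have hkd : HasFDerivAt (k i) (fderiv ℝ (k i) (W (s, t))) (W (s, t)) :=
        (((hR.smooth_snd i).differentiable (by simp)) _).hasFDerivAt
      have hφd : HasFDerivAt φ (fderiv ℝ φ (y i (W (s, t)))) (y i (W (s, t))) :=
        ((hφ.smooth.differentiable (by simp)) _).hasFDerivAt
      have h6 : HasFDerivAt (fun p => (x p, h p)) _ (s, t) :=
        ((hφd.comp (s, t) (hyd.comp (s, t) hWd)).congr_of_eventuallyEq h3).prodMk
          ((hkd.comp (s, t) hWd).congr_of_eventuallyEq h4)
      rw [h6.fderiv, injective_iff_map_eq_zero]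
      intro u hu
      have h7 : fderiv ℝ φ (y i (W (s, t))) (fderiv ℝ (y i) (W (s, t)) (fderiv ℝ W (s, t) u)) = 0 :=
        congrArg Prod.fst hu
      have h8 : fderiv ℝ (k i) (W (s, t)) (fderiv ℝ W (s, t) u) = 0 := congrArg Prod.snd hu
      have h9 := (injective_iff_map_eq_zero _).1 (hφ.immersion _ (hyb i s t hs)) _ h7
      have h10 := hR.immersion i (W (s, t)) h1
      rw [(hyd.prodMk hkd).fderiv] at h10
      have h11 := (injective_iff_map_eq_zero _).1 h10 (fderiv ℝ W (s, t) u) (Prod.ext h9 h8)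
      exact (injective_iff_map_eq_zero _).1 (hWinj (s, t) (hVd i s h1 h2)) u h11
  · rintro s t ⟨ht0, ht1⟩
    constructor
    · intro h0
      by_contra hne
      rcases ht1.eq_or_lt with rfl | ht1
      · rw [hh1] at h0
        exact one_ne_zero h0
      · exact (hhmem s t ⟨lt_of_le_of_ne ht0 (Ne.symm hne), ht1⟩).1.ne' h0
    · rintro rfl
      exact hh0 s
  · rintro s t ⟨ht0, ht1⟩
    constructor
    · intro h0
      by_contra hne
      rcases ht0.eq_or_lt with rfl | ht0
      · rw [hh0] at h0
        exact zero_ne_one h0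
      · exact (hhmem s t ⟨ht0, lt_of_le_of_ne ht1 hne⟩).2.ne h0
    · rintro rfl
      exact hh1 s
  · intro s
    apply hneat
    filter_upwards [continuous_snd.continuousAt.eventually
      (gt_mem_nhds (show ((s, 0) : ℝ × ℝ).2 < 1 / 10 by norm_num))] with p hp
    exact (hbot p.1 p.2 (le_of_lt hp)).2
  · intro s
    apply hneat
    filter_upwards [continuous_snd.continuousAt.eventually
      (lt_mem_nhds (show 9 / 10 < ((s, 1) : ℝ × ℝ).2 by norm_num))] with p hp
    exact (htop p.1 p.2 (le_of_lt hp)).2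
  · rw [← hK]
    congr 1
    ext1 s
    exact (hbot s 0 (by norm_num)).1
  · rw [hK']
    ext z
    constructor
    · rintro ⟨s, rfl⟩
      rcases hcase s with hs | ⟨i, hi⟩
      · left
        simp only [(hx0 s 1 hs).1]
        refine ⟨by rw [← hK]; exact ⟨s, rfl⟩, fun hb => ?_⟩
        obtain ⟨i, hi⟩ := hball s hb
        exact hs i hi
      · right
        simp only [(hx1 i s 1 hi).1]
        exact ⟨_, (hR.range_top _).2 ⟨i, V s, (hJ i s hi).1, rfl⟩, rfl⟩
    · rintro (⟨hz, hzb⟩ | ⟨p, hp, rfl⟩)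
      · rw [← hK] at hz
        obtain ⟨s, rfl⟩ := hz
        refine ⟨s, (hx0 s 1 fun i hi => hzb ?_).1⟩
        rw [(hJ i s hi).2]
        exact ⟨_, strand_mem i (hJ i s hi).1, rfl⟩
      · obtain ⟨i, v, hv, rfl⟩ := (hR.range_top p).1 hp
        obtain ⟨s, hs⟩ := hTK i v hv
        have h1 : γ s ∈ T i := ⟨v, (hIv v).2 hv, hs.symm⟩
        refine ⟨s, ?_⟩
        simp only [(hx1 i s 1 h1).1]
        rw [show V s = v by simp only [hV, hs, hgT i v hv]]
  · exact fun s t ht => ⟨(hbot s t ht).1.trans (hbot s 0 (by norm_num)).1.symm, (hbot s t ht).2⟩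
  · intro p
    rcases hlocal' p with ⟨-, h1⟩ | ⟨i, h1, h2, -, h3⟩
    · exact (morseNoMaxAt_snd p).congr h1
    · exact (MorseNoMaxAt.comp (hR.morse i (W p)) (hR.smooth_snd i).contDiffAt hWs.contDiffAt
        (fderiv_bijective_of_injective (hWinj p (hVd i p.1 h1 h2)))).congr h3

/-! ### Local inverses -/

theorem exists_local_inverse {E F : Type*} [NormedAddCommGroup E] [NormedSpace ℝ E]
    [FiniteDimensional ℝ E] [NormedAddCommGroup F] [NormedSpace ℝ F] [FiniteDimensional ℝ F]
    {f : E → F} {x : E} (hf : ∀ᶠ y in 𝓝 x, ContDiffAt ℝ ∞ f y)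
    (hx : Function.Bijective (fderiv ℝ f x)) :
    ∃ g : F → E, (∀ᶠ z in 𝓝 (f x), ContDiffAt ℝ ∞ g z) ∧ (∀ᶠ y in 𝓝 x, g (f y) = y) ∧
      ∀ᶠ z in 𝓝 (f x), f (g z) = z := by
  obtain ⟨g, hg, hgf⟩ := exists_leftInverse_nhds hf hx.1
  refine ⟨g, hg, hgf, ?_⟩
  have h1 : map f (𝓝 x) = 𝓝 (f x) :=
    (hf.self_of_nhds.hasStrictFDerivAt (by simp)).map_nhds_eq_of_surj
      (LinearMap.range_eq_top.2 hx.2)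
  rw [← h1, eventually_map]
  filter_upwards [hgf] with y hy
  rw [hy]

/-! ### The collar of a surface in the ball -/

section Collar

variable {F : Set E4} {γ : ℝ → E4}

theorem IsKnotParam.hasDerivAt (hγ : IsKnotParam γ) (s : ℝ) : HasDerivAt γ (deriv γ s) s :=
  ((hγ.smooth.differentiable (by simp)) s).hasDerivAt

theorem IsKnotParam.contDiff_deriv (hγ : IsKnotParam γ) : ContDiff ℝ ∞ (deriv γ) :=
  KnotConcordance.contDiff_deriv hγ.smooth

theorem IsKnotParam.hasDerivAt_deriv (hγ : IsKnotParam γ) (s : ℝ) :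
    HasDerivAt (deriv γ) (deriv (deriv γ) s) s :=
  ((hγ.contDiff_deriv.differentiable (by simp)) s).hasDerivAt

theorem IsKnotParam.inner_deriv (hγ : IsKnotParam γ) (s : ℝ) :
    inner ℝ (γ s) (deriv γ s) = 0 := by
  have h1 := (hγ.hasDerivAt s).inner ℝ (hγ.hasDerivAt s)
  have h2 : (fun t => inner ℝ (γ t) (γ t)) = fun _ => (1 : ℝ) := by
    ext t
    rw [real_inner_self_eq_norm_sq, hγ.mem_sphere, one_pow]
  rw [h2] at h1
  have h3 := h1.unique (hasDerivAt_const s (1 : ℝ))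
  rw [real_inner_comm (γ s)] at h3
  linarith

/-- Differentiating the orthogonality of `γ` and its velocity gives minus the squared speed. It
follows that, for `y` near the knot, orthogonality of `y` to the velocity at `s` is a nondegenerate
equation for `s`. -/
theorem IsKnotParam.inner_deriv_deriv (hγ : IsKnotParam γ) (s : ℝ) :
    inner ℝ (γ s) (deriv (deriv γ) s) ≠ 0 := by
  have h1 := (hγ.hasDerivAt s).inner ℝ (hγ.hasDerivAt_deriv s)
  have h2 : (fun t => inner ℝ (γ t) (deriv γ t)) = fun _ => (0 : ℝ) := by
    ext t
    exact hγ.inner_deriv t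
  rw [h2] at h1
  have h3 := h1.unique (hasDerivAt_const s (0 : ℝ))
  intro h0
  rw [h0, zero_add] at h3
  exact hγ.regular s (inner_self_eq_zero.1 h3)

/-- A point close to a knot lies in the normal hyperplane of only one nearby point of the knot. -/
theorem IsKnotParam.eventually_normal_unique (hγ : IsKnotParam γ) (s₁ : ℝ) :
    ∀ᶠ z : ℝ × E4 × E4 in 𝓝 (s₁, γ s₁, γ s₁), inner ℝ z.2.1 (deriv γ z.1) = 0 →
      ∀ s, γ s = z.2.2 → inner ℝ z.2.1 (deriv γ s) = 0 → ∃ n : ℤ, s = z.1 + n := by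
  set f : ℝ × E4 → ℝ × E4 := fun p => (inner ℝ p.2 (deriv γ p.1), p.2) with hf
  have hfs : ContDiff ℝ ∞ f :=
    ((contDiff_snd).inner ℝ (hγ.contDiff_deriv.comp contDiff_fst)).prodMk contDiff_snd
  have h1 : HasFDerivAt (deriv γ)
      (ContinuousLinearMap.toSpanSingleton ℝ (deriv (deriv γ) s₁)) ((s₁, γ s₁) : ℝ × E4).1 :=
    (hγ.hasDerivAt_deriv s₁).hasFDerivAt
  have h2 : HasFDerivAt f _ (s₁, γ s₁) :=
    ((hasFDerivAt_snd (𝕜 := ℝ)).inner ℝ (h1.comp (s₁, γ s₁) (hasFDerivAt_fst (𝕜 := ℝ)))).prodMk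
      (hasFDerivAt_snd (𝕜 := ℝ))
  have h3 : Function.Injective (fderiv ℝ f (s₁, γ s₁)) := by
    rw [h2.fderiv, injective_iff_map_eq_zero]
    rintro ⟨u, v⟩ huv
    have hv : v = 0 := congrArg Prod.snd huv
    subst hv
    have hu := congrArg Prod.fst huv
    simp [hγ.inner_deriv_deriv s₁, inner_smul_right] at hu
    rw [hu]
    rfl
  obtain ⟨u, hu, hinj⟩ := injOn_nhds_of_immersion
    (Eventually.of_forall fun _ => hfs.contDiffAt) h3
  obtain ⟨u₁, hu₁, u₂, hu₂, huu⟩ := mem_nhds_prod_iff.1 hu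
  obtain ⟨ε, hε, hεu⟩ := Metric.mem_nhds_iff.1 hu₁
  rw [nhds_prod_eq, nhds_prod_eq]
  filter_upwards [Filter.prod_mem_prod hu₁
    (Filter.prod_mem_prod hu₂ (hγ.eventually_exists s₁ hε))] with z hz h4 s hs h5
  obtain ⟨n, hn⟩ := hz.2.2 s hs
  have h6 : deriv γ (s + n) = deriv γ s := by
    have h7 : (fun t => γ (t + n)) = γ := funext fun t => hγ.add_int t n
    rw [← deriv_comp_add_const, h7]
  have h8 := hinj (huu ⟨hz.1, hz.2.1⟩ : (z.1, z.2.1) ∈ u)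
    (huu ⟨hεu (by rwa [Metric.mem_ball, Real.dist_eq]), hz.2.1⟩ : (s + n, z.2.1) ∈ u)
    (by simp only [hf, h4, h6, h5])
  refine ⟨-n, ?_⟩
  have h9 : z.1 = s + n := congrArg Prod.fst h8
  rw [h9]
  push_cast
  ring

/-- The map `Φ` that sends `(s, y)` to `s`, the local equation of `F`, the product of `y` with the
velocity at `s`, and the squared norm is a local diffeomorphism at `(s₁, γ s₁)`. Its injectivity
gives uniqueness of the point of `F` of given norm in a normal hyperplane, and its inverse gives
existence. -/
theorem exists_local_collar (hF : IsNeatSurface F) (hγ : IsKnotParam γ)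
    (hK : range γ = F ∩ Metric.sphere 0 1) (s₁ : ℝ) :
    (∀ᶠ z : ℝ × E4 × E4 in 𝓝 (s₁, γ s₁, γ s₁), z.2.1 ∈ F → z.2.2 ∈ F →
      inner ℝ z.2.1 (deriv γ z.1) = 0 → inner ℝ z.2.2 (deriv γ z.1) = 0 →
      ‖z.2.1‖ = ‖z.2.2‖ → z.2.1 = z.2.2) ∧
    ∃ f : ℝ × ℝ → E4, f (s₁, 1) = γ s₁ ∧ ∀ᶠ q in 𝓝 ((s₁, 1) : ℝ × ℝ), ContDiffAt ℝ ∞ f q ∧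
      inner ℝ (f q) (deriv γ q.1) = 0 ∧ ‖f q‖ = q.2 ∧ (q.2 ≤ 1 → f q ∈ F) := by
  have hmem : ∀ s, γ s ∈ F := fun s => (hK.subset ⟨s, rfl⟩).1
  obtain ⟨U, G, hU, hpU, hG, hUF, hsurj, htr⟩ := hF.local_equation (γ s₁) (hmem s₁)
  have hGat : ∀ y ∈ U, ContDiffAt ℝ ∞ G y := fun y hy => hG.contDiffAt (hU.mem_nhds hy)
  have hGd : HasFDerivAt G (fderiv ℝ G (γ s₁)) (γ s₁) :=
    ((hGat _ hpU).differentiableAt (by simp)).hasFDerivAt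
  have hGγ : fderiv ℝ G (γ s₁) (deriv γ s₁) = 0 := by
    have h1 := hGd.comp_hasDerivAt s₁ (hγ.hasDerivAt s₁)
    have h2 : G ∘ γ =ᶠ[𝓝 s₁] fun _ => 0 := by
      filter_upwards [hγ.smooth.continuous.continuousAt.eventually (hU.mem_nhds hpU)] with s hs
      exact ((hUF _ hs).1 (hmem s)).2
    exact h1.unique ((hasDerivAt_const s₁ (0 : E2)).congr_of_eventuallyEq h2)
  -- By neatness the differential of `G` and the product with `γ s₁` are jointly onto a space of
  -- dimension 3. Their common kernel is thus a line, and it contains the velocity of the knot.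
  have hline : ∀ v, fderiv ℝ G (γ s₁) v = 0 → inner ℝ (γ s₁) v = 0 →
      ∃ c : ℝ, c • deriv γ s₁ = v := by
    let M : E4 →ₗ[ℝ] E2 × ℝ :=
      (fderiv ℝ G (γ s₁) : E4 →ₗ[ℝ] E2).prod (innerSL ℝ (γ s₁) : E4 →ₗ[ℝ] ℝ)
    have hM : Function.Surjective M := by
      rintro ⟨w, c⟩
      obtain ⟨v, hv, hvw⟩ := htr (hγ.mem_sphere s₁) (w - c • fderiv ℝ G (γ s₁) (γ s₁))
      refine ⟨v + c • γ s₁, Prod.ext ?_ ?_⟩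
      · show fderiv ℝ G (γ s₁) (v + c • γ s₁) = w
        rw [map_add, map_smul, hvw, sub_add_cancel]
      · show inner ℝ (γ s₁) (v + c • γ s₁) = c
        rw [inner_add_right, hv, inner_smul_right, real_inner_self_eq_norm_sq, hγ.mem_sphere]
        ring
    have h1 := LinearMap.finrank_range_add_finrank_ker M
    rw [LinearMap.range_eq_top.2 hM, finrank_top] at h1
    have h2 : Module.finrank ℝ (LinearMap.ker M) = 1 := by
      simp only [Module.finrank_prod, finrank_euclideanSpace, Fintype.card_fin,
        Module.finrank_self] at h1
      omega
    have hker : ∀ v, fderiv ℝ G (γ s₁) v = 0 → inner ℝ (γ s₁) v = 0 → v ∈ LinearMap.ker M :=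
      fun v h3 h4 => LinearMap.mem_ker.2 (Prod.ext h3 h4)
    intro v h3 h4
    obtain ⟨c, hc⟩ := (finrank_eq_one_iff_of_nonzero'
      (⟨deriv γ s₁, hker _ hGγ (hγ.inner_deriv s₁)⟩ : LinearMap.ker M)
      (fun h => hγ.regular s₁ (congrArg Subtype.val h))).1 h2 ⟨v, hker v h3 h4⟩
    exact ⟨c, congrArg Subtype.val hc⟩
  set Φ : ℝ × E4 → ℝ × E2 × ℝ × ℝ :=
    fun p => (p.1, G p.2, inner ℝ p.2 (deriv γ p.1), ‖p.2‖ ^ 2) with hΦ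
  have hΦs : ∀ᶠ p in 𝓝 (s₁, γ s₁), ContDiffAt ℝ ∞ Φ p := by
    filter_upwards [continuous_snd.continuousAt.eventually (hU.mem_nhds hpU)] with p hp
    exact contDiffAt_fst.prodMk (((hGat p.2 hp).comp p contDiffAt_snd).prodMk
      ((contDiffAt_snd.inner ℝ (hγ.contDiff_deriv.contDiffAt.comp p contDiffAt_fst)).prodMk
        (contDiffAt_snd.norm_sq ℝ)))
  have hΦd : Function.Bijective (fderiv ℝ Φ (s₁, γ s₁)) := by
    have h1 : HasFDerivAt (deriv γ)
        (ContinuousLinearMap.toSpanSingleton ℝ (deriv (deriv γ) s₁)) ((s₁, γ s₁) : ℝ × E4).1 :=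
      (hγ.hasDerivAt_deriv s₁).hasFDerivAt
    have h2 : HasFDerivAt G (fderiv ℝ G (γ s₁)) ((s₁, γ s₁) : ℝ × E4).2 := hGd
    have h3 : HasFDerivAt Φ _ (s₁, γ s₁) :=
      (hasFDerivAt_fst (𝕜 := ℝ)).prodMk ((h2.comp (s₁, γ s₁) (hasFDerivAt_snd (𝕜 := ℝ))).prodMk
        (((hasFDerivAt_snd (𝕜 := ℝ)).inner ℝ
          (h1.comp (s₁, γ s₁) (hasFDerivAt_fst (𝕜 := ℝ)))).prodMk
          (hasFDerivAt_snd (𝕜 := ℝ)).norm_sq))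
    have h4 : Function.Injective (fderiv ℝ Φ (s₁, γ s₁)) := by
      rw [h3.fderiv, injective_iff_map_eq_zero]
      rintro ⟨u, v⟩ huv
      have hu : u = 0 := congrArg Prod.fst huv
      subst hu
      have hv1 : fderiv ℝ G (γ s₁) v = 0 := congrArg (fun q => q.2.1) huv
      have hv2 := congrArg (fun q => q.2.2.1) huv
      have hv3 := congrArg (fun q => q.2.2.2) huv
      simp at hv2 hv3
      obtain ⟨c, rfl⟩ := hline v hv1 hv3
      rw [inner_smul_left] at hv2
      have hc : c = 0 := by
        rcases mul_eq_zero.1 hv2 with h | h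
        · simpa using h
        · exact (hγ.regular s₁ (inner_self_eq_zero.1 h)).elim
      rw [hc, zero_smul]
      rfl
    have h5 : Module.finrank ℝ (ℝ × E4) = Module.finrank ℝ (ℝ × E2 × ℝ × ℝ) := by
      simp only [Module.finrank_prod, finrank_euclideanSpace, Fintype.card_fin,
        Module.finrank_self]
    exact ⟨h4, (LinearMap.injective_iff_surjective_of_finrank_eq_finrank
      (f := (fderiv ℝ Φ (s₁, γ s₁) : (ℝ × E4) →ₗ[ℝ] _)) h5).1 h4⟩
  obtain ⟨g, hg, hgΦ, hΦg⟩ := exists_local_inverse hΦs hΦd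
  constructor
  · have hc1 : Continuous fun z : ℝ × E4 × E4 => (z.1, z.2.1) := by fun_prop
    have hc2 : Continuous fun z : ℝ × E4 × E4 => (z.1, z.2.2) := by fun_prop
    have h0 := hgΦ.and (continuous_snd.continuousAt.eventually (hU.mem_nhds hpU))
    filter_upwards [hc1.continuousAt.eventually h0, hc2.continuousAt.eventually h0]
      with z hz1 hz2 hy hy' h1 h2 h3
    have h4 : Φ (z.1, z.2.1) = Φ (z.1, z.2.2) := by
      simp only [hΦ, ((hUF _ hz1.2).1 hy).2, ((hUF _ hz2.2).1 hy').2, h1, h2, h3]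
    exact congrArg Prod.snd (hz1.1.symm.trans ((congrArg g h4).trans hz2.1))
  · have hΦ1 : Φ (s₁, γ s₁) = (s₁, 0, 0, 1) := by
      simp only [hΦ, ((hUF _ hpU).1 (hmem s₁)).2, hγ.inner_deriv, hγ.mem_sphere, one_pow]
    have hg1 : g (s₁, 0, 0, 1) = (s₁, γ s₁) := by
      rw [← hΦ1]
      exact hgΦ.self_of_nhds
    rw [hΦ1] at hg hΦg
    -- The last coordinate of `Φ` is the squared norm, so the collar with norm `q.2` is read off at
    -- `q.2 ^ 2`.
    set j : ℝ × ℝ → ℝ × E2 × ℝ × ℝ := fun q => (q.1, 0, 0, q.2 ^ 2) with hj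
    have hjs : ContDiff ℝ ∞ j := contDiff_fst.prodMk (contDiff_const.prodMk
      (contDiff_const.prodMk (contDiff_snd.pow 2)))
    have hj1 : j (s₁, 1) = (s₁, 0, 0, 1) := by simp [hj]
    rw [← hj1] at hg hΦg hg1
    refine ⟨fun q => (g (j q)).2, congrArg Prod.snd hg1, ?_⟩
    have hcont : ContinuousAt (fun q => (g (j q)).2) (s₁, 1) :=
      continuous_snd.continuousAt.comp
        (hg.self_of_nhds.continuousAt.comp hjs.continuous.continuousAt)
    have hU' : ∀ᶠ q in 𝓝 ((s₁, 1) : ℝ × ℝ), (g (j q)).2 ∈ U := by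
      apply hcont.tendsto.eventually
      rw [hg1]
      exact hU.mem_nhds hpU
    filter_upwards [hjs.continuous.continuousAt.eventually (hg.and hΦg), hU',
      continuous_snd.continuousAt.eventually
        (lt_mem_nhds (show (0 : ℝ) < ((s₁, 1) : ℝ × ℝ).2 by norm_num))] with q hq hqU hq0
    have h1 : (g (j q)).1 = q.1 := congrArg Prod.fst hq.2
    have h2 : G (g (j q)).2 = 0 := congrArg (fun w => w.2.1) hq.2
    have h3 : inner ℝ (g (j q)).2 (deriv γ (g (j q)).1) = 0 := congrArg (fun w => w.2.2.1) hq.2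
    have h4 : ‖(g (j q)).2‖ ^ 2 = q.2 ^ 2 := congrArg (fun w => w.2.2.2) hq.2
    rw [h1] at h3
    have h5 : ‖(g (j q)).2‖ = q.2 := by
      rwa [sq_eq_sq₀ (norm_nonneg _) (le_of_lt hq0)] at h4
    exact ⟨contDiffAt_snd.comp q (hq.1.comp q hjs.contDiffAt), h3, h5,
      fun hq1 => (hUF _ hqU).2 ⟨h5.trans_le hq1, h2⟩⟩

end Collar

/-! ### A global collar of the boundary knot, parametrised by the norm. -/

section RadialCollar

variable {F : Set E4} {γ : ℝ → E4}

theorem IsKnotParam.deriv_add_int (hγ : IsKnotParam γ) (s : ℝ) (n : ℤ) :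
    deriv γ (s + n) = deriv γ s := by
  have h : (fun t => γ (t + n)) = γ := funext fun t => hγ.add_int t n
  rw [← deriv_comp_add_const, h]

theorem IsKnotParam.deriv_deriv_add_int (hγ : IsKnotParam γ) (s : ℝ) (n : ℤ) :
    deriv (deriv γ) (s + n) = deriv (deriv γ) s := by
  have h : (fun t => deriv γ (t + n)) = deriv γ := funext fun t => hγ.deriv_add_int t n
  rw [← deriv_comp_add_const, h]

/-- A collar of the boundary curve of a surface in the ball, parametrised by the distance to the
origin. -/
structure IsRadialCollar (F : Set E4) (γ : ℝ → E4) (ρ : ℝ) (f : ℝ × ℝ → E4) : Prop where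
  pos : 0 < ρ
  lt_one : ρ < 1
  smooth : ContDiffOn ℝ ∞ f (univ ×ˢ Ioc ρ 1)
  periodic : ∀ s r, f (s + 1, r) = f (s, r)
  top : ∀ s, f (s, 1) = γ s
  norm_eq : ∀ s, ∀ r ∈ Ioc ρ 1, ‖f (s, r)‖ = r
  mem : ∀ s, ∀ r ∈ Ioc ρ 1, f (s, r) ∈ F
  simple : ∀ s s', ∀ r ∈ Ioc ρ 1, f (s, r) = f (s', r) → ∃ n : ℤ, s' = s + n
  regular : ∀ s, ∀ r ∈ Ioc ρ 1, deriv (fun s => f (s, r)) s ≠ 0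
  exists_eq : ∀ p ∈ F, ρ < ‖p‖ → ∃ s, f (s, ‖p‖) = p

/-- Uniform versions of the local uniqueness statements. -/
theorem exists_uniform_collar_width (hF : IsNeatSurface F) (hγ : IsKnotParam γ)
    (hK : range γ = F ∩ Metric.sphere 0 1) :
    ∃ δ > 0, ∀ s y z, ‖y - γ s‖ < δ → ‖z - γ s‖ < δ →
      (y ∈ F → z ∈ F → inner ℝ y (deriv γ s) = 0 → inner ℝ z (deriv γ s) = 0 →
        ‖y‖ = ‖z‖ → y = z) ∧
      (inner ℝ y (deriv γ s) = 0 → ∀ s', γ s' = z → inner ℝ y (deriv γ s') = 0 →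
        ∃ n : ℤ, s' = s + n) ∧
      inner ℝ y (deriv (deriv γ) s) ≠ 0 := by
  set P : ℝ × E4 × E4 → Prop := fun z =>
    (z.2.1 ∈ F → z.2.2 ∈ F → inner ℝ z.2.1 (deriv γ z.1) = 0 → inner ℝ z.2.2 (deriv γ z.1) = 0 →
        ‖z.2.1‖ = ‖z.2.2‖ → z.2.1 = z.2.2) ∧
      (inner ℝ z.2.1 (deriv γ z.1) = 0 → ∀ s', γ s' = z.2.2 → inner ℝ z.2.1 (deriv γ s') = 0 →
        ∃ n : ℤ, s' = z.1 + n) ∧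
      inner ℝ z.2.1 (deriv (deriv γ) z.1) ≠ 0 with hP
  have hPev : ∀ s, ∀ᶠ z in 𝓝 (s, γ s, γ s), P z := by
    intro s
    have hc : Continuous fun z : ℝ × E4 × E4 => inner ℝ z.2.1 (deriv (deriv γ) z.1) := by
      have := (KnotConcordance.contDiff_deriv hγ.contDiff_deriv).continuous
      fun_prop
    exact (exists_local_collar hF hγ hK s).1.and ((hγ.eventually_normal_unique s).and
      (hc.continuousAt.eventually_ne (hγ.inner_deriv_deriv s)))
  -- One period is compact, so the local statements hold with a common width; the other parameters
  -- are reduced to it by periodicity.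
  have hcomp : IsCompact ((fun s => (s, γ s, γ s)) '' Icc (0 : ℝ) 1) := by
    have := hγ.smooth.continuous
    exact isCompact_Icc.image (by fun_prop)
  obtain ⟨δ, hδ, hsub⟩ := hcomp.exists_thickening_subset_open
    (isOpen_interior (s := {z | P z})) (by
      rintro _ ⟨s, -, rfl⟩
      exact mem_interior_iff_mem_nhds.2 (hPev s))
  have hbase : ∀ s ∈ Icc (0 : ℝ) 1, ∀ y z, ‖y - γ s‖ < δ → ‖z - γ s‖ < δ → P (s, y, z) := by
    intro s hs y z hy hz
    apply interior_subset (hsub _)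
    rw [Metric.mem_thickening_iff]
    refine ⟨_, ⟨s, hs, rfl⟩, ?_⟩
    rw [Prod.dist_eq, Prod.dist_eq, dist_self, dist_eq_norm, dist_eq_norm]
    exact max_lt hδ (max_lt hy hz)
  refine ⟨δ, hδ, fun s y z hy hz => ?_⟩
  have h1 := hbase (Int.fract s) ⟨Int.fract_nonneg s, (Int.fract_lt_one s).le⟩ y z
  have h2 : s = Int.fract s + (⌊s⌋ : ℤ) := (Int.fract_add_floor s).symm
  have h3 : γ (Int.fract s) = γ s := by
    rw [← hγ.add_int _ ⌊s⌋, ← h2]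
  have h4 : deriv γ (Int.fract s) = deriv γ s := by
    rw [← hγ.deriv_add_int _ ⌊s⌋, ← h2]
  have h5 : deriv (deriv γ) (Int.fract s) = deriv (deriv γ) s := by
    rw [← hγ.deriv_deriv_add_int _ ⌊s⌋, ← h2]
  rw [h3] at h1
  obtain ⟨h6, h7, h8⟩ := h1 hy hz
  simp only [h4, h5] at h6 h7 h8
  refine ⟨h6, fun h9 s' h10 h11 => ?_, h8⟩
  obtain ⟨n, hn⟩ := h7 h9 s' h10 h11
  refine ⟨n - ⌊s⌋, ?_⟩
  rw [hn, Int.fract]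
  push_cast
  ring

/-- The collar point over `(s, r)` is the point of `F` of norm `r` near `γ s` in the hyperplane
normal to the knot at `s`. Since it is unique, it can be chosen pointwise, and it agrees with the
smooth local solutions. -/
theorem exists_radialCollar (hF : IsNeatSurface F) (hγ : IsKnotParam γ)
    (hK : range γ = F ∩ Metric.sphere 0 1) : ∃ ρ f, IsRadialCollar F γ ρ f := by
  obtain ⟨δ, hδ, huniq⟩ := exists_uniform_collar_width hF hγ hK
  -- Half the uniform width: two points of the knot within `ε` of the same collar point are within
  -- `δ` of each other.
  set ε : ℝ := δ / 2 with hε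
  have hε0 : 0 < ε := half_pos hδ
  set Q : ℝ × ℝ → E4 → Prop := fun q y =>
    y ∈ F ∧ inner ℝ y (deriv γ q.1) = 0 ∧ ‖y‖ = q.2 ∧ ‖y - γ q.1‖ < ε with hQ
  set L : ℝ → ℝ → Prop := fun r s => ∃ fl : ℝ × ℝ → E4,
    ∀ᶠ q in 𝓝 (s, r), ContDiffAt ℝ ∞ fl q ∧ (q.2 ≤ 1 → Q q (fl q)) with hL
  have hLev : ∀ s, ∀ᶠ z : ℝ × ℝ in 𝓝 (1, s), L z.1 z.2 := by
    intro s
    obtain ⟨-, fl, hfl1, hfl⟩ := exists_local_collar hF hγ hK s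
    have h1 : ∀ᶠ q in 𝓝 (s, (1 : ℝ)), ‖fl q - γ q.1‖ < ε := by
      have h2 : ContinuousAt (fun q : ℝ × ℝ => ‖fl q - γ q.1‖) (s, 1) :=
        (hfl.self_of_nhds.1.continuousAt.sub
          (hγ.smooth.continuous.comp continuous_fst).continuousAt).norm
      apply h2.eventually_lt_const
      simpa only [hfl1, sub_self, norm_zero] using hε0
    have h3 := (hfl.and h1).eventually_nhds
    have h4 : Tendsto (fun z : ℝ × ℝ => (z.2, z.1)) (𝓝 (1, s)) (𝓝 (s, 1)) :=
      (continuous_snd.prodMk continuous_fst).continuousAt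
    filter_upwards [h4.eventually h3] with z hz
    refine ⟨fl, hz.mono fun q hq => ⟨hq.1.1, fun hq1 => ⟨hq.1.2.2.2 hq1, hq.1.2.1,
      hq.1.2.2.1, hq.2⟩⟩⟩
  -- Compactness of a period turns the neighbourhoods of the points `(1, s)` into one interval of
  -- radii that works for all `s`.
  have hLall := isCompact_Icc.eventually_forall_of_forall_eventually
    (K := Icc (0 : ℝ) 1) (x₀ := (1 : ℝ)) (P := L) fun s _ => hLev s
  have hcov : ∀ᶠ r in 𝓝 (1 : ℝ), ∀ p ∈ F, ‖p‖ = r → p ∈ Metric.thickening ε (range γ) := by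
    have h1 : IsCompact (norm '' (F \ Metric.thickening ε (range γ))) :=
      (hF.compact.diff Metric.isOpen_thickening).image continuous_norm
    have h2 : (1 : ℝ) ∉ norm '' (F \ Metric.thickening ε (range γ)) := by
      rintro ⟨p, ⟨hp, hpt⟩, hp1⟩
      apply hpt
      apply Metric.self_subset_thickening hε0
      rw [hK]
      exact ⟨hp, by rwa [mem_sphere_zero_iff_norm]⟩
    filter_upwards [h1.isClosed.isOpen_compl.mem_nhds h2] with r hr p hp hpr
    by_contra hpt
    exact hr ⟨p, ⟨hp, hpt⟩, hpr⟩
  obtain ⟨l, hl1, hl⟩ := exists_Ioc_subset_of_mem_nhds (hLall.and hcov)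
    ⟨0, zero_lt_one⟩
  set ρ : ℝ := max l (1 / 2) with hρ
  have hρ1 : ρ < 1 := max_lt hl1 (by norm_num)
  have hρ0 : 0 < ρ := lt_of_lt_of_le (by norm_num) (le_max_right _ _)
  have hlρ : ∀ r ∈ Ioc ρ 1, r ∈ Ioc l 1 := fun r hr => ⟨(le_max_left _ _).trans_lt hr.1, hr.2⟩
  have hLs : ∀ s, ∀ r ∈ Ioc ρ 1, L r s := by
    intro s r hr
    obtain ⟨fl, hfl⟩ := (hl (hlρ r hr)).1 (Int.fract s)
      ⟨Int.fract_nonneg s, (Int.fract_lt_one s).le⟩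
    refine ⟨fun q => fl (q.1 - (⌊s⌋ : ℤ), q.2), ?_⟩
    have h1 : ContDiff ℝ ∞ fun q : ℝ × ℝ => (q.1 - (⌊s⌋ : ℤ), q.2) := by fun_prop
    have h2 : ∀ᶠ q : ℝ × ℝ in 𝓝 (s, r), _ := h1.continuous.continuousAt.eventually hfl
    filter_upwards [h2] with q hq
    refine ⟨hq.1.comp q h1.contDiffAt, fun hq1 => ?_⟩
    have h3 := hq.2 hq1
    have h4 := hγ.add_int (q.1 - (⌊s⌋ : ℤ)) ⌊s⌋
    have h5 := hγ.deriv_add_int (q.1 - (⌊s⌋ : ℤ)) ⌊s⌋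
    rw [sub_add_cancel] at h4 h5
    simp only [hQ] at h3 ⊢
    rwa [h4, h5]
  set f : ℝ × ℝ → E4 := fun q => Classical.epsilon (Q q) with hf
  have hfQ : ∀ s, ∀ r ∈ Ioc ρ 1, Q (s, r) (f (s, r)) := by
    intro s r hr
    obtain ⟨fl, hfl⟩ := hLs s r hr
    exact Classical.epsilon_spec ⟨_, hfl.self_of_nhds.2 hr.2⟩
  have hQu : ∀ q y z, Q q y → Q q z → y = z := by
    intro q y z hy hz
    exact (huniq q.1 y z (hy.2.2.2.trans (half_lt_self hδ))
      (hz.2.2.2.trans (half_lt_self hδ))).1 hy.1 hz.1 hy.2.1 hz.2.1 (hy.2.2.1.trans hz.2.2.1.symm)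
  have hsmooth : ContDiffOn ℝ ∞ f (univ ×ˢ Ioc ρ 1) := by
    rintro ⟨s, r⟩ ⟨-, hr⟩
    obtain ⟨fl, hfl⟩ := hLs s r hr
    refine hfl.self_of_nhds.1.contDiffWithinAt.congr_of_eventuallyEq ?_
      (hQu _ _ _ (hfQ s r hr) (hfl.self_of_nhds.2 hr.2))
    filter_upwards [nhdsWithin_le_nhds hfl, self_mem_nhdsWithin] with q hq hqm
    exact hQu q _ _ (hfQ q.1 q.2 hqm.2) (hq.2 hqm.2.2)
  refine ⟨ρ, f, hρ0, hρ1, hsmooth, ?_, ?_, fun s r hr => (hfQ s r hr).2.2.1,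
    fun s r hr => (hfQ s r hr).1, ?_, ?_, ?_⟩
  · intro s r
    have h1 := hγ.add_int s 1
    have h2 := hγ.deriv_add_int s 1
    rw [Int.cast_one] at h1 h2
    simp only [hf, hQ, h1, h2]
  · intro s
    apply hQu (s, 1) _ _ (hfQ s 1 ⟨hρ1, le_rfl⟩)
    exact ⟨(hK.subset ⟨s, rfl⟩).1, hγ.inner_deriv s, hγ.mem_sphere s, by simpa using hε0⟩
  · intro s s' r hr h
    have h1 := hfQ s r hr
    have h2 := hfQ s' r hr
    rw [← h] at h2
    refine (huniq s (f (s, r)) (γ s') (h1.2.2.2.trans (half_lt_self hδ)) ?_).2.1 h1.2.1 s' rfl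
      h2.2.1
    calc ‖γ s' - γ s‖ = ‖(f (s, r) - γ s) - (f (s, r) - γ s')‖ := by congr 1; abel
      _ ≤ ‖f (s, r) - γ s‖ + ‖f (s, r) - γ s'‖ := norm_sub_le _ _
      _ < ε + ε := add_lt_add h1.2.2.2 h2.2.2.2
      _ = δ := add_halves δ
  · intro s r hr h0
    have h1 := hfQ s r hr
    have h2 : DifferentiableAt ℝ (fun s => f (s, r)) s := by
      have h3 : ContDiffOn ℝ ∞ (fun s => f (s, r)) univ :=
        hsmooth.comp (by fun_prop) fun s _ => ⟨mem_univ _, hr⟩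
      exact (h3.differentiableOn (by simp)).differentiableAt univ_mem
    have h3 := h2.hasDerivAt.inner ℝ (hγ.hasDerivAt_deriv s)
    have h4 : (fun s => inner ℝ (f (s, r)) (deriv γ s)) = fun _ => (0 : ℝ) :=
      funext fun t => (hfQ t r hr).2.1
    rw [h4, h0, inner_zero_left, add_zero] at h3
    exact (huniq s (f (s, r)) (f (s, r)) (h1.2.2.2.trans (half_lt_self hδ))
      (h1.2.2.2.trans (half_lt_self hδ))).2.2 (h3.unique (hasDerivAt_const s (0 : ℝ)))
  · intro p hp hpρ
    have hp1 : ‖p‖ ≤ 1 := mem_closedBall_zero_iff.1 (hF.subset_ball hp)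
    have h1 := (hl (hlρ _ ⟨hpρ, hp1⟩)).2 p hp rfl
    rw [Metric.mem_thickening_iff] at h1
    obtain ⟨_, ⟨s₀, rfl⟩, hs₀⟩ := h1
    -- A nearest point of the knot to `p` makes the squared distance stationary, which says that `p`
    -- lies in the normal hyperplane there.
    have h2 : Continuous fun s => ‖p - γ s‖ ^ 2 := by
      have := hγ.smooth.continuous
      fun_prop
    obtain ⟨s, -, hs⟩ := isCompact_Icc.exists_isMinOn
      (nonempty_Icc.2 (zero_le_one (α := ℝ))) h2.continuousOn
    have h3 : ∀ s', ‖p - γ s‖ ^ 2 ≤ ‖p - γ s'‖ ^ 2 := by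
      intro s'
      have h4 : ‖p - γ s‖ ^ 2 ≤ ‖p - γ (Int.fract s')‖ ^ 2 :=
        hs (show Int.fract s' ∈ Icc (0 : ℝ) 1 from
          ⟨Int.fract_nonneg s', (Int.fract_lt_one s').le⟩)
      rwa [← hγ.add_int (Int.fract s') ⌊s'⌋, Int.fract_add_floor] at h4
    have h4 : HasDerivAt (fun s => p - γ s) (0 - deriv γ s) s :=
      (hasDerivAt_const s p).sub (hγ.hasDerivAt s)
    have h5 := h4.norm_sq
    have h6 := (show IsLocalMin (fun s => ‖p - γ s‖ ^ 2) s from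
      Eventually.of_forall h3).hasDerivAt_eq_zero h5
    have h7 : inner ℝ p (deriv γ s) = 0 := by
      rw [zero_sub, inner_neg_right, inner_sub_left, hγ.inner_deriv] at h6
      linarith
    refine ⟨s, hQu _ _ _ (hfQ s ‖p‖ ⟨hpρ, hp1⟩) ⟨hp, h7, rfl, ?_⟩⟩
    refine lt_of_le_of_lt ?_ (dist_eq_norm p (γ s₀) ▸ hs₀)
    exact (sq_le_sq₀ (norm_nonneg _) (norm_nonneg _)).1 (h3 s₀)

end RadialCollar

/-! ### Exchanging a collar: topology -/

section Exchange

/-- A continuous map from a compact space to a Hausdorff space is closed, hence a quotient map onto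
its image. -/
theorem continuousOn_image_of_comp {X Y W : Type*} [TopologicalSpace X] [TopologicalSpace Y]
    [TopologicalSpace W] [T2Space Y] {Z : Set X} (hZ : IsCompact Z) {f : X → Y} {θ : Y → W}
    (hf : ContinuousOn f Z) (hθ : ContinuousOn (θ ∘ f) Z) : ContinuousOn θ (f '' Z) := by
  rw [continuousOn_iff_isClosed]
  intro C hC
  obtain ⟨D, hD, hDZ⟩ := continuousOn_iff_isClosed.1 hθ C hC
  refine ⟨f '' (Z ∩ D), ((hZ.inter_right hD).image_of_continuousOn
    (hf.mono inter_subset_left)).isClosed, ?_⟩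
  ext y
  constructor
  · rintro ⟨h1, x, hx, rfl⟩
    have h2 : x ∈ (θ ∘ f) ⁻¹' C ∩ Z := ⟨h1, hx⟩
    rw [hDZ] at h2
    exact ⟨⟨x, ⟨hx, h2.1⟩, rfl⟩, x, hx, rfl⟩
  · rintro ⟨⟨x, ⟨hx, hxD⟩, rfl⟩, -⟩
    have h2 : x ∈ D ∩ Z := ⟨hxD, hx⟩
    rw [← hDZ] at h2
    exact ⟨h2.1, x, hx, rfl⟩

/-- `f` embeds a closed annulus (a strip modulo translation) that is attached to `A` along its
lower boundary and otherwise lies outside the ball of radius `a`. -/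
structure IsCollarMap (A : Set E4) (a : ℝ) (f : ℝ × ℝ → E4) : Prop where
  continuousOn : ContinuousOn f (univ ×ˢ Icc a 1)
  periodic : ∀ s t, f (s + 1, t) = f (s, t)
  injective : ∀ s s', ∀ t ∈ Icc a 1, ∀ t' ∈ Icc a 1, f (s, t) = f (s', t') →
    t = t' ∧ ∃ n : ℤ, s' = s + n
  mem : ∀ s, f (s, a) ∈ A
  lt_norm : ∀ s, ∀ t ∈ Ioc a 1, a < ‖f (s, t)‖

variable {A : Set E4} {a : ℝ} {f f' : ℝ × ℝ → E4}

theorem IsCollarMap.add_int (hf : IsCollarMap A a f) (s t : ℝ) (n : ℤ) :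
    f (s + n, t) = f (s, t) := by
  have h : Function.Periodic (fun s => f (s, t)) 1 := fun s => hf.periodic s t
  simpa using h.int_mul n s

theorem IsCollarMap.image_eq (hf : IsCollarMap A a f) :
    f '' (univ ×ˢ Icc a 1) = f '' (Icc 0 1 ×ˢ Icc a 1) := by
  apply Subset.antisymm
  · rintro _ ⟨⟨s, t⟩, ⟨-, ht⟩, rfl⟩
    refine ⟨(Int.fract s, t), ⟨⟨Int.fract_nonneg s, (Int.fract_lt_one s).le⟩, ht⟩, ?_⟩
    rw [← hf.add_int (Int.fract s) t ⌊s⌋, Int.fract_add_floor]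
  · exact image_mono (prod_mono_left (subset_univ _))

theorem IsCollarMap.isCompact (hf : IsCollarMap A a f) : IsCompact (f '' (univ ×ˢ Icc a 1)) := by
  rw [hf.image_eq]
  exact (isCompact_Icc.prod isCompact_Icc).image_of_continuousOn
    (hf.continuousOn.mono (prod_mono_left (subset_univ _)))

/-- Maps out of `A` and out of the collar that agree on the common boundary fit together. -/
theorem IsCollarMap.exists_glue {W : Type*} [TopologicalSpace W] [Nonempty W]
    (hf : IsCollarMap A a f) (hA : IsClosed A) (hAa : ∀ p ∈ A, ‖p‖ ≤ a)
    {u : E4 → W} {v : ℝ × ℝ → W} (hu : ContinuousOn u A) (hv : ContinuousOn v (univ ×ˢ Icc a 1))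
    (hvp : ∀ s t, v (s + 1, t) = v (s, t)) (huv : ∀ s, u (f (s, a)) = v (s, a)) :
    ∃ θ : E4 → W, ContinuousOn θ (A ∪ f '' (univ ×ˢ Icc a 1)) ∧ (∀ p ∈ A, θ p = u p) ∧
      ∀ s, ∀ t ∈ Icc a 1, θ (f (s, t)) = v (s, t) := by
  classical
  have hvn : ∀ s t (n : ℤ), v (s + n, t) = v (s, t) := by
    intro s t n
    have h : Function.Periodic (fun s => v (s, t)) 1 := fun s => hvp s t
    simpa using h.int_mul n s
  have hinv : ∀ p, ∃ w, ∀ s, ∀ t ∈ Icc a 1, f (s, t) = p → v (s, t) = w := by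
    intro p
    by_cases hp : p ∈ f '' (univ ×ˢ Icc a 1)
    · obtain ⟨⟨s, t⟩, ⟨-, ht⟩, rfl⟩ := hp
      refine ⟨v (s, t), fun s' t' ht' h => ?_⟩
      obtain ⟨rfl, n, rfl⟩ := hf.injective _ _ _ ht' _ ht h
      rw [hvn]
    · exact ⟨Classical.arbitrary W, fun s t ht h => (hp ⟨(s, t), ⟨mem_univ _, ht⟩, h⟩).elim⟩
  choose w hw using hinv
  have hθA : ∀ p ∈ A, (if p ∈ A then u p else w p) = u p := fun p hp => if_pos hp
  have hθf : ∀ s, ∀ t ∈ Icc a 1,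
      (if f (s, t) ∈ A then u (f (s, t)) else w (f (s, t))) = v (s, t) := by
    intro s t ht
    split_ifs with h
    · have hta : t = a := by
        by_contra hne
        exact absurd (hAa _ h) (not_le.2 (hf.lt_norm s t ⟨lt_of_le_of_ne ht.1 (Ne.symm hne), ht.2⟩))
      rw [hta, huv]
    · exact (hw _ s t ht rfl).symm
  refine ⟨fun p => if p ∈ A then u p else w p, ?_, hθA, hθf⟩
  refine ContinuousOn.union_of_isClosed (hu.congr hθA) ?_ hA hf.isCompact.isClosed
  rw [hf.image_eq]
  have hsub : Icc (0 : ℝ) 1 ×ˢ Icc a 1 ⊆ univ ×ˢ Icc a 1 := prod_mono_left (subset_univ _)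
  exact continuousOn_image_of_comp (isCompact_Icc.prod isCompact_Icc) (hf.continuousOn.mono hsub)
    ((hv.mono hsub).congr fun q hq => hθf q.1 q.2 hq.2)

/-- The identity of `A` and the exchange of collar coordinates glue, in both directions. -/
theorem IsCollarMap.exists_homeomorph (hf : IsCollarMap A a f) (hf' : IsCollarMap A a f')
    (hA : IsClosed A) (hAa : ∀ p ∈ A, ‖p‖ ≤ a) (hff : ∀ s, f (s, a) = f' (s, a)) :
    Nonempty ((A ∪ f '' (univ ×ˢ Icc a 1) : Set E4) ≃ₜ (A ∪ f' '' (univ ×ˢ Icc a 1) : Set E4)) := by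
  obtain ⟨θ, hθ, hθA, hθf⟩ := hf.exists_glue hA hAa continuousOn_id hf'.continuousOn hf'.periodic
    fun s => hff s
  obtain ⟨ψ, hψ, hψA, hψf⟩ := hf'.exists_glue hA hAa continuousOn_id hf.continuousOn hf.periodic
    fun s => (hff s).symm
  have key : ∀ {f f' : ℝ × ℝ → E4} {θ ψ : E4 → E4}, (∀ p ∈ A, θ p = id p) →
      (∀ s, ∀ t ∈ Icc a 1, θ (f (s, t)) = f' (s, t)) → (∀ p ∈ A, ψ p = id p) →
      (∀ s, ∀ t ∈ Icc a 1, ψ (f' (s, t)) = f (s, t)) →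
      ∀ p ∈ A ∪ f '' (univ ×ˢ Icc a 1), θ p ∈ A ∪ f' '' (univ ×ˢ Icc a 1) ∧ ψ (θ p) = p := by
    rintro f f' θ ψ h1 h2 h3 h4 p (hp | ⟨⟨s, t⟩, ⟨hs, ht⟩, rfl⟩)
    · rw [h1 p hp]
      exact ⟨Or.inl hp, h3 p hp⟩
    · rw [h2 s t ht]
      exact ⟨Or.inr ⟨_, ⟨hs, ht⟩, rfl⟩, h4 s t ht⟩
  have k1 := key hθA hθf hψA hψf
  have k2 := key hψA hψf hθA hθf
  exact ⟨{
    toFun := fun p => ⟨θ p, (k1 p p.2).1⟩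
    invFun := fun p => ⟨ψ p, (k2 p p.2).1⟩
    left_inv := fun p => Subtype.ext (k1 p p.2).2
    right_inv := fun p => Subtype.ext (k2 p p.2).2
    continuous_toFun := (continuousOn_iff_continuous_domRestrict.1 hθ).subtype_mk _
    continuous_invFun := (continuousOn_iff_continuous_domRestrict.1 hψ).subtype_mk _ }⟩

theorem isConnected_of_homeomorph {F F' : Set E4} (e : F ≃ₜ F') (h : IsConnected F) :
    IsConnected F' := by
  rw [isConnected_iff_connectedSpace] at h ⊢
  exact e.surjective.connectedSpace e.continuous

theorem firstBetti_eq_of_homeomorph {F F' : Set E4} (e : F ≃ₜ F') : firstBetti F = firstBetti F' :=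
  (((((AlgebraicTopology.singularHomologyFunctor (ModuleCat.{0} ℚ) 1).obj
    (ModuleCat.of ℚ ℚ)).mapIso (TopCat.isoOfHomeo
      (show TopCat.of F ≃ₜ TopCat.of F' from e)))).toLinearEquiv).finrank_eq

end Exchange

/-! ### Local equations of an immersed surface -/

section Straightening

/-- Adding a complement of the tangent plane to the parameters extends `f` to a local diffeomorphism
onto space. The complementary coordinate of its inverse cuts out the surface. -/
theorem exists_local_equation {f : ℝ × ℝ → E4} {z : ℝ × ℝ} (hf : ∀ᶠ q in 𝓝 z, ContDiffAt ℝ ∞ f q)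
    (hz : Function.Injective (fderiv ℝ f z)) {N : Set (ℝ × ℝ)} (hN : N ∈ 𝓝 z) :
    ∃ G : E4 → E2, (∀ᶠ y in 𝓝 (f z), ContDiffAt ℝ ∞ G y) ∧
      (∃ V ∈ 𝓝 z, V ⊆ N ∧ ∀ᶠ y in 𝓝 (f z), G y = 0 ↔ y ∈ f '' V) ∧
      Function.Surjective (fderiv ℝ G (f z)) ∧ ∀ v, fderiv ℝ G (f z) (fderiv ℝ f z v) = 0 := by
  have hfd : HasFDerivAt f (fderiv ℝ f z) z :=
    (hf.self_of_nhds.differentiableAt (by simp)).hasFDerivAt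
  obtain ⟨C, hC⟩ := Submodule.exists_isCompl (LinearMap.range (fderiv ℝ f z : ℝ × ℝ →ₗ[ℝ] E4))
  have hdim : Module.finrank ℝ C = Module.finrank ℝ E2 := by
    have h1 := Submodule.finrank_add_eq_of_isCompl hC
    rw [LinearMap.finrank_range_of_inj hz] at h1
    simp only [Module.finrank_prod, finrank_euclideanSpace, Fintype.card_fin,
        Module.finrank_self] at h1 ⊢
    omega
  let e : E2 ≃ₗ[ℝ] C := (LinearEquiv.ofFinrankEq C E2 hdim).symm
  let L : E2 →L[ℝ] E4 := LinearMap.toContinuousLinearMap (C.subtype ∘ₗ (e : E2 →ₗ[ℝ] C))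
  have hL : ∀ w, L w = (e w : E4) := fun w => rfl
  set Ψ : (ℝ × ℝ) × E2 → E4 := fun q => f q.1 + L q.2 with hΨ
  have hΨz : Ψ (z, 0) = f z := by simp [hΨ]
  have hfst : ∀ᶠ q : (ℝ × ℝ) × E2 in 𝓝 (z, 0), ContDiffAt ℝ ∞ f q.1 :=
    continuous_fst.continuousAt.eventually hf
  have hΨs : ∀ᶠ q in 𝓝 (z, (0 : E2)), ContDiffAt ℝ ∞ Ψ q := by
    filter_upwards [hfst] with q hq
    exact (hq.comp q contDiffAt_fst).add (L.contDiff.contDiffAt.comp q contDiffAt_snd)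
  have hΨd : HasFDerivAt Ψ ((fderiv ℝ f z).comp (ContinuousLinearMap.fst ℝ (ℝ × ℝ) E2) +
      L.comp (ContinuousLinearMap.snd ℝ (ℝ × ℝ) E2)) (z, 0) := by
    have h1 : HasFDerivAt f (fderiv ℝ f z) ((z, 0) : (ℝ × ℝ) × E2).1 := hfd
    exact (h1.comp (z, (0 : E2)) (hasFDerivAt_fst (𝕜 := ℝ))).add
      (L.hasFDerivAt.comp (z, (0 : E2)) (hasFDerivAt_snd (𝕜 := ℝ)))
  have hbij : Function.Bijective (fderiv ℝ Ψ (z, 0)) := by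
    have h4 : Function.Injective (fderiv ℝ Ψ (z, 0)) := by
      rw [hΨd.fderiv, injective_iff_map_eq_zero]
      rintro ⟨u, w⟩ huw
      have h1 : fderiv ℝ f z u + L w = 0 := huw
      have h2 : (fderiv ℝ f z u) ∈ C := by
        rw [eq_neg_of_add_eq_zero_left h1, hL]
        exact C.neg_mem (e w).2
      have h3 := Submodule.disjoint_def.1 hC.disjoint _ ⟨u, rfl⟩ h2
      have h5 : u = 0 := (injective_iff_map_eq_zero _).1 hz u h3
      have h3' : fderiv ℝ f z u = 0 := h3
      rw [h3', zero_add, hL] at h1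
      have h6 : w = 0 := by
        have : e w = 0 := Subtype.ext h1
        exact e.map_eq_zero_iff.1 this
      rw [h5, h6]
      rfl
    have h5 : Module.finrank ℝ ((ℝ × ℝ) × E2) = Module.finrank ℝ E4 := by
      simp only [Module.finrank_prod, finrank_euclideanSpace, Fintype.card_fin,
        Module.finrank_self]
    exact ⟨h4, (LinearMap.injective_iff_surjective_of_finrank_eq_finrank
      (f := (fderiv ℝ Ψ (z, 0) : ((ℝ × ℝ) × E2) →ₗ[ℝ] _)) h5).1 h4⟩
  obtain ⟨g, hg, hgΨ, hΨg⟩ := exists_local_inverse hΨs hbij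
  rw [hΨz] at hg hΨg
  have hgz : g (f z) = (z, 0) := by
    rw [← hΨz]
    exact hgΨ.self_of_nhds
  have hgc : ContinuousAt g (f z) := hg.self_of_nhds.continuousAt
  have hj : Continuous fun q : ℝ × ℝ => (q, (0 : E2)) := by fun_prop
  have hgf : ∀ᶠ q in 𝓝 z, g (f q) = (q, 0) := by
    filter_upwards [hj.continuousAt.eventually hgΨ] with q hq
    simpa [hΨ] using hq
  refine ⟨fun y => (g y).2, ?_, ?_, ?_, ?_⟩
  · filter_upwards [hg] with y hy
    exact contDiffAt_snd.comp y hy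
  · refine ⟨_, inter_mem hN hgf, inter_subset_left, ?_⟩
    have h1 : ∀ᶠ y in 𝓝 (f z), (g y).1 ∈ N ∩ {q | g (f q) = (q, 0)} := by
      have h2 : Tendsto (fun y => (g y).1) (𝓝 (f z)) (𝓝 z) := by
        have := (continuous_fst.continuousAt (x := g (f z))).comp hgc
        rwa [ContinuousAt, Function.comp_apply, hgz] at this
      exact h2 (inter_mem hN hgf)
    filter_upwards [hΨg, h1] with y hy hy1
    constructor
    · intro h0
      refine ⟨(g y).1, hy1, ?_⟩
      have h2 : f (g y).1 + L (g y).2 = y := hy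
      rwa [h0, map_zero, add_zero] at h2
    · rintro ⟨q, hq, rfl⟩
      exact congrArg Prod.snd hq.2
  · have hgd : HasFDerivAt (fun y => (g y).2) (fderiv ℝ (fun y => (g y).2) (f z)) (Ψ (z, 0)) := by
      rw [hΨz]
      exact (contDiffAt_snd.comp (f z) hg.self_of_nhds).differentiableAt (by simp) |>.hasFDerivAt
    have h1 := hgd.comp (z, (0 : E2)) hΨd
    have h2 : (fun y => (g y).2) ∘ Ψ =ᶠ[𝓝 (z, 0)] Prod.snd := hgΨ.mono fun q hq =>
      congrArg Prod.snd hq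
    have h3 := h1.unique ((hasFDerivAt_snd (𝕜 := ℝ)).congr_of_eventuallyEq h2)
    intro w
    exact ⟨L w, by simpa using DFunLike.congr_fun h3 ((0 : ℝ × ℝ), w)⟩
  · have hgd : HasFDerivAt (fun y => (g y).2) (fderiv ℝ (fun y => (g y).2) (f z)) (f z) :=
      (contDiffAt_snd.comp (f z) hg.self_of_nhds).differentiableAt (by simp) |>.hasFDerivAt
    have h1 := hgd.comp z hfd
    have h2 : (fun y => (g y).2) ∘ f =ᶠ[𝓝 z] fun _ => 0 := hgf.mono fun q hq =>
      congrArg Prod.snd hq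
    have h3 := h1.unique ((hasFDerivAt_const (0 : E2) z).congr_of_eventuallyEq h2)
    exact fun v => DFunLike.congr_fun h3 v

end Straightening

/-! ### Area forms -/

section AreaForm

/-- The area form of the plane. -/
def planeArea : (ℝ × ℝ) [⋀^Fin 2]→L[ℝ] ℝ where
  toFun m := (m 0).1 * (m 1).2 - (m 0).2 * (m 1).1
  map_update_add' m i x y := by
    fin_cases i <;> simp <;> ring
  map_update_smul' m i c x := by
    fin_cases i <;> simp <;> ring
  map_eq_zero_of_eq' m i j h hij := by
    fin_cases i <;> fin_cases j <;> simp_all <;> ring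
  cont := by fun_prop

/-- The alternating form on space that pairs with the images of the two basis vectors. -/
def areaForm (T : ℝ × ℝ →L[ℝ] E4) : E4 [⋀^Fin 2]→L[ℝ] ℝ :=
  ContinuousAlternatingMap.compContinuousLinearMapCLM
    ((innerSL ℝ (T (1, 0))).prod (innerSL ℝ (T (0, 1)))) planeArea

theorem areaForm_apply (T : ℝ × ℝ →L[ℝ] E4) (u v : E4) : areaForm T ![u, v] =
    inner ℝ (T (1, 0)) u * inner ℝ (T (0, 1)) v - inner ℝ (T (0, 1)) u * inner ℝ (T (1, 0)) v :=
  rfl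

theorem continuous_areaForm : Continuous areaForm := by
  have h1 : Continuous fun T : ℝ × ℝ →L[ℝ] E4 =>
      (innerSL ℝ (T (1, 0))).prod (innerSL ℝ (T (0, 1))) := by
    have h2 : ∀ v : ℝ × ℝ, Continuous fun T : ℝ × ℝ →L[ℝ] E4 => innerSL ℝ (T v) := fun v =>
      (innerSL ℝ).continuous.comp (ContinuousLinearMap.apply ℝ E4 v).continuous
    exact (ContinuousLinearMap.prodₗᵢ ℝ).continuous.comp ((h2 _).prodMk (h2 _))
  exact (ContinuousAlternatingMap.continuous_compContinuousLinearMapCLM.comp h1).clm_apply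
    continuous_const

/-- The value is the Gram determinant of two independent vectors. -/
theorem areaForm_pos {T : ℝ × ℝ →L[ℝ] E4} (hT : Function.Injective T) :
    0 < areaForm T ![T (1, 0), T (0, 1)] := by
  rw [areaForm_apply]
  set u := T (1, 0) with hu
  set v := T (0, 1) with hv
  have hu0 : u ≠ 0 := fun h => by
    have h1 := (injective_iff_map_eq_zero T).1 hT _ h
    exact one_ne_zero (congrArg Prod.fst h1)
  have huu : 0 < inner ℝ u u := real_inner_self_pos.2 hu0
  -- This vector is a positive multiple of the component of `v` orthogonal to `u`. Its squared norm
  -- is `inner ℝ u u` times the Gram determinant.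
  have hw : inner ℝ u u • v - inner ℝ u v • u ≠ 0 := fun h => by
    rw [hu, hv, ← map_smul, ← map_smul, ← map_sub] at h
    have h1 := (injective_iff_map_eq_zero T).1 hT _ h
    have h2 := congrArg Prod.snd h1
    simp at h2
    exact hu0 h2
  have h1 := real_inner_self_pos.2 hw
  simp only [inner_sub_left, inner_sub_right, inner_smul_left, inner_smul_right,
    real_inner_comm u v, conj_trivial] at h1
  have h2 : 0 < inner ℝ u u * (inner ℝ u u * inner ℝ v v - inner ℝ u v * inner ℝ u v) := by
    linarith
  rw [real_inner_comm u v]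
  exact (pos_iff_pos_of_mul_pos h2).1 huu

/-- Pulled back to the plane, `η` is a multiple of the determinant, with its value on the standard
basis as the factor. -/
theorem alternating_ne_zero_of_mem_range {T : ℝ × ℝ →L[ℝ] E4} {η : E4 [⋀^Fin 2]→L[ℝ] ℝ} {u v : E4}
    (hu : u ∈ LinearMap.range (T : ℝ × ℝ →ₗ[ℝ] E4)) (hv : v ∈ LinearMap.range (T : ℝ × ℝ →ₗ[ℝ] E4))
    (h : η ![u, v] ≠ 0) : η ![T (1, 0), T (0, 1)] ≠ 0 := by
  obtain ⟨α, rfl⟩ := hu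
  obtain ⟨β, rfl⟩ := hv
  intro h0
  apply h
  have h1 := (η.compContinuousLinearMap T).toAlternatingMap.eq_smul_basis_det
    (Module.Basis.finTwoProd ℝ)
  have h2 : (η.compContinuousLinearMap T).toAlternatingMap (Module.Basis.finTwoProd ℝ) = 0 := by
    rw [← h0]
    show η _ = _
    congr 1
    ext1 i
    fin_cases i <;> simp
  rw [h2, zero_smul] at h1
  have h3 := DFunLike.congr_fun h1 ![α, β]
  rw [AlternatingMap.zero_apply] at h3
  rw [← h3]
  show _ = η _
  congr 1
  ext1 i
  fin_cases i <;> rfl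

end AreaForm

/-! ### Tangent planes -/

section TangentPlane

theorem tangentPlane_congr {F F' : Set E4} {p : E4} (h : 𝓝[F] p = 𝓝[F'] p) :
    tangentPlane F p = tangentPlane F' p := by
  rw [tangentPlane, tangentPlane, tangentConeAt_congr h]

/-- Tangent cones map to tangent cones. In finite dimension, unique differentiability means that the
cone of the parameter domain spans everything; this also covers parameters on the boundary. -/
theorem mem_tangentPlane_of_parametrization {F : Set E4} {S : Set (ℝ × ℝ)} {f : ℝ × ℝ → E4}
    {q : ℝ × ℝ} (hS : UniqueDiffWithinAt ℝ S q) (hf : DifferentiableAt ℝ f q)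
    (hSF : MapsTo f S F) (v : ℝ × ℝ) : fderiv ℝ f q v ∈ tangentPlane F (f q) := by
  have h1 : Submodule.span ℝ (tangentConeAt ℝ S q) = ⊤ := by
    rw [← (Submodule.closed_of_finiteDimensional
      (Submodule.span ℝ (tangentConeAt ℝ S q))).submodule_topologicalClosure_eq]
    exact (Submodule.dense_iff_topologicalClosure_eq_top).1 hS.dense_tangentConeAt
  have h2 : v ∈ Submodule.span ℝ (tangentConeAt ℝ S q) := h1 ▸ Submodule.mem_top
  have h3 := hf.hasFDerivAt.hasFDerivWithinAt (s := S)
  have h4 := Submodule.mem_map_of_mem (f := (fderiv ℝ f q : ℝ × ℝ →ₗ[ℝ] E4)) h2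
  rw [Submodule.map_span] at h4
  refine Submodule.span_mono ?_ h4
  rintro _ ⟨w, hw, rfl⟩
  exact tangentConeAt_mono hSF.image_subset (h3.mapsTo_tangent_cone hw)

/-- Both planes are compared with the kernel of the differential of the local equation: it contains
the range of the parametrisation and equals it by dimension, and it contains the tangent cone. -/
theorem IsNeatSurface.tangentPlane_le_range {F : Set E4} (hF : IsNeatSurface F) {f : ℝ × ℝ → E4}
    {q : ℝ × ℝ} (hf : DifferentiableAt ℝ f q) (hinj : Function.Injective (fderiv ℝ f q))
    (hfF : ∀ᶠ q' in 𝓝 q, f q' ∈ F) :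
    tangentPlane F (f q) ≤ LinearMap.range (fderiv ℝ f q : ℝ × ℝ →ₗ[ℝ] E4) := by
  obtain ⟨U, G, hU, hpU, hG, hUF, hsurj, -⟩ := hF.local_equation _ hfF.self_of_nhds
  have hGd : HasFDerivAt G (fderiv ℝ G (f q)) (f q) :=
    ((hG.contDiffAt (hU.mem_nhds hpU)).differentiableAt (by simp)).hasFDerivAt
  set N := LinearMap.ker (fderiv ℝ G (f q) : E4 →ₗ[ℝ] E2) with hN
  have h1 : LinearMap.range (fderiv ℝ f q : ℝ × ℝ →ₗ[ℝ] E4) ≤ N := by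
    rintro _ ⟨v, rfl⟩
    have h2 := hGd.comp q hf.hasFDerivAt
    have h3 : G ∘ f =ᶠ[𝓝 q] fun _ => 0 := by
      filter_upwards [hfF, hf.continuousAt.eventually (hU.mem_nhds hpU)] with q' h4 h5
      exact ((hUF _ h5).1 h4).2
    exact DFunLike.congr_fun (h2.unique ((hasFDerivAt_const (0 : E2) q).congr_of_eventuallyEq h3)) v
  have h2 : Module.finrank ℝ N = 2 := by
    have h3 : _ + Module.finrank ℝ N = _ :=
      LinearMap.finrank_range_add_finrank_ker (fderiv ℝ G (f q) : E4 →ₗ[ℝ] E2)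
    rw [LinearMap.range_eq_top.2 hsurj, finrank_top] at h3
    simp only [finrank_euclideanSpace, Fintype.card_fin] at h3
    omega
  have h3 : Module.finrank ℝ (LinearMap.range (fderiv ℝ f q : ℝ × ℝ →ₗ[ℝ] E4)) = 2 := by
    rw [LinearMap.finrank_range_of_inj hinj]
    simp only [Module.finrank_prod, Module.finrank_self]
  rw [Submodule.eq_of_le_of_finrank_eq h1 (h3.trans h2.symm), tangentPlane, Submodule.span_le]
  intro w hw
  have h5 : w ∈ tangentConeAt ℝ (F ∩ U) (f q) := by
    rwa [tangentConeAt_congr (nhdsWithin_inter_of_mem' (nhdsWithin_le_nhds (hU.mem_nhds hpU)))]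
  have h6 := (hGd.hasFDerivWithinAt (s := F ∩ U)).mapsTo_tangent_cone h5
  have h7 : G '' (F ∩ U) ⊆ {0} := by
    rintro _ ⟨y, ⟨hy, hyU⟩, rfl⟩
    exact ((hUF y hyU).1 hy).2
  have h8 := tangentConeAt_mono h7 h6
  rw [((hUF _ hpU).1 hfF.self_of_nhds).2] at h8
  refine tangentConeAt_subset_zero (𝕜 := ℝ) ?_ h8
  rw [accPt_principal_iff_nhdsWithin, sdiff_self, nhdsWithin_empty]
  exact fun h => h.ne rfl

end TangentPlane

/-! ### Exchanging a collar: smooth structure and orientation -/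

section SmoothExchange

/-- A smooth, neat collar of an inner part `A` of a surface in the ball. -/
structure IsNeatCollar (A : Set E4) (ρ a : ℝ) (f : ℝ × ℝ → E4) : Prop extends
    IsCollarMap A a f where
  smooth : ContDiffOn ℝ ∞ f (univ ×ˢ Ioi ρ)
  immersion : ∀ s, ∀ t ∈ Icc a 1, Function.Injective (fderiv ℝ f (s, t))
  norm_lt : ∀ s, ∀ t ∈ Ico a 1, ‖f (s, t)‖ < 1
  norm_eq : ∃ c < 1, ∀ s t, c < t → ‖f (s, t)‖ = t

variable {A : Set E4} {ρ a b : ℝ} {f f' : ℝ × ℝ → E4}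

theorem IsNeatCollar.contDiffAt (hf : IsNeatCollar A ρ a f) {q : ℝ × ℝ} (hq : ρ < q.2) :
    ContDiffAt ℝ ∞ f q :=
  hf.smooth.contDiffAt ((isOpen_univ.prod isOpen_Ioi).mem_nhds ⟨mem_univ _, hq⟩)

theorem IsNeatCollar.eventually_contDiffAt (hf : IsNeatCollar A ρ a f) {q : ℝ × ℝ} (hq : ρ < q.2) :
    ∀ᶠ q' in 𝓝 q, ContDiffAt ℝ ∞ f q' := by
  filter_upwards [continuous_snd.continuousAt.eventually (lt_mem_nhds hq)] with q' hq'
  exact hf.contDiffAt hq'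

theorem IsNeatCollar.norm_top (hf : IsNeatCollar A ρ a f) (s : ℝ) : ‖f (s, 1)‖ = 1 := by
  obtain ⟨c, hc, h⟩ := hf.norm_eq
  exact h s 1 hc

theorem IsNeatCollar.norm_le (hf : IsNeatCollar A ρ a f) (s : ℝ) {t : ℝ} (ht : t ∈ Icc a 1) :
    ‖f (s, t)‖ ≤ 1 := by
  rcases ht.2.eq_or_lt with rfl | h
  · exact (hf.norm_top s).le
  · exact (hf.norm_lt s t ⟨ht.1, h⟩).le

/-- Near an interior point of the collar, the surface is the image of a small piece of the strip. -/
theorem IsNeatCollar.eventually_mem_image (hf : IsNeatCollar A ρ a f) (hA : IsClosed A)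
    (hAa : ∀ p ∈ A, ‖p‖ ≤ a) {q : ℝ × ℝ} (hq : q.2 ∈ Ioc a 1) {V : Set (ℝ × ℝ)} (hV : V ∈ 𝓝 q) :
    ∀ᶠ y in 𝓝 (f q), y ∈ A ∪ f '' (univ ×ˢ Icc a 1) → y ∈ f '' V := by
  obtain ⟨s, t⟩ := q
  have hqA : f (s, t) ∉ A := fun h => absurd (hAa _ h) (not_le.2 (hf.lt_norm s t hq))
  -- One period around `s` without the interior of `V`: its image is compact and avoids `f (s, t)`,
  -- hence so do all points of the collar that are not represented in `V`.
  set C : Set (ℝ × ℝ) := (Icc (s - 1 / 2) (s + 1 / 2) ×ˢ Icc a 1) \ interior V with hC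
  have hCc : IsCompact C := (isCompact_Icc.prod isCompact_Icc).diff isOpen_interior
  have hCf : IsClosed (f '' C) := (hCc.image_of_continuousOn
    (hf.continuousOn.mono (sdiff_subset.trans (prod_mono_left (subset_univ _))))).isClosed
  have hqC : f (s, t) ∉ f '' C := by
    rintro ⟨⟨s', t'⟩, ⟨⟨hs', ht'⟩, hV'⟩, h⟩
    obtain ⟨h1, n, h2⟩ := hf.injective s' s t' ht' t ⟨hq.1.le, hq.2⟩ h
    have h3 : n = 0 := by
      have h4 : |(n : ℝ)| < 1 := by
        have h5 := hs'.1
        have h6 := hs'.2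
        simp only at h2 h5 h6
        rw [abs_lt]
        constructor <;> linarith
      rw [← Int.cast_abs] at h4
      exact Int.abs_lt_one_iff.1 (by exact_mod_cast h4)
    rw [h3, Int.cast_zero, add_zero] at h2
    apply hV'
    rw [← h1, h2] at hV
    exact mem_interior_iff_mem_nhds.2 hV
  filter_upwards [hA.isOpen_compl.mem_nhds hqA, hCf.isOpen_compl.mem_nhds hqC] with y hyA hyC
  rintro (h | ⟨⟨s', t'⟩, ⟨-, ht'⟩, rfl⟩)
  · exact (hyA h).elim
  · have hper : Function.Periodic (fun s => f (s, t')) 1 := fun s => hf.periodic s t'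
    obtain ⟨s'', hs'', h⟩ := hper.exists_mem_Ico zero_lt_one s' (s - 1 / 2)
    refine ⟨(s'', t'), ?_, h.symm⟩
    by_contra hV'
    apply hyC
    rw [h]
    refine ⟨(s'', t'), ⟨⟨⟨hs''.1, ?_⟩, ht'⟩, fun hi => hV' (interior_subset hi)⟩, rfl⟩
    have := hs''.2
    linarith

/-- Near `A` the new surface coincides with `F`, whose local equations are reused. Near a point of
the collar off `A` the immersion supplies one. -/
theorem IsNeatCollar.isNeatSurface {F : Set E4} (hF : IsNeatSurface F) (hf : IsNeatCollar A ρ a f)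
    (hρ : ρ < a) (ha1 : a < 1) (hb : a < b) (hA : IsCompact A) (hAa : ∀ p ∈ A, ‖p‖ ≤ a)
    (hlow : ∀ y, ‖y‖ < b → (y ∈ A ∪ f '' (univ ×ˢ Icc a 1) ↔ y ∈ F)) :
    IsNeatSurface (A ∪ f '' (univ ×ˢ Icc a 1)) where
  compact := hA.union hf.isCompact
  subset_ball := by
    rintro _ (hp | ⟨⟨s, t⟩, ⟨-, ht⟩, rfl⟩) <;> rw [mem_closedBall_zero_iff]
    · exact (hAa _ hp).trans ha1.le
    · exact hf.norm_le s ht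
  local_equation := by
    intro p hp
    have hle : ∀ y ∈ A ∪ f '' (univ ×ˢ Icc a 1), ‖y‖ ≤ 1 := by
      rintro _ (hp | ⟨⟨s, t⟩, ⟨-, ht⟩, rfl⟩)
      · exact (hAa _ hp).trans ha1.le
      · exact hf.norm_le s ht
    by_cases hpA : p ∈ A
    · have hpa := hAa p hpA
      obtain ⟨U, G, hU, hpU, hG, hUF, hsurj, -⟩ := hF.local_equation p
        ((hlow p (hpa.trans_lt hb)).1 hp)
      refine ⟨U ∩ Metric.ball 0 b, G, hU.inter Metric.isOpen_ball,
        ⟨hpU, by rw [mem_ball_zero_iff]; exact hpa.trans_lt hb⟩, hG.mono inter_subset_left, ?_,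
        hsurj, fun h => absurd (h.symm.le.trans hpa) (not_le.2 ha1)⟩
      rintro y ⟨hyU, hyb⟩
      rw [hlow y (mem_ball_zero_iff.1 hyb), hUF y hyU]
    · obtain ⟨⟨s, t⟩, ⟨-, ht⟩, rfl⟩ := hp.resolve_left hpA
      have hta : t ∈ Ioc a 1 := by
        refine ⟨lt_of_le_of_ne ht.1 ?_, ht.2⟩
        rintro rfl
        exact hpA (hf.mem s)
      obtain ⟨c, hc, hcn⟩ := hf.norm_eq
      -- The local equation also describes the collar beyond `t = 1`; the condition of norm at most
      -- 1 has to cut off exactly this part, which it does since the norm is `t` there.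
      have hN : ∃ N ∈ 𝓝 (s, t), ∀ q ∈ N, a < q.2 ∧ (‖f q‖ ≤ 1 → q.2 ≤ 1) := by
        rcases ht.2.eq_or_lt with rfl | ht1
        · have hev : ∀ᶠ q : ℝ × ℝ in 𝓝 (s, 1), a < q.2 ∧ c < q.2 :=
            continuous_snd.continuousAt.eventually (p := fun u => a < u ∧ c < u)
              ((lt_mem_nhds ha1).and (lt_mem_nhds hc))
          refine ⟨_, hev, fun q hq => ?_⟩
          obtain ⟨h1, h2⟩ := hq
          exact ⟨h1, fun h => (hcn q.1 q.2 h2).symm.trans_le h⟩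
        · have hev : ∀ᶠ q : ℝ × ℝ in 𝓝 (s, t), a < q.2 ∧ q.2 < 1 :=
            continuous_snd.continuousAt.eventually (p := fun u => a < u ∧ u < 1)
              ((lt_mem_nhds hta.1).and (gt_mem_nhds ht1))
          exact ⟨_, hev, fun q hq => ⟨hq.1, fun _ => hq.2.le⟩⟩
      obtain ⟨N, hN, hNq⟩ := hN
      obtain ⟨G, hG, ⟨V, hV, hVN, hGV⟩, hsurj, hker⟩ := exists_local_equation
        (hf.eventually_contDiffAt (q := (s, t)) (hρ.trans hta.1)) (hf.immersion s t ht) hN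
      have hev := hG.and (hGV.and (hf.eventually_mem_image hA.isClosed hAa (q := (s, t)) hta hV))
      obtain ⟨U, hUall, hU, hpU⟩ := eventually_nhds_iff.1 hev
      refine ⟨U, G, hU, hpU, fun y hy => (hUall y hy).1.contDiffWithinAt, ?_, hsurj, ?_⟩
      · intro y hy
        obtain ⟨-, h1, h2⟩ := hUall y hy
        constructor
        · exact fun h => ⟨hle y h, h1.2 (h2 h)⟩
        · rintro ⟨h3, h4⟩
          obtain ⟨q, hq, rfl⟩ := h1.1 h4
          obtain ⟨h5, h6⟩ := hNq q (hVN hq)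
          exact Or.inr ⟨q, ⟨mem_univ _, h5.le, h6 h3⟩, rfl⟩
      · intro hp1
        have ht1 : t = 1 := by
          by_contra hne
          exact absurd hp1 (hf.norm_lt s t ⟨ht.1, lt_of_le_of_ne ht.2 hne⟩).ne
        subst ht1
        have hfd : HasFDerivAt f (fderiv ℝ f (s, 1)) (s, 1) :=
          ((hf.contDiffAt (q := (s, 1)) (hρ.trans ha1)).differentiableAt (by simp)).hasFDerivAt
        have h1 : HasDerivAt (fun t : ℝ => f (s, t)) (fderiv ℝ f (s, 1) (0, 1)) 1 :=
          hfd.comp_hasDerivAt (1 : ℝ) ((hasDerivAt_const (1 : ℝ) s).prodMk (hasDerivAt_id (1 : ℝ)))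
        have h2 := h1.norm_sq
        have h3 : (fun t : ℝ => ‖f (s, t)‖ ^ 2) =ᶠ[𝓝 1] fun t => t ^ 2 := by
          filter_upwards [lt_mem_nhds hc] with t ht
          rw [hcn s t ht]
        have h4 := h2.unique (((hasDerivAt_id (1 : ℝ)).pow 2).congr_of_eventuallyEq h3)
        have h5 : inner ℝ (f (s, 1)) (fderiv ℝ f (s, 1) (0, 1)) = 1 := by
          simp at h4
          exact h4
        intro w
        obtain ⟨v, hv⟩ := hsurj w
        -- The derivative in `t` is tangent to the surface and has product 1 with the position
        -- vector. Subtracting a multiple of it makes `v` tangent to the sphere and does not change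
        -- its image under the differential of `G`.
        refine ⟨v - inner ℝ (f (s, 1)) v • fderiv ℝ f (s, 1) (0, 1), ?_, ?_⟩
        · rw [inner_sub_right, inner_smul_right, h5, mul_one, sub_self]
        · rw [map_sub, map_smul, hker, smul_zero, sub_zero, hv]

theorem IsNeatCollar.fderiv_periodic (hf : IsNeatCollar A ρ a f) (s t : ℝ) :
    fderiv ℝ f (s + 1, t) = fderiv ℝ f (s, t) := by
  have h1 : (fun q : ℝ × ℝ => f (q + (1, 0))) = f := by
    ext1 q
    rw [← hf.periodic q.1 q.2]
    congr 1
    exact Prod.ext rfl (add_zero _)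
  have h2 := fderiv_comp_add_right (𝕜 := ℝ) (f := f) (x := (s, t)) ((1, 0) : ℝ × ℝ)
  rw [h1] at h2
  rw [h2]
  congr 1
  exact Prod.ext rfl (add_zero _).symm

theorem IsNeatCollar.continuousOn_fderiv (hf : IsNeatCollar A ρ a f) (hρ : ρ < a) :
    ContinuousOn (fderiv ℝ f) (univ ×ˢ Icc a 1) := fun q hq =>
  ((hf.contDiffAt (q := q) (hρ.trans_le hq.2.1)).fderiv_right (m := 1)
    (by norm_cast)).continuousAt.continuousWithinAt

/-- The form `η` is kept on `A` and blended, over the radii from `a` to `b`, into a signed multiple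
of the area form of the new collar. -/
theorem IsNeatCollar.isOrientableSurface {F : Set E4} (hF : IsNeatSurface F)
    (hFo : IsOrientableSurface F) {g : ℝ × ℝ → E4} (hg : IsCollarMap A a g)
    (hgF : MapsTo g (univ ×ˢ Icc a 1) F)
    (hf : IsNeatCollar A ρ a f) (hρ : ρ < a) (hb : a < b) (hb1 : b < 1)
    (hA : IsClosed A) (hAa : ∀ p ∈ A, ‖p‖ ≤ a)
    (hgf : ∀ s, ∀ t ∈ Icc a b, g (s, t) = f (s, t))
    (hfF : ∀ s, ∀ t ∈ Ioo ρ b, f (s, t) ∈ F)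
    (hlow : ∀ y, ‖y‖ < b → (y ∈ A ∪ f '' (univ ×ˢ Icc a 1) ↔ y ∈ F)) :
    IsOrientableSurface (A ∪ f '' (univ ×ˢ Icc a 1)) := by
  obtain ⟨η, hη, hηF⟩ := hFo
  have hAF : A ⊆ F := fun p hp => (hlow p ((hAa p hp).trans_lt hb)).1 (Or.inl hp)
  set S : Set (ℝ × ℝ) := univ ×ˢ Ico a b with hS
  have hSsub : S ⊆ univ ×ˢ Icc a 1 := prod_mono_right fun t ht => ⟨ht.1, ht.2.le.trans hb1.le⟩
  set l : ℝ × ℝ → ℝ := fun q => η (f q) ![fderiv ℝ f q (1, 0), fderiv ℝ f q (0, 1)] with hl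
  have hl0 : ∀ q ∈ S, l q ≠ 0 := by
    rintro ⟨s, t⟩ ⟨-, ht⟩
    have h1 : ∀ᶠ q in 𝓝 (s, t), f q ∈ F := by
      filter_upwards [continuous_snd.continuousAt.eventually
        ((isOpen_Ioo (a := ρ) (b := b)).mem_nhds (⟨hρ.trans_le ht.1, ht.2⟩ : t ∈ Ioo ρ b))]
        with q hq
      exact hfF q.1 q.2 hq
    have h2 := hF.tangentPlane_le_range
      ((hf.contDiffAt (q := (s, t)) (hρ.trans_le ht.1)).differentiableAt (by simp))
      (hf.immersion s t ⟨ht.1, ht.2.le.trans hb1.le⟩) h1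
    obtain ⟨u, hu, v, hv, huv⟩ := hηF _ h1.self_of_nhds
    exact alternating_ne_zero_of_mem_range (h2 hu) (h2 hv) huv
  have hfd := hf.continuousOn_fderiv hρ
  have hlc : ContinuousOn l S := by
    have h1 : ContinuousOn (fun q => η (f q)) S :=
      hη.comp (hf.continuousOn.mono hSsub) fun q hq =>
        hfF q.1 q.2 ⟨hρ.trans_le hq.2.1, hq.2.2⟩
    have h2 : ∀ v, ContinuousOn (fun q => fderiv ℝ f q v) S := fun v =>
      (hfd.mono hSsub).clm_apply continuousOn_const
    have h3 : ContinuousOn (fun q => ![fderiv ℝ f q (1, 0), fderiv ℝ f q (0, 1)]) S := by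
      rw [continuousOn_pi]
      intro i
      fin_cases i
      · exact h2 _
      · exact h2 _
    exact h1.eval h3
  have hSp : IsPreconnected S := (convex_univ.prod (convex_Ico a b)).isPreconnected
  -- The value of `η` on the coordinate frame has no zero on a connected strip, so its sign is
  -- constant; `ε` carries this sign.
  obtain ⟨ε, hε, hεl⟩ : ∃ ε : ℝ, ε ≠ 0 ∧ ∀ q ∈ S, 0 < ε * l q := by
    have h0 : ((0 : ℝ), a) ∈ S := ⟨mem_univ _, le_rfl, hb⟩
    refine ⟨l (0, a), hl0 _ h0, fun q hq => ?_⟩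
    by_contra hneg
    rw [not_lt] at hneg
    have h1 : ContinuousOn (fun q => l (0, a) * l q) S := continuousOn_const.mul hlc
    obtain ⟨q', hq', h2⟩ := hSp.intermediate_value hq h0 h1 ⟨hneg, mul_self_nonneg _⟩
    exact mul_ne_zero (hl0 _ h0) (hl0 _ hq') h2
  set χ : ℝ → ℝ := fun t => Real.smoothTransition ((t - a) / (b - a)) with hχ
  have hχc : Continuous χ := Real.smoothTransition.continuous.comp (by fun_prop)
  have hχ0 : χ a = 0 := by simp [hχ]
  have hχ1 : ∀ t, b ≤ t → χ t = 1 := fun t ht =>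
    Real.smoothTransition.one_of_one_le (by rw [le_div_iff₀ (by linarith)]; linarith)
  have hχm : ∀ t, 0 ≤ χ t ∧ χ t ≤ 1 := fun t =>
    ⟨Real.smoothTransition.nonneg _, Real.smoothTransition.le_one _⟩
  obtain ⟨θ, hθ, hθA, hθf⟩ := hf.toIsCollarMap.exists_glue hA hAa (u := η)
    (v := fun q => (1 - χ q.2) • η (g q) + (χ q.2 * ε) • areaForm (fderiv ℝ f q)) (hη.mono hAF)
    (((continuousOn_const.sub (hχc.comp continuous_snd).continuousOn).smul
      (hη.comp hg.continuousOn hgF)).add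
      (((hχc.comp continuous_snd).continuousOn.mul continuousOn_const).smul
        (continuous_areaForm.comp_continuousOn hfd)))
    (fun s t => by simp only [hg.periodic, hf.fderiv_periodic])
    (fun s => by simp only [hχ0, hgf s a ⟨le_rfl, hb.le⟩, sub_zero, one_smul, zero_mul, zero_smul,
      add_zero])
  refine ⟨θ, hθ, fun p hp => ?_⟩
  by_cases hpA : p ∈ A
  · have h1 : tangentPlane (A ∪ f '' (univ ×ˢ Icc a 1)) p = tangentPlane F p := by
      apply tangentPlane_congr
      rw [nhdsWithin_eq_iff_eventuallyEq]
      have h2 : ∀ᶠ y in 𝓝 p, ‖y‖ < b :=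
        continuous_norm.continuousAt.eventually (gt_mem_nhds ((hAa p hpA).trans_lt hb))
      filter_upwards [h2] with y hy
      exact propext (hlow y hy)
    rw [h1, hθA p hpA]
    exact hηF p (hAF hpA)
  · obtain ⟨⟨s, t⟩, ⟨-, ht⟩, rfl⟩ := hp.resolve_left hpA
    have hmem := mem_tangentPlane_of_parametrization (F := A ∪ f '' (univ ×ˢ Icc a 1))
      ((uniqueDiffOn_univ.prod (uniqueDiffOn_Icc (hb.trans hb1))) (s, t) ⟨mem_univ _, ht⟩)
      ((hf.contDiffAt (q := (s, t)) (hρ.trans_le ht.1)).differentiableAt (by simp))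
      (fun q hq => Or.inr ⟨q, hq, rfl⟩)
    refine ⟨_, hmem (1, 0), _, hmem (0, 1), ?_⟩
    rw [hθf s t ht]
    have harea := areaForm_pos (hf.immersion s t ht)
    simp only [ContinuousAlternatingMap.add_apply, ContinuousAlternatingMap.smul_apply, smul_eq_mul]
    rcases lt_or_ge t b with htb | htb
    · rw [hgf s t ⟨ht.1, htb.le⟩]
      have h1 := hεl (s, t) ⟨mem_univ _, ht.1, htb⟩
      simp only [hl] at h1
      obtain ⟨h2, h3⟩ := hχm t
      set X := η (f (s, t)) ![fderiv ℝ f (s, t) (1, 0), fderiv ℝ f (s, t) (0, 1)] with hX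
      set Y := areaForm (fderiv ℝ f (s, t)) ![fderiv ℝ f (s, t) (1, 0), fderiv ℝ f (s, t) (0, 1)]
      intro h4
      -- After multiplication by `ε` neither summand is negative, and the second is positive unless
      -- `χ t = 0`, in which case the first is.
      have h5 : (1 - χ t) * (ε * X) + χ t * (ε ^ 2 * Y) = 0 := by
        linear_combination ε * h4
      have h6 : 0 < ε ^ 2 * Y := mul_pos (by positivity) harea
      rcases h2.eq_or_lt with h7 | h7
      · rw [← h7] at h5
        linarith
      · have h8 := mul_pos h7 h6
        have h9 := mul_nonneg (sub_nonneg.2 h3) h1.le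
        linarith
    · rw [hχ1 t htb]
      simp [hε, harea.ne']

/-- Exchanging the collar of a surface in the ball. -/
theorem IsNeatSurface.boundsSurfaceOfGenus_of_exchange {F : Set E4} {n : ℕ}
    (hF : IsNeatSurface F) (hFc : IsConnected F) (hFo : IsOrientableSurface F)
    (hFb : firstBetti F = 2 * n) {g : ℝ × ℝ → E4} (hg : IsCollarMap A a g)
    (hFg : F = A ∪ g '' (univ ×ˢ Icc a 1))
    (hf : IsNeatCollar A ρ a f) (hρ : ρ < a) (hb : a < b) (hb1 : b < 1)
    (hA : IsCompact A) (hAa : ∀ p ∈ A, ‖p‖ ≤ a)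
    (hgf : ∀ s, ∀ t ∈ Icc a b, g (s, t) = f (s, t))
    (hfF : ∀ s, ∀ t ∈ Ioo ρ b, f (s, t) ∈ F)
    (hfu : ∀ s, ∀ t ∈ Icc b 1, b ≤ ‖f (s, t)‖)
    (hgu : ∀ s, ∀ t ∈ Icc b 1, b ≤ ‖g (s, t)‖) :
    BoundsSurfaceOfGenus (range fun s => f (s, 1)) n := by
  -- Both collars have norm at least `b` for parameters from `b` on and agree before, so the old and
  -- new surfaces coincide inside radius `b`.
  have hlow : ∀ y, ‖y‖ < b → (y ∈ A ∪ f '' (univ ×ˢ Icc a 1) ↔ y ∈ F) := by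
    intro y hy
    rw [hFg]
    have h1 : ∀ f₁ f₂ : ℝ × ℝ → E4, (∀ s, ∀ t ∈ Icc a b, f₁ (s, t) = f₂ (s, t)) →
        (∀ s, ∀ t ∈ Icc b 1, b ≤ ‖f₁ (s, t)‖) → y ∈ A ∪ f₁ '' (univ ×ˢ Icc a 1) →
        y ∈ A ∪ f₂ '' (univ ×ˢ Icc a 1) := by
      rintro f₁ f₂ h2 h3 (h | ⟨⟨s, t⟩, ⟨hs, ht⟩, rfl⟩)
      · exact Or.inl h
      · rcases le_total t b with htb | htb
        · exact Or.inr ⟨(s, t), ⟨hs, ht⟩, (h2 s t ⟨ht.1, htb⟩).symm⟩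
        · exact absurd hy (not_lt.2 (h3 s t ⟨htb, ht.2⟩))
    exact ⟨h1 f g (fun s t ht => (hgf s t ht).symm) hfu, h1 g f hgf hgu⟩
  obtain ⟨e⟩ := hg.exists_homeomorph hf.toIsCollarMap hA.isClosed hAa
    fun s => hgf s a ⟨le_rfl, hb.le⟩
  have hgF : MapsTo g (univ ×ˢ Icc a 1) F := fun q hq => by
    rw [hFg]
    exact Or.inr ⟨q, hq, rfl⟩
  refine ⟨A ∪ f '' (univ ×ˢ Icc a 1), hf.isNeatSurface hF hρ (hb.trans hb1) hb hA hAa hlow, ?_,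
    hf.isOrientableSurface hF hFo hg hgF hρ hb hb1 hA.isClosed hAa hgf hfF hlow, ?_, ?_⟩
  · rw [hFg] at hFc
    exact isConnected_of_homeomorph e hFc
  · ext y
    constructor
    · rintro ⟨h | ⟨⟨s, t⟩, ⟨-, ht⟩, rfl⟩, hy⟩ <;> rw [mem_sphere_zero_iff_norm] at hy
      · exact absurd (hy.symm.trans_le (hAa y h)) (not_le.2 (hb.trans hb1))
      · refine ⟨s, ?_⟩
        have : t = 1 := by
          by_contra hne
          exact absurd hy (hf.norm_lt s t ⟨ht.1, lt_of_le_of_ne ht.2 hne⟩).ne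
        rw [this]
    · rintro ⟨s, rfl⟩
      exact ⟨Or.inr ⟨(s, 1), ⟨mem_univ _, (hb.trans hb1).le, le_rfl⟩, rfl⟩,
        mem_sphere_zero_iff_norm.2 (hf.norm_top s)⟩
  · rw [← firstBetti_eq_of_homeomorph e, ← hFg, hFb]

end SmoothExchange

/-! ### The 4-genus is a concordance invariant -/

section Gluing

variable {K K' : Set E4} {x : ℝ × ℝ → E4} {h : ℝ × ℝ → ℝ}

/-- For a unit vector field the derivative is orthogonal to the field, so the radial and the
spherical part of the derivative of the product vanish separately. -/
theorem injective_fderiv_smul {R : ℝ × ℝ → ℝ} {X : ℝ × ℝ → E4} {q : ℝ × ℝ}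
    (hR : DifferentiableAt ℝ R q) (hX : DifferentiableAt ℝ X q) (hX1 : ∀ᶠ q' in 𝓝 q, ‖X q'‖ = 1)
    (hR0 : R q ≠ 0) (hRX : ∀ v, fderiv ℝ R q v = 0 → fderiv ℝ X q v = 0 → v = 0) :
    Function.Injective (fderiv ℝ (fun q => R q • X q) q) := by
  rw [show fderiv ℝ (fun q => R q • X q) q = _ from (hR.hasFDerivAt.smul hX.hasFDerivAt).fderiv,
    injective_iff_map_eq_zero]
  intro v hv
  have h1 : R q • fderiv ℝ X q v + fderiv ℝ R q v • X q = 0 := hv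
  have h2 : inner ℝ (X q) (fderiv ℝ X q v) = 0 := by
    have h3 : (fun q => ‖X q‖ ^ 2) =ᶠ[𝓝 q] fun _ => 1 := hX1.mono fun q' h => by
      simp only [h, one_pow]
    have h4 := hX.hasFDerivAt.norm_sq.unique
      ((hasFDerivAt_const (1 : ℝ) q).congr_of_eventuallyEq h3)
    have h5 := DFunLike.congr_fun h4 v
    simpa using h5
  have h3 := congrArg (inner ℝ (X q)) h1
  rw [inner_add_right, inner_smul_right, inner_smul_right, h2, real_inner_self_eq_norm_sq,
    hX1.self_of_nhds, inner_zero_right] at h3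
  have h4 : fderiv ℝ R q v = 0 := by linarith
  rw [h4, zero_smul, add_zero] at h1
  exact hRX v h4 ((smul_eq_zero.1 h1).resolve_left hR0)

/-- The definition controls the annulus over `[0,1]` only; the product ends extend the property to
all parameters, which the collar needs beyond its end. -/
theorem IsConcordance.norm_eq_one (hC : IsConcordance K K' x h) (hcol : IsCollared x h)
    (q : ℝ × ℝ) : ‖x q‖ = 1 := by
  obtain ⟨s, t⟩ := q
  rcases le_or_gt t (1 / 10) with h1 | h1
  · rw [(hcol.bottom s t h1).1]
    exact hC.mem_sphere s 0 ⟨le_rfl, zero_le_one⟩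
  rcases le_or_gt (9 / 10) t with h2 | h2
  · rw [(hcol.top s t h2).1]
    exact hC.mem_sphere s 1 ⟨zero_le_one, le_rfl⟩
  · exact hC.mem_sphere s t ⟨by linarith, by linarith⟩

/-- The height is constant along the lower boundary, so the immersion must be detected by `x` there.
-/
theorem IsConcordance.isKnotParam (hC : IsConcordance K K' x h) :
    IsKnotParam fun s => x (s, 0) where
  smooth := hC.smooth_fst.comp (by fun_prop)
  periodic s := hC.periodic_fst s 0
  regular s h0 := by
    have h0m : (0 : ℝ) ∈ Icc (0 : ℝ) 1 := ⟨le_rfl, zero_le_one⟩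
    have h1 : HasDerivAt (fun s : ℝ => (s, (0 : ℝ))) (1, 0) s :=
      (hasDerivAt_id s).prodMk (hasDerivAt_const s (0 : ℝ))
    have h2 : HasFDerivAt x (fderiv ℝ x (s, 0)) (s, 0) :=
      ((hC.smooth_fst.differentiable (by simp)) _).hasFDerivAt
    have h3 : HasFDerivAt h (fderiv ℝ h (s, 0)) (s, 0) :=
      ((hC.smooth_snd.differentiable (by simp)) _).hasFDerivAt
    have h4 := (h2.comp_hasDerivAt s h1).deriv
    have h5 : fderiv ℝ h (s, 0) (1, 0) = 0 := by
      have h6 : (h ∘ fun s : ℝ => (s, (0 : ℝ))) = fun _ => 0 := by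
        ext s
        exact (hC.proper_zero s 0 h0m).2 rfl
      have h7 := h3.comp_hasDerivAt s h1
      rw [h6] at h7
      exact h7.unique (hasDerivAt_const s (0 : ℝ))
    have h6 := hC.immersion s 0 h0m
    rw [(h2.prodMk h3).fderiv] at h6
    have h7 := (injective_iff_map_eq_zero _).1 h6 (1, 0) (Prod.ext (h4.symm.trans h0) h5)
    exact one_ne_zero (congrArg Prod.fst h7)
  simple s t hst := by
    have h0m : (0 : ℝ) ∈ Icc (0 : ℝ) 1 := ⟨le_rfl, zero_le_one⟩
    exact (hC.injective s t 0 h0m 0 h0m hst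
      (((hC.proper_zero s 0 h0m).2 rfl).trans ((hC.proper_zero t 0 h0m).2 rfl).symm)).2
  mem_sphere s := hC.mem_sphere s 0 ⟨le_rfl, zero_le_one⟩

/-- The radial collar of a surface bounded by the lower end of a concordance is straightened to a
cone, and the concordance is attached to it. -/
theorem IsConcordance.exists_neatCollar (hC : IsConcordance K K' x h) (hcol : IsCollared x h)
    {F : Set E4} {ρ : ℝ} {f : ℝ × ℝ → E4} (hf : IsRadialCollar F (fun s => x (s, 0)) ρ f) :
    ∃ a b : ℝ, ∃ f' : ℝ × ℝ → E4, ρ < a ∧ a < b ∧ b < 1 ∧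
      IsNeatCollar {p | p ∈ F ∧ ‖p‖ ≤ a} ρ a f' ∧
      (∀ s, ∀ t ∈ Ioc ρ b, f' (s, t) = f (s, t)) ∧ (∀ s, ∀ t ∈ Icc b 1, b ≤ ‖f' (s, t)‖) ∧
      ∀ s, f' (s, 1) = x (s, 1) := by
  have hρ0 := hf.pos
  have hρ1 := hf.lt_one
  -- Quarter points of the interval from `ρ` to 1: the inner part ends at `a`, the old collar is
  -- unchanged up to `b`, it is bent into a cone over `K` until `c`, and the shell from `c` to 1
  -- receives the concordance.
  obtain ⟨a, ha⟩ : ∃ a, a = ρ + (1 - ρ) / 4 := ⟨_, rfl⟩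
  obtain ⟨b, hb⟩ : ∃ b, b = ρ + (1 - ρ) / 2 := ⟨_, rfl⟩
  obtain ⟨c, hc⟩ : ∃ c, c = ρ + 3 * (1 - ρ) / 4 := ⟨_, rfl⟩
  have hρa : ρ < a := by linarith
  have hab : a < b := by linarith
  have hbc : b < c := by linarith
  have hc1 : c < 1 := by linarith
  have hc1' : 0 < 1 - c := sub_pos.2 hc1
  -- the two reparametrisations of the radius
  set κ : ℝ → ℝ := fun τ => τ + Real.smoothTransition ((τ - b) / (c - b)) * (1 - τ) with hκ
  have hκs : ContDiff ℝ ∞ κ := contDiff_id.add ((Real.smoothTransition.contDiff.comp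
    (by fun_prop)).mul (by fun_prop))
  have hκb : ∀ τ ≤ b, κ τ = τ := fun τ hτ => by
    simp only [hκ]
    rw [Real.smoothTransition.zero_of_nonpos, zero_mul, add_zero]
    exact div_nonpos_of_nonpos_of_nonneg (by linarith) (by linarith)
  have hκc : ∀ τ, c ≤ τ → κ τ = 1 := fun τ hτ => by
    simp only [hκ]
    rw [Real.smoothTransition.one_of_one_le]
    · ring
    · rw [le_div_iff₀ (by linarith)]
      linarith
  have hκm : ∀ τ, ρ < τ → κ τ ∈ Ioc ρ 1 := fun τ hτ => by
    rcases le_or_gt c τ with h1 | h1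
    · rw [hκc τ h1]
      exact ⟨hρ1, le_rfl⟩
    · have h2 := Real.smoothTransition.nonneg ((τ - b) / (c - b))
      have h3 := Real.smoothTransition.le_one ((τ - b) / (c - b))
      have h4 : 0 ≤ 1 - τ := by linarith
      have h5 := mul_nonneg h2 h4
      have h6 := mul_le_of_le_one_left h4 h3
      exact ⟨by simp only [hκ]; linarith, by simp only [hκ]; linarith⟩
  set T : ℝ → ℝ := fun τ => (τ - c) / (1 - c) with hT
  have hTτ : ∀ τ, c + (1 - c) * T τ = τ := fun τ => by
    simp only [hT]
    field_simp
    ring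
  have hTle : ∀ τ r, T τ ≤ r ↔ τ ≤ c + (1 - c) * r := fun τ r => by
    simp only [hT]
    rw [div_le_iff₀ hc1']
    constructor <;> intro h <;> linarith
  have hleT : ∀ τ r, r ≤ T τ ↔ c + (1 - c) * r ≤ τ := fun τ r => by
    simp only [hT]
    rw [le_div_iff₀ hc1']
    constructor <;> intro h <;> linarith
  set W : ℝ × ℝ → ℝ × ℝ := fun q => (q.1, T q.2) with hW
  have hWs : ContDiff ℝ ∞ W := by fun_prop
  have hTm : ∀ τ ∈ Icc c 1, T τ ∈ Icc (0 : ℝ) 1 := fun τ hτ =>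
    ⟨(hleT τ 0).2 (by linarith [hτ.1]), (hTle τ 1).2 (by linarith [hτ.2])⟩
  set R : ℝ × ℝ → ℝ := fun q => c + (1 - c) * h (W q) with hR
  have hRs : ContDiff ℝ ∞ R := contDiff_const.add (contDiff_const.mul (hC.smooth_snd.comp hWs))
  -- The direction of the new collar by one formula. Up to `c'` the concordance is still the product
  -- and its term cancels `x (q.1, 0)`; from `c` on `κ` is 1 and the term of `f` cancels it. On the
  -- overlap `X` is `x (q.1, 0)` itself. Since `κ` never exceeds 1, `f` is used only where it is
  -- smooth, even beyond the end of the collar.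
  set X : ℝ × ℝ → E4 := fun q => x (W q) + (κ q.2)⁻¹ • f (q.1, κ q.2) - x (q.1, 0) with hX
  set c' : ℝ := c + (1 - c) / 10 with hc'
  have hcc' : c < c' := by linarith
  have hRlow : ∀ q : ℝ × ℝ, q.2 ≤ c' → R q = q.2 := fun q hq => by
    simp only [hR]
    rw [(hcol.bottom q.1 (T q.2) ((hTle _ _).2 (by linarith))).2, hTτ]
  have hXlow : ∀ q : ℝ × ℝ, q.2 ≤ c' → X q = (κ q.2)⁻¹ • f (q.1, κ q.2) := fun q hq => by
    simp only [hX]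
    rw [(hcol.bottom q.1 (T q.2) ((hTle _ _).2 (by linarith))).1, add_sub_cancel_left]
  have hXhigh : ∀ q : ℝ × ℝ, c ≤ q.2 → X q = x (W q) := fun q hq => by
    simp only [hX]
    rw [hκc _ hq, inv_one, one_smul, hf.top, add_sub_cancel_right]
  have hRtop : ∀ q : ℝ × ℝ, c + (1 - c) * (9 / 10) ≤ q.2 → R q = q.2 := fun q hq => by
    simp only [hR]
    rw [(hcol.top q.1 (T q.2) ((hleT _ _).2 hq)).2, hTτ]
  have hRmid : ∀ q : ℝ × ℝ, q.2 ∈ Icc c 1 → c ≤ R q ∧ R q ≤ 1 := fun q hq => by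
    obtain ⟨h1, h2⟩ := hC.mem_Icc q.1 (T q.2) (hTm _ hq)
    have h3 := mul_nonneg hc1'.le h1
    have h4 := mul_le_of_le_one_right hc1'.le h2
    exact ⟨by simp only [hR, hW]; linarith, by simp only [hR, hW]; linarith⟩
  have hRpos : ∀ q : ℝ × ℝ, ρ < q.2 → 0 < R q := fun q hq => by
    rcases le_or_gt q.2 c with h1 | h1
    · rw [hRlow q (h1.trans hcc'.le)]
      linarith
    rcases le_or_gt q.2 1 with h2 | h2
    · linarith [(hRmid q ⟨h1.le, h2⟩).1]
    · rw [hRtop q (by linarith)]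
      linarith
  have hX1 : ∀ q : ℝ × ℝ, ρ < q.2 → ‖X q‖ = 1 := fun q hq => by
    rcases le_or_gt q.2 c with h1 | h1
    · have h2 := hκm _ hq
      have h3 : 0 < κ q.2 := hρ0.trans h2.1
      rw [hXlow q (h1.trans hcc'.le), norm_smul, hf.norm_eq _ _ h2, norm_inv, Real.norm_of_nonneg
        h3.le, inv_mul_cancel₀ h3.ne']
    · rw [hXhigh q h1.le, hC.norm_eq_one hcol]
  have hXs : ContDiffOn ℝ ∞ X (univ ×ˢ Ioi ρ) := by
    have h1 : ContDiff ℝ ∞ fun q : ℝ × ℝ => κ q.2 := hκs.comp contDiff_snd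
    have h2 : ContDiffOn ℝ ∞ (fun q : ℝ × ℝ => f (q.1, κ q.2)) (univ ×ˢ Ioi ρ) :=
      hf.smooth.comp (contDiff_fst.prodMk h1).contDiffOn
        fun q hq => ⟨mem_univ _, hκm _ hq.2⟩
    have h3 : ContDiff ℝ ∞ fun q : ℝ × ℝ => x (q.1, 0) := hC.smooth_fst.comp (by fun_prop)
    exact ((hC.smooth_fst.comp hWs).contDiffOn.add ((h1.contDiffOn.inv fun q hq =>
      (hρ0.trans (hκm _ hq.2).1).ne').smul h2)).sub h3.contDiffOn
  set f' : ℝ × ℝ → E4 := fun q => R q • X q with hf'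
  have hnorm : ∀ s t, ρ < t → ‖f' (s, t)‖ = R (s, t) := fun s t ht => by
    simp only [hf']
    rw [norm_smul, hX1 _ ht, mul_one, Real.norm_of_nonneg (hRpos _ ht).le]
  have hfs : ContDiffOn ℝ ∞ f' (univ ×ˢ Ioi ρ) := hRs.contDiffOn.smul hXs
  have hff : ∀ s, ∀ t ∈ Ioc ρ b, f' (s, t) = f (s, t) := fun s t ht => by
    have h1 : t ≤ c' := by linarith [ht.2]
    simp only [hf']
    rw [hRlow _ h1, hXlow _ h1]
    simp only [hκb t ht.2]
    rw [smul_inv_smul₀ (hρ0.trans ht.1).ne']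
  refine ⟨a, b, f', hρa, hab, hbc.trans hc1, ⟨⟨?_, ?_, ?_, ?_, ?_⟩, hfs, ?_, ?_, ?_⟩, hff, ?_, ?_⟩
  · exact hfs.continuousOn.mono (prod_mono_right fun t ht => hρa.trans_le ht.1)
  · intro s t
    simp only [hf', hR, hX, hW, hC.periodic_fst, hC.periodic_snd, hf.periodic]
  · intro s s' t ht t' ht' heq
    have hρt : ρ < t := hρa.trans_le ht.1
    have hρt' : ρ < t' := hρa.trans_le ht'.1
    have h1 : R (s, t) = R (s', t') := by
      rw [← hnorm s t hρt, ← hnorm s' t' hρt', heq]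
    have h2 : X (s, t) = X (s', t') := by
      simp only [hf'] at heq
      rw [h1] at heq
      exact smul_right_injective E4 (hRpos (s', t') hρt').ne' heq
    rcases lt_or_ge t c with h3 | h3 <;> rcases lt_or_ge t' c with h4 | h4
    · rw [hRlow _ (h3.le.trans hcc'.le), hRlow _ (h4.le.trans hcc'.le)] at h1
      have h1' : t = t' := h1
      subst h1'
      rw [hXlow _ (h3.le.trans hcc'.le), hXlow _ (h3.le.trans hcc'.le)] at h2
      have h5 := hκm t hρt
      exact ⟨rfl, hf.simple s s' _ h5
        (smul_right_injective E4 (inv_ne_zero (hρ0.trans h5.1).ne') h2)⟩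
    · rw [hRlow _ (h3.le.trans hcc'.le)] at h1
      have h1' : t = R (s', t') := h1
      linarith [(hRmid (s', t') ⟨h4, ht'.2⟩).1]
    · rw [hRlow (s', t') (h4.le.trans hcc'.le)] at h1
      have h1' : R (s, t) = t' := h1
      linarith [(hRmid (s, t) ⟨h3, ht.2⟩).1]
    · rw [hXhigh _ h3, hXhigh _ h4] at h2
      have h5 : h (W (s, t)) = h (W (s', t')) := mul_left_cancel₀ hc1'.ne' (add_left_cancel h1)
      obtain ⟨h6, h7⟩ := hC.injective s s' (T t) (hTm t ⟨h3, ht.2⟩) (T t') (hTm t' ⟨h4, ht'.2⟩)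
        h2 h5
      exact ⟨by rw [← hTτ t, ← hTτ t', h6], h7⟩
  · intro s
    have h1 : a ∈ Ioc ρ 1 := ⟨hρa, by linarith⟩
    rw [hff s a ⟨hρa, hab.le⟩]
    exact ⟨hf.mem s a h1, (hf.norm_eq s a h1).le⟩
  · rintro s t ⟨h1, h2⟩
    rw [hnorm s t (hρa.trans h1)]
    rcases le_or_gt t c with h3 | h3
    · rwa [hRlow _ (h3.trans hcc'.le)]
    · linarith [(hRmid (s, t) ⟨h3.le, h2⟩).1]
  · intro s t ht
    have hρt : ρ < t := hρa.trans_le ht.1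
    have hnhds : ∀ᶠ q : ℝ × ℝ in 𝓝 (s, t), ρ < q.2 :=
      continuous_snd.continuousAt.eventually (lt_mem_nhds hρt)
    have hXd : DifferentiableAt ℝ X (s, t) :=
      (hXs.contDiffAt (hnhds.mono fun q hq => ⟨mem_univ _, hq⟩)).differentiableAt (by simp)
    refine injective_fderiv_smul ((hRs.differentiable (by simp)) _) hXd
      (hnhds.mono fun q hq => hX1 q hq) (hRpos _ hρt).ne' ?_
    -- Below `c'` the radius equals the parameter, so only the direction along the knot has to be
    -- checked. Above, the immersion of the concordance applies after rescaling.
    rcases lt_or_ge t c' with h1 | h1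
    · rintro ⟨v₁, v₂⟩ h2 h3
      have h4 : R =ᶠ[𝓝 (s, t)] Prod.snd := by
        filter_upwards [continuous_snd.continuousAt.eventually
          (gt_mem_nhds (show ((s, t) : ℝ × ℝ).2 < c' from h1))] with q hq
        exact hRlow q hq.le
      have h5 : v₂ = 0 := by
        rw [h4.fderiv_eq, show fderiv ℝ (Prod.snd : ℝ × ℝ → ℝ) (s, t) =
          ContinuousLinearMap.snd ℝ ℝ ℝ from fderiv_snd] at h2
        exact h2
      subst h5
      have h6 : HasDerivAt (fun s => X (s, t)) (fderiv ℝ X (s, t) (1, 0)) s :=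
        HasFDerivAt.comp_hasDerivAt (f := fun s => (s, t)) s hXd.hasFDerivAt
          ((hasDerivAt_id s).prodMk (hasDerivAt_const s t))
      have h7 : (fun s => X (s, t)) = fun s => (κ t)⁻¹ • f (s, κ t) :=
        funext fun s => hXlow (s, t) h1.le
      have h8 : fderiv ℝ X (s, t) (v₁, 0) = v₁ • fderiv ℝ X (s, t) (1, 0) := by
        rw [← map_smul]
        simp
      rw [h8, ← h6.deriv, h7] at h3
      have hκt := hκm t hρt
      have h9 : deriv (fun s => (κ t)⁻¹ • f (s, κ t)) s =
          (κ t)⁻¹ • deriv (fun s => f (s, κ t)) s := by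
        have h10 : ContDiffOn ℝ ∞ (fun s => f (s, κ t)) univ :=
          hf.smooth.comp (by fun_prop) fun s _ => ⟨mem_univ _, hκt⟩
        exact (((h10.differentiableOn (by simp)).differentiableAt (x := s)
          univ_mem).hasDerivAt.const_smul (κ t)⁻¹).deriv
      rw [h9] at h3
      have h10 := (smul_eq_zero.1 h3).resolve_right (smul_ne_zero
        (inv_ne_zero (hρ0.trans hκt.1).ne') (hf.regular s _ hκt))
      rw [h10]
      rfl
    · intro v h2 h3
      have htc : c < t := hcc'.trans_le h1
      have hWd : HasFDerivAt W (((ContinuousLinearMap.fst ℝ ℝ ℝ)).prod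
          ((1 - c)⁻¹ • ContinuousLinearMap.snd ℝ ℝ ℝ)) (s, t) := by
        refine (hasFDerivAt_fst (𝕜 := ℝ)).prodMk ?_
        have h4 := ((hasFDerivAt_snd (𝕜 := ℝ) (p := ((s, t) : ℝ × ℝ))).sub_const c).const_mul
          (1 - c)⁻¹
        have h5 : (fun q : ℝ × ℝ => (1 - c)⁻¹ * (q.2 - c)) = fun q => T q.2 := by
          ext q
          simp only [hT]
          ring
        rw [h5] at h4
        exact h4
      have hxd : HasFDerivAt x (fderiv ℝ x (W (s, t))) (W (s, t)) :=
        ((hC.smooth_fst.differentiable (by simp)) _).hasFDerivAt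
      have hhd : HasFDerivAt h (fderiv ℝ h (W (s, t))) (W (s, t)) :=
        ((hC.smooth_snd.differentiable (by simp)) _).hasFDerivAt
      have h4 : X =ᶠ[𝓝 (s, t)] x ∘ W := by
        filter_upwards [continuous_snd.continuousAt.eventually
          (lt_mem_nhds (show c < ((s, t) : ℝ × ℝ).2 from htc))] with q hq
        exact hXhigh q hq.le
      rw [h4.fderiv_eq, (hxd.comp (s, t) hWd).fderiv] at h3
      rw [show fderiv ℝ R (s, t) = _ from
        ((hhd.comp (s, t) hWd).const_mul (1 - c) |>.const_add c).fderiv] at h2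
      have h5 := (smul_eq_zero.1 (show (1 - c) • (fderiv ℝ h (W (s, t))) _ = 0 from h2)).resolve_left
        hc1'.ne'
      have h6 := hC.immersion s (T t) (hTm t ⟨htc.le, ht.2⟩)
      rw [(hxd.prodMk hhd).fderiv] at h6
      have h7 := (injective_iff_map_eq_zero _).1 h6 _ (Prod.ext h3 h5)
      have h8 : v.1 = 0 := congrArg Prod.fst h7
      have h9 : (1 - c)⁻¹ * v.2 = 0 := congrArg Prod.snd h7
      exact Prod.ext h8 ((mul_eq_zero.1 h9).resolve_left (inv_ne_zero hc1'.ne'))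
  · rintro s t ⟨h1, h2⟩
    rw [hnorm s t (hρa.trans_le h1)]
    rcases le_or_gt t c with h3 | h3
    · rwa [hRlow _ (h3.trans hcc'.le)]
    · refine lt_of_le_of_ne (hRmid (s, t) ⟨h3.le, h2.le⟩).2 fun h4 => ?_
      have h5 : h (s, T t) = 1 := by
        have h6 : (1 - c) * (h (s, T t) - 1) = 0 := by
          simp only [hR, hW] at h4
          linarith
        linarith [(mul_eq_zero.1 h6).resolve_left hc1'.ne']
      have h6 := (hC.proper_one s (T t) (hTm t ⟨h3.le, h2.le⟩)).1 h5
      have h7 := hTτ t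
      rw [h6] at h7
      linarith
  · refine ⟨c + (1 - c) * (9 / 10), by linarith, fun s t ht => ?_⟩
    have h1 : c < t := by linarith
    rw [hnorm s t (by linarith), hRtop _ ht.le]
  · rintro s t ⟨h1, h2⟩
    rw [hnorm s t (by linarith)]
    rcases le_or_gt t c with h3 | h3
    · rwa [hRlow _ (h3.trans hcc'.le)]
    · linarith [(hRmid (s, t) ⟨h3.le, h2⟩).1]
  · intro s
    have h1 : T 1 = 1 := by
      simp only [hT]
      exact div_self hc1'.ne'
    simp only [hf']
    rw [hRtop _ (by simp only; linarith), hXhigh _ hc1.le]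
    simp only [hW, h1, one_smul]

theorem IsRadialCollar.isCollarMap {F : Set E4} {γ : ℝ → E4} {ρ a : ℝ} {f : ℝ × ℝ → E4}
    (hf : IsRadialCollar F γ ρ f) (ha : ρ < a) (ha1 : a < 1) :
    IsCollarMap {p | p ∈ F ∧ ‖p‖ ≤ a} a f where
  continuousOn := hf.smooth.continuousOn.mono (prod_mono_right fun _ ht =>
    ⟨ha.trans_le ht.1, ht.2⟩)
  periodic := hf.periodic
  injective s s' t ht t' ht' h := by
    have h1 : t = t' := by
      rw [← hf.norm_eq s t ⟨ha.trans_le ht.1, ht.2⟩, h,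
        hf.norm_eq s' t' ⟨ha.trans_le ht'.1, ht'.2⟩]
    subst h1
    exact ⟨rfl, hf.simple s s' t ⟨ha.trans_le ht.1, ht.2⟩ h⟩
  mem s := ⟨hf.mem s a ⟨ha, ha1.le⟩, (hf.norm_eq s a ⟨ha, ha1.le⟩).le⟩
  lt_norm s t ht := by
    rw [hf.norm_eq s t ⟨ha.trans ht.1, ht.2⟩]
    exact ht.1

theorem IsRadialCollar.eq_union {F : Set E4} {γ : ℝ → E4} {ρ a : ℝ} {f : ℝ × ℝ → E4}
    (hf : IsRadialCollar F γ ρ f) (hF : F ⊆ Metric.closedBall 0 1) (ha : ρ < a) :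
    F = {p | p ∈ F ∧ ‖p‖ ≤ a} ∪ f '' (univ ×ˢ Icc a 1) := by
  apply Subset.antisymm
  · intro p hp
    rcases le_or_gt ‖p‖ a with h1 | h1
    · exact Or.inl ⟨hp, h1⟩
    · obtain ⟨s, hs⟩ := hf.exists_eq p hp (ha.trans h1)
      exact Or.inr ⟨(s, ‖p‖), ⟨mem_univ _, h1.le, mem_closedBall_zero_iff.1 (hF hp)⟩, hs⟩
  · rintro _ (hp | ⟨⟨s, t⟩, ⟨-, ht⟩, rfl⟩)
    · exact hp.1
    · exact hf.mem s t ⟨ha.trans_le ht.1, ht.2⟩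

/-- The inner part of `F` is kept and its collar is exchanged for one that ends with the
concordance, so the boundary becomes `K'`. -/
theorem BoundsSurfaceOfGenus.of_concordance {n : ℕ} (hK : BoundsSurfaceOfGenus K n)
    (hC : IsConcordance K K' x h) (hcol : IsCollared x h) : BoundsSurfaceOfGenus K' n := by
  obtain ⟨F, hF, hFc, hFo, hFK, hFb⟩ := hK
  obtain ⟨ρ, f, hf⟩ := exists_radialCollar hF hC.isKnotParam (hC.lower_boundary.trans hFK.symm)
  obtain ⟨a, b, f', hρa, hab, hb1, hf', hff, hfb, htop⟩ := hC.exists_neatCollar hcol hf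
  have hnorm : ∀ s, ∀ t ∈ Ioc ρ 1, ‖f (s, t)‖ = t := hf.norm_eq
  have hρ : ∀ {t}, a ≤ t → ρ < t := fun h => hρa.trans_le h
  have h1 := hF.boundsSurfaceOfGenus_of_exchange hFc hFo hFb
    (hf.isCollarMap hρa (hab.trans hb1)) (hf.eq_union hF.subset_ball hρa) hf' hρa hab hb1
    (hF.compact.inter_right (isClosed_le continuous_norm continuous_const)) (fun p hp => hp.2)
    (fun s t ht => (hff s t ⟨hρ ht.1, ht.2⟩).symm)
    (fun s t ht => by
      rw [hff s t ⟨ht.1, ht.2.le⟩]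
      exact hf.mem s t ⟨ht.1, (ht.2.trans hb1).le⟩)
    hfb
    (fun s t ht => by
      rw [hnorm s t ⟨hρ (hab.le.trans ht.1), ht.2⟩]
      exact ht.1)
  simp only [htop] at h1
  rwa [hC.upper_boundary] at h1

/-- A concordance can be turned upside down. -/
theorem IsConcordance.symm (hC : IsConcordance K K' x h) :
    IsConcordance K' K (fun q => x (q.1, 1 - q.2)) fun q => 1 - h (q.1, 1 - q.2) := by
  have hm : ∀ t ∈ Icc (0 : ℝ) 1, 1 - t ∈ Icc (0 : ℝ) 1 := fun t ht =>
    ⟨by linarith [ht.2], by linarith [ht.1]⟩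
  have hWs : ContDiff ℝ ∞ fun q : ℝ × ℝ => (q.1, 1 - q.2) := by fun_prop
  have hWd : ∀ q, HasFDerivAt (fun q : ℝ × ℝ => (q.1, 1 - q.2))
      ((ContinuousLinearMap.fst ℝ ℝ ℝ).prod (-ContinuousLinearMap.snd ℝ ℝ ℝ)) q := fun q =>
    (hasFDerivAt_fst (𝕜 := ℝ)).prodMk ((hasFDerivAt_snd (𝕜 := ℝ)).const_sub 1)
  have hxd : ∀ q, HasFDerivAt x (fderiv ℝ x q) q := fun q =>
    ((hC.smooth_fst.differentiable (by simp)) _).hasFDerivAt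
  have hhd : ∀ q, HasFDerivAt h (fderiv ℝ h q) q := fun q =>
    ((hC.smooth_snd.differentiable (by simp)) _).hasFDerivAt
  have hneat : ∀ q, fderiv ℝ (fun q : ℝ × ℝ => 1 - h (q.1, 1 - q.2)) q = 0 →
      fderiv ℝ h (q.1, 1 - q.2) = 0 := by
    intro q hq
    have h1 := ((hhd (q.1, 1 - q.2)).comp q (hWd q)).const_sub 1
    have h2 : fderiv ℝ (fun q : ℝ × ℝ => 1 - h (q.1, 1 - q.2)) q = _ := h1.fderiv
    rw [h2] at hq
    refine ContinuousLinearMap.ext fun v => ?_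
    have h3 := DFunLike.congr_fun hq (v.1, -v.2)
    simpa using h3
  refine ⟨hC.smooth_fst.comp hWs, contDiff_const.sub (hC.smooth_snd.comp hWs),
    fun s t => hC.periodic_fst s _, fun s t => ?_, fun s t ht => hC.mem_sphere s _ (hm t ht),
    fun s t ht => hm _ (hC.mem_Icc s _ (hm t ht)), fun s s' t ht t' ht' h1 h2 => ?_,
    fun s t ht => ?_, fun s t ht => ?_, fun s t ht => ?_, fun s h1 => ?_, fun s h1 => ?_, ?_, ?_⟩
  · simp only [hC.periodic_snd]
  · obtain ⟨h3, h4⟩ := hC.injective s s' _ (hm t ht) _ (hm t' ht') h1 (by linarith)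
    exact ⟨by linarith, h4⟩
  · have h1 : HasFDerivAt (fun q : ℝ × ℝ => (x (q.1, 1 - q.2), 1 - h (q.1, 1 - q.2))) _ (s, t) :=
      ((hxd (s, 1 - t)).comp (s, t) (hWd (s, t))).prodMk
        (((hhd (s, 1 - t)).comp (s, t) (hWd (s, t))).const_sub 1)
    rw [h1.fderiv, injective_iff_map_eq_zero]
    intro v hv
    have h2 := hC.immersion s _ (hm t ht)
    rw [((hxd (s, 1 - t)).prodMk (hhd (s, 1 - t))).fderiv] at h2
    have h3 := congrArg Prod.fst hv
    have h4 := neg_eq_zero.1 (congrArg Prod.snd hv)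
    have h5 := (injective_iff_map_eq_zero _).1 h2 _ (Prod.ext h3 h4)
    have h6 : v.1 = 0 := (Prod.ext_iff.1 h5).1
    have h7 : -v.2 = 0 := (Prod.ext_iff.1 h5).2
    exact Prod.ext h6 (neg_eq_zero.1 h7)
  · have h1 := hC.proper_one s _ (hm t ht)
    constructor
    · intro h2
      linarith [h1.1 (by linarith)]
    · intro h2
      linarith [h1.2 (by linarith)]
  · have h1 := hC.proper_zero s _ (hm t ht)
    constructor
    · intro h2
      linarith [h1.1 (by linarith)]
    · intro h2
      linarith [h1.2 (by linarith)]
  · have h2 := hneat _ h1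
    rw [sub_zero] at h2
    exact hC.neat_one s h2
  · have h2 := hneat _ h1
    rw [sub_self] at h2
    exact hC.neat_zero s h2
  · simp only [sub_zero]
    exact hC.upper_boundary
  · simp only [sub_self]
    exact hC.lower_boundary

theorem IsCollared.symm (hcol : IsCollared x h) :
    IsCollared (fun q => x (q.1, 1 - q.2)) fun q => 1 - h (q.1, 1 - q.2) where
  bottom s t ht := by
    obtain ⟨h1, h2⟩ := hcol.top s (1 - t) (by linarith)
    exact ⟨by simpa using h1, by simp only [h2]; ring⟩
  top s t ht := by
    obtain ⟨h1, h2⟩ := hcol.bottom s (1 - t) (by linarith)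
    exact ⟨by simpa using h1, by simp only [h2]; ring⟩

/-- Concordance is symmetric, so `K` and `K'` bound surfaces of the same genera. -/
theorem fourGenus_eq_of_concordance (hC : IsConcordance K K' x h) (hcol : IsCollared x h) :
    fourGenus K = fourGenus K' := by
  have h1 : {g : ℕ | BoundsSurfaceOfGenus K g} = {g : ℕ | BoundsSurfaceOfGenus K' g} := by
    ext g
    exact ⟨fun hg => hg.of_concordance hC hcol, fun hg => hg.of_concordance hC.symm hcol.symm⟩
  rw [fourGenus, fourGenus, h1]

end Gluing

end KnotConcordance

end

/-! ### Assembly of the theorem. -/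

theorem mainTheorem4 (K K' : Set KnotConcordance.E4)
    (hK : KnotConcordance.IsKnot K) (hK' : KnotConcordance.IsKnot K')
    (hKK' : KnotConcordance.IsRibbonBandAttachment K K') :
    KnotConcordance.Concordant K K' ∧
      KnotConcordance.RibbonConcordant K K' ∧
      KnotConcordance.fourGenus K = KnotConcordance.fourGenus K' := by
  obtain ⟨γ, hγ, hγK⟩ := hK
  obtain ⟨φ, R, hφ, hR, hKT, hKR⟩ := hKK'
  obtain ⟨y, k, hyk⟩ := hR.exists_isBallCobordism
  obtain ⟨x, h, hC, hcol, hmorse⟩ :=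
    KnotConcordance.exists_collared_concordance hγ hγK hφ hyk hKT hKR
  exact ⟨⟨x, h, hC⟩, ⟨x, h, hC, fun s t _ => hmorse (s, t)⟩,
    KnotConcordance.fourGenus_eq_of_concordance hC hcol⟩
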